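/- Let $X$ be a smooth (connected) complex projective curve, let $\mathcal H$ be a vector bundle on $X$, and let $\sigma\in\mathbb Q$, $\sigma>0$. A framed module is a pair $(E,\psi)$ of a vector bundle $E$ on $X$ and a homomorphism $\psi\colon E\to\mathcal H$. For a homomorphism $\psi$ put $\delta(\psi)=1$ if $\psi\neq0$ and $\delta(\psi)=0$ if $\psi=0$. The framed module $(E,\psi)$ is $\sigma$-stable if for every proper nonzero subbundle $F\subset E$ $$\frac{\deg F-\delta(\psi|_F)\,\sigma}{\operatorname{rank}F}<\frac{\deg E-\delta(\psi)\,\sigma}{\operatorname{rank}E}.\qquad(*)$$ (This is the same as the corresponding inequality for the reduced Hilbert polynomials $(P_F-\delta(\psi|_F)\sigma)/\operatorname{rank}F$ and $(P_E-\delta(\psi)\sigma)/\operatorname{rank}E$.) An $\mathcal O_X$-twisted framed Hitchin pair $(E,\varepsilon,\phi,\psi)$ consists of a framed module $(E,\psi)$, a number $\varepsilon\in\mathbb C$ and a homomorphism $\phi\colon E\to E\otimes\mathcal O_X=E$ that is not nilpotent if $\varepsilon=0$. It is constrained if $\phi$ is an endomorphism of $(E,\psi)$, i.e. $\psi\circ\phi=w\psi$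 for some $w\in\mathbb C$. It is $\sigma$-stable if $(*)$ holds for every proper nonzero subbundle $F\subset E$ with $\phi(F)\subset F$. **Theorem.** Let $(E,\varepsilon,\phi,\psi)$ be a constrained $\mathcal O_X$-twisted framed Hitchin pair with $\psi\neq0$ (of any rank and degree). Suppose that either 1. the vector bundle $E$ is (slope) semistable, or 2. $E$ is not semistable, and the first step $E_1$ of its Harder–Narasimhan filtration $0=E_0\subset E_1\subset\cdots\subset E_n=E$ satisfies $E_1\subset\ker\psi$. Then $(E,\varepsilon,\phi,\psi)$ is $\sigma$-stable if and only if the framed module $(E,\psi)$ is $\sigma$-stable. -/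

import Mathlib

open CategoryTheory CategoryTheory.Limits AlgebraicGeometry

noncomputable section

/-- A smooth projective curve over `ℂ`: an integral scheme, proper and smooth of relative
dimension one over `Spec ℂ`. (Every such scheme is projective over `ℂ`, and conversely.) -/
structure SmoothCurve where
  X : Scheme.{0}
  toSpec : X ⟶ Spec (CommRingCat.of ℂ)
  [isIntegral : IsIntegral X]
  [isProper : IsProper toSpec]
  [smooth : SmoothOfRelativeDimension 1 toSpec]

namespace SmoothCurve

attribute [instance] isIntegral isProper smooth

variable (C : SmoothCurve)

instance isLocallyNoetherian : IsLocallyNoetherian C.X :=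
  LocallyOfFiniteType.isLocallyNoetherian C.toSpec

/-- A complex number, viewed as a constant regular function on the open set `U`. -/
def const (U : C.X.Opens) : ℂ →+* Γ(C.X, U) :=
  ((Scheme.ΓSpecIso (CommRingCat.of ℂ)).inv ≫ C.toSpec.appLE ⊤ U le_top).hom

variable {C}

/-- Restriction of a section of a sheaf of modules to a smaller open set. -/
def res (E : C.X.Modules) {U V : C.X.Opens} (h : V ≤ U) (s : Γ(E, U)) : Γ(E, V) :=
  E.presheaf.map (homOfLE h).op s

/-- The finite family `s` of sections over `U` is a frame of `E` over `U`: over every open `V ⊆ U`,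
every section of `E` is in a unique way an `𝒪(V)`-linear combination of the `s i`. In other words
`s` is an isomorphism from the free sheaf `𝒪_U ^ ι` to `E|_U`. -/
def IsFrame (E : C.X.Modules) (U : C.X.Opens) {ι : Type} [Fintype ι] (s : ι → Γ(E, U)) : Prop :=
  ∀ (V : C.X.Opens) (h : V ≤ U) (t : Γ(E, V)),
    ∃! c : ι → Γ(C.X, V), t = ∑ i, c i • res E h (s i)

/-- Vector bundles: locally free sheaves of finite rank. -/
def IsVectorBundle (E : C.X.Modules) : Prop :=
  ∀ x : C.X, ∃ (U : C.X.Opens) (_ : x ∈ U) (n : ℕ) (s : Fin n → Γ(E, U)), IsFrame E U s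

/-- The rank of a vector bundle: the number of elements of a frame over a nonempty open set. -/
def rank (E : C.X.Modules) : ℕ :=
  sInf {r | ∃ U : C.X.Opens, Nonempty U ∧ ∃ s : Fin r → Γ(E, U), IsFrame E U s}

/-- Let `b` be a frame of `E` over a nonempty open `U`, i.e. a rational frame of `E`. At the point
`x`, the rational section `b 1 ∧ ... ∧ b r` of `det E` has order `n`: there is a frame `s` of
`E` over a neighbourhood `V` of `x`, such that the matrix `A` with `b = s A` over `U ∩ V` has a
determinant of order `n` at `x`. -/
def IsOrderAt (E : C.X.Modules) {U : C.X.Opens} {r : ℕ} (b : Fin r → Γ(E, U)) (x : C.X)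
    (n : ℤ) : Prop :=
  ∃ (V : C.X.Opens) (_ : x ∈ V) (s : Fin r → Γ(E, V)) (A : Matrix (Fin r) (Fin r) Γ(C.X, U ⊓ V))
    (_ : Nonempty (U ⊓ V : C.X.Opens)),
    IsFrame E V s ∧
    (∀ j, res E inf_le_left (b j) = ∑ i, A i j • res E inf_le_right (s i)) ∧
    n = Scheme.ord (C.X.germToFunctionField (U ⊓ V) A.det) x

/-- `d` is the degree of the divisor of the rational section `b 1 ∧ ... ∧ b r` of `det E`, for some
rational frame `b` of `E`. (All closed points have degree one, and `Scheme.ord` is zero at the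
generic point.) -/
def HasDegree (E : C.X.Modules) (d : ℤ) : Prop :=
  ∃ (r : ℕ) (U : C.X.Opens) (b : Fin r → Γ(E, U)) (n : C.X → ℤ),
    Nonempty U ∧ IsFrame E U b ∧ (∀ x, IsOrderAt E b x (n x)) ∧ n.support.Finite ∧
    d = ∑ᶠ x, n x

open Classical in
/-- The degree of a vector bundle `E`, i.e. the degree of the line bundle `det E`. -/
def degree (E : C.X.Modules) : ℤ := if h : ∃ d, HasDegree E d then h.choose else 0

/-- The slope of a vector bundle. -/
def slope (E : C.X.Modules) : ℚ := degree E / rank E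

/-- A subsheaf `F` of `E` is a subbundle if, locally, some frame of `F` extends to a frame of `E`;
equivalently, `F` and `E / F` are vector bundles. -/
def IsSubbundle {E : C.X.Modules} (F : Subobject E) : Prop :=
  ∀ x : C.X, ∃ (U : C.X.Opens) (_ : x ∈ U) (m n : ℕ)
    (s : Fin m → Γ((F : C.X.Modules), U)) (t : Fin n → Γ(E, U)),
    IsFrame (F : C.X.Modules) U s ∧
    IsFrame E U (Sum.elim (fun i => F.arrow.app U (s i)) t)

/-- Slope semistability of a vector bundle. -/
def IsSemistable (E : C.X.Modules) : Prop :=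
  ∀ F : Subobject E, IsSubbundle F → F ≠ ⊥ → F ≠ ⊤ → slope (F : C.X.Modules) ≤ slope E

/-- The graded piece `E_{i+1} / E_i` of a filtration of `E`. -/
def gradedPiece {E : C.X.Modules} {n : ℕ} (p : Fin (n + 1) → Subobject E) (hp : Monotone p)
    (i : Fin n) : C.X.Modules :=
  cokernel (Subobject.ofLE (p i.castSucc) (p i.succ) (hp i.castSucc_lt_succ.le))

/-- A Harder--Narasimhan filtration `0 = E_0 ⊂ E_1 ⊂ ... ⊂ E_n = E` of a vector bundle: strictly
increasing, by subbundles, with semistable graded pieces of strictly decreasing slopes. -/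
structure HNFiltration (E : C.X.Modules) where
  n : ℕ
  piece : Fin (n + 1) → Subobject E
  strictMono : StrictMono piece
  piece_zero : piece 0 = ⊥
  piece_last : piece (Fin.last n) = ⊤
  isSubbundle : ∀ i, IsSubbundle (piece i)
  semistable : ∀ i, IsSemistable (gradedPiece piece strictMono.monotone i)
  slope_lt : ∀ i j, i < j → slope (gradedPiece piece strictMono.monotone j) <
    slope (gradedPiece piece strictMono.monotone i)

/-- A framed module `(E, ψ : E ⟶ H)`: a vector bundle with a homomorphism to `H`. -/
structure FramedModule (H : C.X.Modules) where
  E : C.X.Modules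
  isVectorBundle : IsVectorBundle E
  ψ : E ⟶ H

open Classical in
/-- The slope `(deg E - δ(ψ) σ) / rank E` of `E` with the framing `ψ`, where `δ(ψ)` is `1` if
`ψ ≠ 0` and `0` if `ψ = 0`. -/
def framedSlope (σ : ℚ) {H E : C.X.Modules} (ψ : E ⟶ H) : ℚ :=
  (degree E - (if ψ = 0 then 0 else 1) * σ) / rank E

/-- The framed module `(E, ψ)` is `σ`-stable: every proper nonzero subbundle, with the restricted
framing, has a smaller framed slope. -/
def FramedModule.IsStable {H : C.X.Modules} (M : FramedModule H) (σ : ℚ) : Prop :=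
  ∀ F : Subobject M.E, IsSubbundle F → F ≠ ⊥ → F ≠ ⊤ →
    framedSlope σ (F.arrow ≫ M.ψ) < framedSlope σ M.ψ

/-- `φ` is an endomorphism of the framed module `(E, ψ)`: there is `w : ℂ` with `ψ ∘ φ = w ψ`. -/
def FramedModule.IsEndomorphism {H : C.X.Modules} (M : FramedModule H) (φ : M.E ⟶ M.E) : Prop :=
  ∃ w : ℂ, ∀ (U : C.X.Opens) (s : Γ(M.E, U)),
    (φ ≫ M.ψ).app U s = C.const U w • M.ψ.app U s

/-- An `𝒪_X`-twisted framed Hitchin pair `(E, ε, φ, ψ)`; here `E ⊗ 𝒪_X` is identified with `E`. -/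
structure FramedHitchinPair (H : C.X.Modules) extends FramedModule H where
  ε : ℂ
  φ : E ⟶ E
  not_isNilpotent : ε = 0 → ¬ IsNilpotent (End.of φ)

namespace FramedHitchinPair

variable {H : C.X.Modules} (P : FramedHitchinPair H)

/-- The pair is constrained if its Higgs field is an endomorphism of the framed module. -/
def IsConstrained : Prop := P.toFramedModule.IsEndomorphism P.φ

/-- A subsheaf `F` of `E` is `φ`-invariant if `φ` restricts to an endomorphism of `F`. -/
def IsInvariant (F : Subobject P.E) : Prop :=
  ∃ g : (F : C.X.Modules) ⟶ (F : C.X.Modules), g ≫ F.arrow = F.arrow ≫ P.φ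

/-- The framed Hitchin pair is `σ`-stable: every proper nonzero `φ`-invariant subbundle, with the
restricted framing, has a smaller framed slope. -/
def IsStable (σ : ℚ) : Prop :=
  ∀ F : Subobject P.E, IsSubbundle F → F ≠ ⊥ → F ≠ ⊤ → P.IsInvariant F →
    framedSlope σ (F.arrow ≫ P.ψ) < framedSlope σ P.ψ

end FramedHitchinPair

end SmoothCurve

end

/-!
Only one implication needs a proof: a stable pair has to be shown to satisfy the inequality of
stability for every subbundle `F`, invariant under the Higgs field `φ` or not. Write
`c = (deg E - σ) / rank E` for the framed slope of `E`.

If `ψ` does not vanish on `F` and `E` is semistable, then `deg F / rank F ≤ deg E / rank E`, and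
`σ / rank F > σ / rank E`; so the inequality holds for `F`. If `ψ` vanishes on `F`, the inequality
reads `deg F - c * rank F < 0`. Suppose that it fails, and choose `W ⊆ ker ψ` nonzero with
`deg W - c * rank W ≥ 0` of minimal rank. For a subsheaf `A`, the homomorphism from
`W / (W ∩ φ⁻¹ A)` to `(A + φ W) / A` induced by `φ` is generically an isomorphism, so that it does
not lower the degree; as `deg - c * rank` is nonpositive on proper subsheaves of `W` by minimality,
it does not become negative when `φ W`, `φ² W`, ... are added to `W` one after the other. The
saturation of the sum of all `φᵏ W` is `φ`-invariant, and is contained in `ker ψ` because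
`ψ ∘ φ = w ψ`. It violates the stability of the pair. This is
`PlaceSystem.IsCoherent.exists_invariant` together with
`SmoothCurve.FramedHitchinPair.IsStable.twistedDeg_neg`.

If `E` is not semistable and the first step `E₁` of its Harder–Narasimhan filtration lies in
`ker ψ`, then the slope of `E₁` is at least that of `E`, hence greater than `c`, and the same
argument shows that the pair is not stable.

To compute with degrees, a subsheaf is replaced by its stalk at the generic point, a subspace of a
vector space `V` over the function field `K`. The stalks of `E` at the points `x` are lattices
`L x` in `V` over the local rings of the curve, which are principal ideal domains in `K`. The degree
of `E` is the sum of the local indices of a basis of `V` in these lattices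
(`SmoothCurve.GenericFiber.degree_eq`). It does not depend on the basis, as the degree of a
principal divisor is zero (`SmoothCurve.finsum_ord`): the local rings of the curve are exactly the
valuation rings of `K` over `ℂ`, and a nonconstant function `t` has `[K : ℂ(t)]` zeros and as many
poles. Degrees are additive in exact sequences (`PlaceSystem.IsCoherent.deg_exact`), because
determinants of block triangular matrices multiply. Subspaces of `V` correspond to saturated
subsheaves, which are the subbundles of `E`
(`SmoothCurve.GenericFiber.isSaturated_of_isSubbundle`,
`SmoothCurve.GenericFiber.isSubbundle_of_isSaturated`), and the stalks of a saturated subsheaf and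
of the quotient are the induced lattices.
-/

/-! ### Places of an algebraic function field in one variable -/

section

open Algebra

universe u

theorem finite_adjoin_of_transcendental {k K : Type u} [Field k] [Field K] [Algebra k K]
    [EssFiniteType k K] (htr : Algebra.trdeg k K ≤ 1) {t : K} (ht : Transcendental k t) :
    FiniteDimensional (IntermediateField.adjoin k {t}) K := by
  have hx : AlgebraicIndependent k (fun _ : Unit => t) :=
    (algebraicIndependent_unique_type_iff).2 ht
  have hb : IsTranscendenceBasis k (fun _ : Unit => t) :=
    hx.isTranscendenceBasis_of_lift_trdeg_le_of_finite (by simpa using htr)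
  have := hb.isAlgebraic_field
  rw [Set.range_const] at this
  have : EssFiniteType (IntermediateField.adjoin k {t}) K := .of_comp k _ _
  exact Algebra.finite_of_essFiniteType_of_isAlgebraic

open scoped IntermediateField.algebraAdjoinAdjoin

theorem isPrincipalIdealRing_adjoin {k K : Type u} [Field k] [Field K] [Algebra k K] {t : K}
    (ht : Transcendental k t) : IsPrincipalIdealRing (Algebra.adjoin k {t}) :=
  .of_surjective (Polynomial.algEquivOfTranscendental k t ht).toRingEquiv.toRingHom
    (Polynomial.algEquivOfTranscendental k t ht).surjective

/-- The prime ideal `(t)` of `k[t]`. -/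
def originIdeal (k : Type u) {K : Type u} [Field k] [Field K] [Algebra k K] (t : K) :
    Ideal (Algebra.adjoin k {t}) :=
  Ideal.span {⟨t, Algebra.self_mem_adjoin_singleton k t⟩}

/-- The residue field of `k[t]` at the origin is `k`. -/
theorem originIdeal_quotient_surjective {k K : Type u} [Field k] [Field K] [Algebra k K] (t : K) :
    Function.Surjective (algebraMap k (Algebra.adjoin k {t} ⧸ originIdeal k t)) := by
  intro y
  obtain ⟨⟨y, hy⟩, rfl⟩ := Ideal.Quotient.mk_surjective y
  induction hy using Algebra.adjoin_induction with
  | mem x hx =>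
    obtain rfl : x = t := hx
    refine ⟨0, ?_⟩
    rw [map_zero, eq_comm, Ideal.Quotient.eq_zero_iff_mem]
    exact Ideal.subset_span rfl
  | algebraMap r => exact ⟨r, rfl⟩
  | add x y hx hy h1 h2 =>
    obtain ⟨a, ha⟩ := h1
    obtain ⟨b, hb⟩ := h2
    exact ⟨a + b, by rw [map_add, ha, hb, ← map_add]; rfl⟩
  | mul x y hx hy h1 h2 =>
    obtain ⟨a, ha⟩ := h1
    obtain ⟨b, hb⟩ := h2
    exact ⟨a * b, by rw [map_mul, ha, hb, ← map_mul]; rfl⟩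

theorem originIdeal_isMaximal {k K : Type u} [Field k] [Field K] [Algebra k K] {t : K}
    (ht : Transcendental k t) : (originIdeal k t).IsMaximal := by
  have hne : originIdeal k t ≠ ⊤ := by
    intro h
    have h1 : (1 : Algebra.adjoin k {t}) ∈ originIdeal k t := by simp [h]
    obtain ⟨a, ha⟩ := Ideal.mem_span_singleton.1 h1
    obtain ⟨p, rfl⟩ := (Polynomial.algEquivOfTranscendental k t ht).surjective a
    have := congrArg ((Polynomial.algEquivOfTranscendental k t ht).symm) ha
    have e : (Polynomial.algEquivOfTranscendental k t ht) Polynomial.X =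
      ⟨t, Algebra.self_mem_adjoin_singleton k t⟩ := by ext; simp
    rw [← e, ← map_mul, AlgEquiv.symm_apply_apply, map_one] at this
    simpa using congrArg (Polynomial.eval 0) this
  have : Nontrivial (Algebra.adjoin k {t} ⧸ originIdeal k t) :=
    Ideal.Quotient.nontrivial_iff.2 hne
  apply Ideal.Quotient.maximal_of_isField
  refine ((RingEquiv.ofBijective (algebraMap k (Algebra.adjoin k {t} ⧸ originIdeal k t))
    ⟨RingHom.injective _, originIdeal_quotient_surjective t⟩).symm.toMulEquiv).isField ?_
  exact Field.toIsField k

theorem inertiaDeg_eq_one {k R S : Type u} [Field k] [IsAlgClosed k] [CommRing R] [CommRing S]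
    [Algebra R S] [Algebra.IsIntegral R S] (p : Ideal R) (q : Ideal S) [p.IsMaximal] [q.IsMaximal]
    [q.LiesOver p] (e : k ≃+* R ⧸ p) : q.inertiaDeg R = 1 := by
  rw [Ideal.inertiaDeg_eq_of_isMaximal p q]
  let : Field (R ⧸ p) := Ideal.Quotient.field _
  have : IsAlgClosed (R ⧸ p) := IsAlgClosed.of_ringEquiv k _ e
  have hb := IsAlgClosed.algebraMap_bijective_of_isIntegral (k := R ⧸ p) (K := S ⧸ q)
  rw [← (LinearEquiv.ofBijective (Algebra.linearMap (R ⧸ p) (S ⧸ q)) hb).finrank_eq]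
  simp

section
variable {k K : Type u} [Field k] [Field K] [Algebra k K] [CharZero k]

/-- The integral closure `S` of `k[t]` in a function field `K` is the coordinate ring of an affine
curve, finite over the line. -/
theorem isDedekindDomain_integralClosure_adjoin
    [EssFiniteType k K] (htr : Algebra.trdeg k K ≤ 1) {t : K} (ht : Transcendental k t) :
    IsDedekindDomain (integralClosure (Algebra.adjoin k {t}) K) ∧
    Module.Finite (Algebra.adjoin k {t}) (integralClosure (Algebra.adjoin k {t}) K) ∧
    IsFractionRing (integralClosure (Algebra.adjoin k {t}) K) K := by
  have := finite_adjoin_of_transcendental htr ht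
  have := isPrincipalIdealRing_adjoin ht
  have : CharZero (IntermediateField.adjoin k {t}) := charZero_of_injective_algebraMap
    (algebraMap k _).injective
  refine ⟨integralClosure.isDedekindDomain _ (IntermediateField.adjoin k {t}) _,
   IsIntegralClosure.finite _ (IntermediateField.adjoin k {t}) K _,
   integralClosure.isFractionRing_of_finite_extension (IntermediateField.adjoin k {t}) _⟩

/-- The number of zeros of `t`, counted with multiplicity, is the degree of `K` over `k(t)`. All
inertia degrees are one, as `k` is algebraically closed. -/
theorem sum_ramificationIdx_originIdeal [IsAlgClosed k]
    [EssFiniteType k K] (htr : Algebra.trdeg k K ≤ 1) {t : K} (ht : Transcendental k t)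
    [Fintype ((originIdeal k t).primesOver (integralClosure (Algebra.adjoin k {t}) K))] :
    ∑ q : (originIdeal k t).primesOver (integralClosure (Algebra.adjoin k {t}) K),
      q.1.ramificationIdx (Algebra.adjoin k {t}) =
        Module.finrank (IntermediateField.adjoin k {t}) K := by
  obtain ⟨h1, h2, h3⟩ := isDedekindDomain_integralClosure_adjoin htr ht
  have := isPrincipalIdealRing_adjoin ht
  have := originIdeal_isMaximal ht
  rw [IsFractionRing.finrank_eq (Algebra.adjoin k {t}) _
    (integralClosure (Algebra.adjoin k {t}) K) K,
    ← Ideal.sum_ramification_inertia_eq_finrank (originIdeal k t)]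
  refine Finset.sum_congr rfl fun q _ => ?_
  obtain ⟨q, hq, hq'⟩ := q
  have : q.IsMaximal := Ideal.IsMaximal.of_liesOver_isMaximal q (originIdeal k t)
  simp only
  suffices q.inertiaDeg (Algebra.adjoin k {t}) = 1 by simp [this]
  have : Nontrivial (Algebra.adjoin k {t} ⧸ originIdeal k t) :=
    Ideal.Quotient.nontrivial_iff.2 Ideal.IsPrime.ne_top'
  exact inertiaDeg_eq_one (originIdeal k t) q (RingEquiv.ofBijective
    (algebraMap k (Algebra.adjoin k {t} ⧸ originIdeal k t))
    ⟨RingHom.injective _, originIdeal_quotient_surjective t⟩)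

theorem finite_primesOver_originIdeal
    [EssFiniteType k K] (htr : Algebra.trdeg k K ≤ 1) {t : K} (ht : Transcendental k t) :
    Finite ((originIdeal k t).primesOver (integralClosure (Algebra.adjoin k {t}) K)) := by
  obtain ⟨h1, h2, h3⟩ := isDedekindDomain_integralClosure_adjoin htr ht
  have := originIdeal_isMaximal ht
  infer_instance
end

section
variable {K : Type*} [Field K]

/-- The localization of a Dedekind domain at a nonzero prime ideal, as a valuation subring
of the field of fractions. -/
noncomputable def primeValuationSubring (S : Type*) [CommRing S] [IsDedekindDomain S] [Algebra S K]
    [IsFractionRing S K] (q : Ideal S) [q.IsPrime] (hq : q ≠ ⊥) : ValuationSubring K where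
  toSubring := (Localization.subalgebra.ofField K q.primeCompl
    q.primeCompl_le_nonZeroDivisors).toSubring
  mem_or_inv_mem' x := by
    let B := Localization.subalgebra.ofField K q.primeCompl q.primeCompl_le_nonZeroDivisors
    have : IsLocalization.AtPrime B q :=
      Localization.subalgebra.isLocalization_ofField K q.primeCompl _
    have : IsDiscreteValuationRing B :=
      IsLocalization.AtPrime.isDiscreteValuationRing_of_dedekind_domain S hq B
    have : IsFractionRing B K := Localization.subalgebra.isFractionRing_ofField K _ _
    rcases ValuationRing.isInteger_or_isInteger B x with ⟨y, hy⟩ | ⟨y, hy⟩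
    · exact Or.inl (hy ▸ y.2)
    · exact Or.inr (hy ▸ y.2)

theorem mem_primeValuationSubring {S : Type*} [CommRing S] [IsDedekindDomain S] [Algebra S K]
    [IsFractionRing S K] (q : Ideal S) [q.IsPrime] (hq : q ≠ ⊥) (x : K) :
    x ∈ primeValuationSubring S q hq ↔
      ∃ a s : S, s ∉ q ∧ x = algebraMap S K a * (algebraMap S K s)⁻¹ := by
  change (∃ a s : S, ∃ _ : s ∈ q.primeCompl, _) ↔ _
  simp only [Ideal.mem_primeCompl_iff, exists_prop]

theorem Ring.ord_ringEquiv {A B : Type*} [CommRing A] [IsDomain A] [IsDiscreteValuationRing A]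
    [CommRing B] [IsDomain B] [IsDiscreteValuationRing B] (e : A ≃+* B) {x : A} (hx : x ≠ 0) :
    Ring.ord B (e x) = Ring.ord A x := by
  obtain ⟨ϖ, hϖ⟩ := IsDiscreteValuationRing.exists_irreducible A
  obtain ⟨n, u, rfl⟩ := IsDiscreteValuationRing.eq_unit_mul_pow_irreducible hx hϖ
  have h2 : Irreducible (e ϖ) := (MulEquiv.irreducible_iff e).2 hϖ
  rw [map_mul, map_pow, Ring.ord_mul_of_isUnit_left (u.isUnit.map e),
    Ring.ord_mul_of_isUnit_left u.isUnit,
    Ring.ord_pow (mem_nonZeroDivisors_of_ne_zero h2.ne_zero),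
    Ring.ord_pow (mem_nonZeroDivisors_of_ne_zero hϖ.ne_zero), Ring.ord_of_irreducible h2,
    Ring.ord_of_irreducible hϖ]

/-- The center of a valuation subring `A` on a ring `S` mapping to `A`. -/
def centerIdeal {S : Type*} [CommRing S] [Algebra S K] (A : ValuationSubring K)
    (h : ∀ s : S, algebraMap S K s ∈ A) : Ideal S :=
  (IsLocalRing.maximalIdeal A).comap ((algebraMap S K).codRestrict A h)

instance centerIdeal_isPrime {S : Type*} [CommRing S] [Algebra S K] (A : ValuationSubring K)
    (h : ∀ s : S, algebraMap S K s ∈ A) : (centerIdeal A h).IsPrime :=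
  Ideal.comap_isPrime _ _

theorem mem_centerIdeal {S : Type*} [CommRing S] [Algebra S K] {A : ValuationSubring K}
    {h : ∀ s : S, algebraMap S K s ∈ A} {s : S} :
    s ∈ centerIdeal A h ↔ algebraMap S K s = 0 ∨ (algebraMap S K s)⁻¹ ∉ A := by
  change (_ ∈ IsLocalRing.maximalIdeal A) ↔ _
  rw [IsLocalRing.mem_maximalIdeal, mem_nonunits_iff, isUnit_iff_exists_inv]
  by_cases h0 : algebraMap S K s = 0
  · simp only [h0, true_or, iff_true]
    rintro ⟨b, hb⟩
    have := congrArg Subtype.val hb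
    simp [h0] at this
  · simp only [h0, false_or, not_iff_not]
    constructor
    · rintro ⟨b, hb⟩
      have hb' : algebraMap S K s * b = 1 := congrArg Subtype.val hb
      rw [← eq_inv_of_mul_eq_one_right hb']
      exact b.2
    · intro hb
      exact ⟨⟨_, hb⟩, Subtype.ext (mul_inv_cancel₀ h0)⟩

/-- A valuation subring is the localization of a Dedekind domain at its center. -/
theorem primeValuationSubring_centerIdeal {S : Type*} [CommRing S] [IsDedekindDomain S]
    [Algebra S K] [IsFractionRing S K] (A : ValuationSubring K)
    (h : ∀ s : S, algebraMap S K s ∈ A) (h0 : centerIdeal A h ≠ ⊥) :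
    primeValuationSubring S (centerIdeal A h) h0 = A := by
  have hunit : ∀ s : S, s ∉ centerIdeal A h → algebraMap S K s ≠ 0 ∧ (algebraMap S K s)⁻¹ ∈ A := by
    intro s hs
    simpa [mem_centerIdeal] using hs
  ext x
  constructor
  · rw [mem_primeValuationSubring]
    rintro ⟨a, s, hs, rfl⟩
    exact mul_mem (h a) (hunit s hs).2
  · intro hx
    by_contra hxB
    have hx0 : x ≠ 0 := by
      rintro rfl
      exact hxB (zero_mem _)
    have hxi := ((primeValuationSubring S (centerIdeal A h) h0).mem_or_inv_mem x).resolve_left hxB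
    obtain ⟨a, s, hs, hxas⟩ := (mem_primeValuationSubring _ h0 _).1 hxi
    obtain ⟨hs0, hsA⟩ := hunit s hs
    have hx' : x = algebraMap S K s * (algebraMap S K a)⁻¹ := by
      rw [← inv_inv x, hxas, mul_inv, inv_inv, mul_comm]
    have ha0 : algebraMap S K a ≠ 0 := by
      intro h
      simp [h] at hx'
      exact hx0 hx'
    by_cases ha : a ∈ centerIdeal A h
    · refine ((mem_centerIdeal.1 ha).resolve_left ha0) ?_
      have : (algebraMap S K a)⁻¹ = x * (algebraMap S K s)⁻¹ := by
        rw [hx']; field_simp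
      rw [this]
      exact mul_mem hx hsA
    · exact hxB ((mem_primeValuationSubring _ h0 _).2 ⟨s, a, ha, hx'⟩)

theorem algebraMap_mem_primeValuationSubring {S : Type*} [CommRing S] [IsDedekindDomain S]
    [Algebra S K] [IsFractionRing S K] (q : Ideal S) [q.IsPrime] (hq : q ≠ ⊥) (s : S) :
    algebraMap S K s ∈ primeValuationSubring S q hq :=
  (mem_primeValuationSubring (K := K) q hq _).2
    ⟨s, 1, (Ideal.ne_top_iff_one q).1 Ideal.IsPrime.ne_top', by simp⟩

theorem centerIdeal_primeValuationSubring {S : Type*} [CommRing S] [IsDedekindDomain S]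
    [Algebra S K] [IsFractionRing S K] (q : Ideal S) [q.IsPrime] (hq : q ≠ ⊥) :
    centerIdeal (primeValuationSubring S q hq)
      (algebraMap_mem_primeValuationSubring (K := K) q hq) = q := by
  ext s
  rw [mem_centerIdeal, ← not_iff_not, not_or, not_not, mem_primeValuationSubring]
  constructor
  · rintro ⟨h0, a, b, hb, h⟩ hs
    apply hb
    have hb0 : algebraMap S K b ≠ 0 := by
      intro h'
      rw [h', inv_zero, mul_zero] at h
      exact h0 (inv_eq_zero.1 h)
    have : b = a * s := by
      apply IsFractionRing.injective S K
      rw [map_mul]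
      field_simp at h
      rw [h, mul_comm]
    rw [this]
    exact q.mul_mem_left _ hs
  · intro hs
    refine ⟨?_, 1, s, hs, by simp⟩
    intro h
    rw [(IsFractionRing.injective S K).eq_iff' (map_zero _)] at h
    exact hs (h ▸ q.zero_mem)

/-- The ramification index of a prime above a principal ideal is the order of the generator. -/
theorem ramificationIdx_eq_ord {R S : Type*} [CommRing R] [CommRing S] [IsDedekindDomain S]
    [Algebra R S] [Algebra S K] [IsFractionRing S K] (r : R) (q : Ideal S) [q.IsPrime]
    [q.LiesOver (Ideal.span {r})] (hq : q ≠ ⊥) (hr : algebraMap R S r ≠ 0) :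
    q.ramificationIdx R = (Ring.ord (primeValuationSubring S q hq)
      ⟨_, algebraMap_mem_primeValuationSubring (K := K) q hq (algebraMap R S r)⟩).toNat := by
  let B := Localization.subalgebra.ofField K q.primeCompl q.primeCompl_le_nonZeroDivisors
  have : IsLocalization.AtPrime B q :=
    Localization.subalgebra.isLocalization_ofField K q.primeCompl _
  have : IsDiscreteValuationRing B :=
    IsLocalization.AtPrime.isDiscreteValuationRing_of_dedekind_domain S hq B
  have : IsDiscreteValuationRing (Localization.AtPrime q) :=
    IsLocalization.AtPrime.isDiscreteValuationRing_of_dedekind_domain S hq _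
  rw [Ideal.ramificationIdx_eq (Ideal.span {r}), Ideal.map_span, Set.image_singleton]
  congr 1
  let e : Localization.AtPrime q ≃ₐ[S] B := IsLocalization.algEquiv q.primeCompl _ _
  have h0 : algebraMap S (Localization.AtPrime q) (algebraMap R S r) ≠ 0 := fun h =>
    hr ((IsLocalization.injective (Localization.AtPrime q)
      q.primeCompl_le_nonZeroDivisors) (h.trans (map_zero _).symm))
  refine Eq.trans ?_ (Ring.ord_ringEquiv e.toRingEquiv h0).symm |>.trans ?_
  · rw [Ring.ord, IsScalarTower.algebraMap_apply R S (Localization.AtPrime q)]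
  · have : e.toRingEquiv (algebraMap S (Localization.AtPrime q) (algebraMap R S r)) =
      algebraMap S B (algebraMap R S r) := e.commutes _
    rw [this]
    rfl
end

/-- The points of a complete normal curve, as places of its function field: `O` enumerates
the valuation subrings of `K` which contain the ground field `k`. -/
structure IsPlaceFamily (k : Type u) {K : Type u} [Field k] [Field K] [Algebra k K] {X : Type*}
    (O : X → ValuationSubring K) : Prop where
  injective : Function.Injective O
  algebraMap_mem : ∀ x (a : k), algebraMap k K a ∈ O x
  exists_eq : ∀ A : ValuationSubring K, (∀ a : k, algebraMap k K a ∈ A) → ∃ x, O x = A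

theorem exists_algebraMap_eq_of_isAlgebraic {k K : Type*} [Field k] [IsAlgClosed k] [Field K]
    [Algebra k K] {x : K} (hx : IsAlgebraic k x) : ∃ a, algebraMap k K a = x := by
  have := IntermediateField.isAlgebraic_adjoin_simple hx.isIntegral
  have h := IntermediateField.eq_bot_of_isAlgClosed_of_isAlgebraic (IntermediateField.adjoin k {x})
  exact IntermediateField.mem_bot.1 (h ▸ IntermediateField.mem_adjoin_simple_self k x)

namespace IsPlaceFamily

variable {k K : Type u} [Field k] [Field K] [Algebra k K] {X : Type*} {O : X → ValuationSubring K}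

open Classical in
/-- The order of vanishing of `t` on the local ring `A`, for `t ∈ A`; zero by convention if `t` is
not in `A`. -/
noncomputable def zeroOrd (A : ValuationSubring K) (t : K) : ℕ :=
  if h : t ∈ A then (Ring.ord A ⟨t, h⟩).toNat else 0

theorem algebraMap_integralClosure_mem (A : ValuationSubring K) (hA : ∀ a : k, algebraMap k K a ∈ A)
    {t : K} (ht : t ∈ A) (s : integralClosure (Algebra.adjoin k {t}) K) :
    algebraMap (integralClosure (Algebra.adjoin k {t}) K) K s ∈ A := by
  have h1 : ∀ r : Algebra.adjoin k {t}, (r : K) ∈ A := by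
    rintro ⟨r, hr⟩
    induction hr using Algebra.adjoin_induction with
    | mem x hx =>
      obtain rfl : x = t := hx
      exact ht
    | algebraMap r => exact hA r
    | add x y hx hy h1 h2 => exact add_mem h1 h2
    | mul x y hx hy h1 h2 => exact mul_mem h1 h2
  have h2 : IsIntegral A (s : K) := by
    obtain ⟨p, hp, hp'⟩ := s.2
    let f : Algebra.adjoin k {t} →+* A := (algebraMap _ K).codRestrict A h1
    refine ⟨p.map f, hp.map f, ?_⟩
    rw [Polynomial.eval₂_map]
    exact hp'
  obtain ⟨y, hy⟩ := IsIntegrallyClosed.isIntegral_iff.1 h2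
  rw [show algebraMap (integralClosure (Algebra.adjoin k {t}) K) K s = (s : K) from rfl, ← hy]
  exact y.2

variable [CharZero k] [Algebra.EssFiniteType k K]

/-- The zeros of `t` are the primes above the origin in the integral closure of `k[t]`: a valuation
ring that contains `k[t]` contains the integral closure and is its localization at the center. -/
theorem exists_equiv_primesOver (h : IsPlaceFamily k O) (htr : Algebra.trdeg k K ≤ 1) {t : K}
    (ht : Transcendental k t) :
    ∃ e : {x // t ∈ O x ∧ t⁻¹ ∉ O x} ≃
      (originIdeal k t).primesOver (integralClosure (Algebra.adjoin k {t}) K),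
      ∀ x, zeroOrd (O x.1) t = (e x).1.ramificationIdx (Algebra.adjoin k {t}) := by
  obtain ⟨h1, h2, h3⟩ := isDedekindDomain_integralClosure_adjoin htr ht
  have hmax := originIdeal_isMaximal ht
  have ht0 : t ≠ 0 := fun h => ht (h ▸ isAlgebraic_zero)
  let S := integralClosure (Algebra.adjoin k {t}) K
  let τ : S := algebraMap (Algebra.adjoin k {t}) S ⟨t, Algebra.self_mem_adjoin_singleton k t⟩
  have hτ : algebraMap S K τ = t := rfl
  have hmem : ∀ x : {x // t ∈ O x ∧ t⁻¹ ∉ O x}, ∀ s : S, algebraMap S K s ∈ O x.1 := fun x =>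
    algebraMap_integralClosure_mem (O x.1) (h.algebraMap_mem _) x.2.1
  have hτc : ∀ x : {x // t ∈ O x ∧ t⁻¹ ∉ O x}, τ ∈ centerIdeal (O x.1) (hmem x) := fun x =>
    mem_centerIdeal.2 (Or.inr x.2.2)
  have hτ0 : τ ≠ 0 := by
    intro h
    rw [h, map_zero] at hτ
    exact ht0 hτ.symm
  have hlies : ∀ q : Ideal S, q.IsPrime → τ ∈ q → q.LiesOver (originIdeal k t) := by
    intro q hq hqτ
    refine ⟨hmax.eq_of_le (Ideal.IsPrime.ne_top inferInstance) ?_⟩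
    rw [originIdeal, Ideal.span_singleton_le_iff_mem]
    exact hqτ
  have hτq : ∀ q ∈ (originIdeal k t).primesOver S, τ ∈ q := by
    rintro q ⟨hq, hq'⟩
    have : (⟨t, Algebra.self_mem_adjoin_singleton k t⟩ : Algebra.adjoin k {t}) ∈ q.under _ := by
      rw [← hq'.over]
      exact Ideal.subset_span rfl
    exact this
  have hqb : ∀ q : Ideal S, τ ∈ q → q ≠ ⊥ := by
    rintro q hq rfl
    exact hτ0 hq
  let f : {x // t ∈ O x ∧ t⁻¹ ∉ O x} → (originIdeal k t).primesOver S := fun x =>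
    ⟨centerIdeal (O x.1) (hmem x), inferInstance, hlies _ inferInstance (hτc x)⟩
  have hfO : ∀ x, primeValuationSubring S (f x).1 (hqb _ (hτc x)) = O x.1 := fun x =>
    primeValuationSubring_centerIdeal (O x.1) (hmem x) (hqb _ (hτc x))
  have hf : Function.Bijective f := by
    constructor
    · intro x y hxy
      apply Subtype.ext
      apply h.injective
      rw [← hfO x, ← hfO y]
      congr 1
      exact congrArg Subtype.val hxy
    · rintro ⟨q, hq, hq'⟩
      have hτq' := hτq q ⟨hq, hq'⟩
      obtain ⟨x, hx⟩ := h.exists_eq (primeValuationSubring S q (hqb q hτq')) (fun a =>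
        algebraMap_mem_primeValuationSubring (K := K) q (hqb q hτq') (algebraMap k S a))
      have hc := centerIdeal_primeValuationSubring (K := K) q (hqb q hτq')
      have htx : t ∈ O x ∧ t⁻¹ ∉ O x := by
        rw [hx]
        refine ⟨algebraMap_mem_primeValuationSubring (K := K) q (hqb q hτq') τ, ?_⟩
        rw [← hc, mem_centerIdeal] at hτq'
        exact hτq'.resolve_left (fun h => ht0 (hτ.symm.trans h))
      refine ⟨⟨x, htx⟩, Subtype.ext ?_⟩
      refine Eq.trans ?_ hc
      ext s
      simp only [f, mem_centerIdeal, hx]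
  refine ⟨Equiv.ofBijective f hf, fun x => ?_⟩
  have hP : (f x).1.IsPrime := (f x).2.1
  have hL : (f x).1.LiesOver (Ideal.span
      {(⟨t, Algebra.self_mem_adjoin_singleton k t⟩ : Algebra.adjoin k {t})}) := (f x).2.2
  rw [Equiv.ofBijective_apply, ramificationIdx_eq_ord (K := K)
    ⟨t, Algebra.self_mem_adjoin_singleton k t⟩ (f x).1 (hqb _ (hτc x)) hτ0]
  have key : ∀ (A B : ValuationSubring K) (hB : t ∈ B), B = A → zeroOrd A t =
    (Ring.ord B ⟨t, hB⟩).toNat := by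
    rintro A B hB rfl
    rw [zeroOrd, dif_pos hB]
  exact key _ _ _ (hfO x)

theorem finite_setOf_zero (h : IsPlaceFamily k O) (htr : Algebra.trdeg k K ≤ 1) {t : K}
    (ht : Transcendental k t) : {x | t ∈ O x ∧ t⁻¹ ∉ O x}.Finite := by
  obtain ⟨e, -⟩ := h.exists_equiv_primesOver htr ht
  have := finite_primesOver_originIdeal htr ht
  exact Finite.of_equiv _ e.symm

theorem finsum_zeroOrd [IsAlgClosed k] (h : IsPlaceFamily k O) (htr : Algebra.trdeg k K ≤ 1) {t : K}
    (ht : Transcendental k t) :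
    ∑ᶠ x : {x // t ∈ O x ∧ t⁻¹ ∉ O x}, zeroOrd (O x.1) t =
      Module.finrank (IntermediateField.adjoin k {t}) K := by
  obtain ⟨e, he⟩ := h.exists_equiv_primesOver htr ht
  have := finite_primesOver_originIdeal htr ht
  have := Fintype.ofFinite ((originIdeal k t).primesOver (integralClosure (Algebra.adjoin k {t}) K))
  rw [← sum_ramificationIdx_originIdeal htr ht, ← finsum_eq_sum_of_fintype]
  exact finsum_eq_of_bijective e e.bijective he

/-- The poles of `f` are the zeros of `f⁻¹`, of which there are finitely many. -/
theorem finite_setOf_notMem [IsAlgClosed k] (h : IsPlaceFamily k O) (htr : Algebra.trdeg k K ≤ 1)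
    (f : K) : {x | f ∉ O x}.Finite := by
  by_cases hf : Transcendental k f
  · have h0 : f ≠ 0 := fun h => hf (h ▸ isAlgebraic_zero)
    have hf' : Transcendental k f⁻¹ := fun h => hf (IsAlgebraic.inv_iff.1 h)
    refine (h.finite_setOf_zero htr hf').subset fun x hx => ?_
    refine ⟨((O x).mem_or_inv_mem f).resolve_left hx, by rwa [inv_inv]⟩
  · have h1 : IsAlgebraic k f := not_not.1 hf
    obtain ⟨a, rfl⟩ := exists_algebraMap_eq_of_isAlgebraic h1
    simp [h.algebraMap_mem]

/-- Principal divisors have degree zero: `t` has as many zeros as poles, since both numbers are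
the degree of `K` over `k(t) = k(t⁻¹)`. The function `ord` is the extension of `zeroOrd` that is
additive on products. -/
theorem finsum_eq_zero [IsAlgClosed k] (h : IsPlaceFamily k O) (htr : Algebra.trdeg k K ≤ 1)
    (ord : X → K → ℤ) (ord_mul : ∀ x f g, f ≠ 0 → g ≠ 0 → ord x (f * g) = ord x f + ord x g)
    (ord_zero : ∀ x f, f ∈ O x → f⁻¹ ∉ O x → ord x f = zeroOrd (O x) f)
    (ord_unit : ∀ x f, f ∈ O x → f⁻¹ ∈ O x → ord x f = 0) {t : K} (ht : t ≠ 0) :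
    ∑ᶠ x, ord x t = 0 := by
  by_cases hf : Transcendental k t
  · have hf' : Transcendental k t⁻¹ := fun h => hf (IsAlgebraic.inv_iff.1 h)
    have hinv : ∀ x, ord x t = - ord x t⁻¹ := by
      intro x
      have h1 := ord_mul x t t⁻¹ ht (inv_ne_zero ht)
      rw [mul_inv_cancel₀ ht, ord_unit x 1 (one_mem _) (by simp)] at h1
      linarith
    let z : K → X → ℤ := fun s => {x | s ∈ O x ∧ s⁻¹ ∉ O x}.indicator fun x => zeroOrd (O x) s
    have hz : ∀ s : K, Transcendental k s → (z s).support.Finite ∧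
        ∑ᶠ x, z s x = Module.finrank (IntermediateField.adjoin k {s}) K := by
      intro s hs
      have hfin := h.finite_setOf_zero htr hs
      refine ⟨hfin.subset Set.support_indicator_subset, ?_⟩
      have : Finite {x // s ∈ O x ∧ s⁻¹ ∉ O x} := hfin
      rw [← h.finsum_zeroOrd htr hs, ← finsum_mem_def, ← finsum_set_coe_eq_finsum_mem]
      exact ((Nat.castAddMonoidHom ℤ).map_finsum_of_injective
        Nat.cast_injective _).symm
    have hz' : ∀ x, ord x t = z t x - z t⁻¹ x := by
      intro x
      simp only [z, Set.indicator, Set.mem_ofPred_eq, inv_inv]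
      by_cases h1 : t ∈ O x <;> by_cases h2 : t⁻¹ ∈ O x
      · simp [h1, h2, ord_unit]
      · simp [h1, h2, ord_zero]
      · rw [hinv, ord_zero x t⁻¹ h2 (by rwa [inv_inv])]
        simp [h1, h2]
      · exact absurd (((O x).mem_or_inv_mem t).resolve_left h1) h2
    obtain ⟨hz1, hz2⟩ := hz t hf
    obtain ⟨hz3, hz4⟩ := hz t⁻¹ hf'
    have hadj : IntermediateField.adjoin k {t⁻¹} = IntermediateField.adjoin k {t} := by
      apply le_antisymm
      · rw [IntermediateField.adjoin_simple_le_iff]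
        exact inv_mem (IntermediateField.mem_adjoin_simple_self k t)
      · rw [IntermediateField.adjoin_simple_le_iff, ← inv_mem_iff]
        exact IntermediateField.mem_adjoin_simple_self k t⁻¹
    simp only [hz']
    rw [finsum_sub_distrib hz1 hz3, hz2, hz4, hadj, sub_self]
  · have h1 : IsAlgebraic k t := not_not.1 hf
    obtain ⟨a, rfl⟩ := exists_algebraMap_eq_of_isAlgebraic h1
    rw [← finsum_zero (α := X)]
    refine finsum_congr fun x => ord_unit x _ (h.algebraMap_mem x a) ?_
    rw [← map_inv₀]
    exact h.algebraMap_mem x _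

end IsPlaceFamily

end

/-! ### Local rings and orders of vanishing on a curve -/

noncomputable section

open scoped IntermediateField.algebraAdjoinAdjoin

/-- The local rings of an étale algebra over a principal ideal domain have principal maximal
ideals. -/
theorem isPrincipalIdealRing_of_etale (A B : Type*) [CommRing A] [IsDomain A]
    [IsPrincipalIdealRing A] [CommRing B] [IsDomain B] [Algebra A B] [Algebra.Etale A B]
    (q : Ideal B) [q.IsPrime] : IsPrincipalIdealRing (Localization.AtPrime q) := by
  have : IsNoetherianRing B := Algebra.FiniteType.isNoetherianRing A B
  let p := q.under A
  let : Algebra (Localization.AtPrime p) (Localization.AtPrime q) :=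
    Localization.AtPrime.algebraOfLiesOver p q
  have h := (Algebra.isUnramifiedAt_iff_map_eq A p q).1 inferInstance
  have hp : (IsLocalRing.maximalIdeal (Localization.AtPrime q)).IsPrincipal := by
    rw [← h.2]
    obtain ⟨a, ha⟩ := IsPrincipalIdealRing.principal p
    rw [ha]
    refine ⟨algebraMap A _ a, ?_⟩
    rw [Ideal.submodule_span_eq, Ideal.map_span, Set.image_singleton]
  exact ((tfae_of_isNoetherianRing_of_isLocalRing_of_isDomain
    (Localization.AtPrime q)).out 4 0).1 hp

theorem trdeg_le_one_of_isAlgebraic_adjoin {k K : Type*} [Field k] [Field K] [Algebra k K] (s : K)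
    [Algebra.IsAlgebraic (IntermediateField.adjoin k {s}) K] : Algebra.trdeg k K ≤ 1 := by
  have : Algebra.IsAlgebraic (Algebra.adjoin k {s}) K :=
    .trans _ (IntermediateField.adjoin k {s}) _
  simpa using Algebra.IsAlgebraic.trdeg_le_cardinalMk k (A := K) {s}

/-- If `B` is étale over the affine line, its field of fractions is separable algebraic over a
simple extension of the ground field. -/
theorem trdeg_le_one_of_etale (k : Type) {B K : Type} [Field k] [CommRing B] [Field K]
    [Algebra k B] [Algebra B K] [Algebra k K] [IsScalarTower k B K] [IsFractionRing B K]
    (g : MvPolynomial (Fin 1) k →ₐ[k] B) (hg : g.Etale) :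
    Algebra.EssFiniteType k K ∧ Algebra.trdeg k K ≤ 1 := by
  have : Algebra.FiniteType k B := by
    have h1 : g.toRingHom.FiniteType := by
      algebraize [g.toRingHom]
      exact RingHom.finiteType_algebraMap.2
        (inferInstance : Algebra.FiniteType (MvPolynomial (Fin 1) k) B)
    have h2 := h1.comp (RingHom.finiteType_algebraMap.2
      (inferInstance : Algebra.FiniteType k (MvPolynomial (Fin 1) k)))
    rw [AlgHom.toRingHom_eq_coe, g.comp_algebraMap] at h2
    exact RingHom.finiteType_algebraMap.1 h2
  have : Algebra.EssFiniteType B K := .of_isLocalization _ (nonZeroDivisors B)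
  have hE : Algebra.EssFiniteType k K := .comp k B K
  refine ⟨hE, ?_⟩
  let s : K := algebraMap B K (g (MvPolynomial.X 0))
  let L := IntermediateField.adjoin k {s}
  let gL : MvPolynomial (Fin 1) k →ₐ[k] L :=
    MvPolynomial.aeval fun _ => ⟨s, IntermediateField.mem_adjoin_simple_self k s⟩
  let gK : MvPolynomial (Fin 1) k →ₐ[k] K := (IsScalarTower.toAlgHom k B K).comp g
  algebraize [g.toRingHom, gL.toRingHom, gK.toRingHom]
  have t1 : IsScalarTower (MvPolynomial (Fin 1) k) B K := .of_algebraMap_eq' rfl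
  have t2 : IsScalarTower (MvPolynomial (Fin 1) k) L K := by
    refine .of_algebraMap_eq' ?_
    change gK.toRingHom = (L.val.comp gL).toRingHom
    congr 1
    ext i
    simp [gK, gL, Subsingleton.elim i 0, s]
  have u1 : Algebra.FormallyUnramified B K := .of_isLocalization (nonZeroDivisors B)
  have u2 : Algebra.FormallyUnramified (MvPolynomial (Fin 1) k) K := .comp _ B K
  have u3 : Algebra.FormallyUnramified L K := .of_restrictScalars (MvPolynomial (Fin 1) k) L K
  have u4 : Algebra.EssFiniteType L K := .of_comp k L K
  have u5 : Algebra.IsSeparable L K := Algebra.FormallyUnramified.isSeparable L K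
  exact trdeg_le_one_of_isAlgebraic_adjoin s

namespace SmoothCurve
variable (C : SmoothCurve)

/-- Locally, a smooth curve is étale over the affine line. -/
theorem exists_etale (x : C.X) : ∃ (V : C.X.Opens) (_ : IsAffineOpen V) (_ : x ∈ V)
    (g : MvPolynomial (Fin 1) ℂ →+* Γ(C.X, V)), g.comp MvPolynomial.C = C.const V ∧ g.Etale := by
  obtain ⟨U, hU, V, hV, hx, e, hf⟩ :=
    SmoothOfRelativeDimension.exists_isStandardSmoothOfRelativeDimension (n := 1) (f := C.toSpec) x
  obtain rfl : U = ⊤ := by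
    ext y
    have : y = C.toSpec x := Subsingleton.elim (α := PrimeSpectrum ℂ) _ _
    subst this
    simpa using e hx
  have h0 : RingHom.IsStandardSmoothOfRelativeDimension 0
      (Scheme.ΓSpecIso (CommRingCat.of ℂ)).inv.hom :=
    RingHom.IsStandardSmoothOfRelativeDimension.equiv
      (Scheme.ΓSpecIso (CommRingCat.of ℂ)).symm.commRingCatIsoToRingEquiv
  have h1 : RingHom.IsStandardSmoothOfRelativeDimension 1 (C.const V) := by
    have := hf.comp h0
    exact this
  obtain ⟨g, hg, hg'⟩ := h1.exists_etale_mvPolynomial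
  exact ⟨V, hV, hx, g, hg, hg'⟩

instance stalk_isPrincipalIdealRing (x : C.X) : IsPrincipalIdealRing (C.X.presheaf.stalk x) := by
  obtain ⟨V, hV, hx, g, hg, hg'⟩ := C.exists_etale x
  algebraize [g]
  have : Nonempty V := ⟨⟨x, hx⟩⟩
  have : IsPrincipalIdealRing (MvPolynomial (Fin 1) ℂ) :=
    .of_surjective (MvPolynomial.uniqueAlgEquiv ℂ (Fin 1)).symm.toRingEquiv.toRingHom
      (MvPolynomial.uniqueAlgEquiv ℂ (Fin 1)).symm.surjective
  let y : V := ⟨x, hx⟩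
  have := hV.isLocalization_stalk y
  have h1 := isPrincipalIdealRing_of_etale (MvPolynomial (Fin 1) ℂ) Γ(C.X, V)
    (hV.primeIdealOf y).asIdeal
  let _ := TopCat.Presheaf.algebra_section_stalk C.X.presheaf y
  exact .of_surjective (IsLocalization.algEquiv (hV.primeIdealOf y).asIdeal.primeCompl
    (Localization.AtPrime (hV.primeIdealOf y).asIdeal) (C.X.presheaf.stalk x)).toRingEquiv.toRingHom
     (IsLocalization.algEquiv _ _ _).surjective

/-- The function field of a curve contains the complex numbers. -/
instance functionFieldAlgebra : Algebra ℂ C.X.functionField :=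
  have : Nonempty (⊤ : C.X.Opens) := ⟨⟨genericPoint C.X, trivial⟩⟩
  ((C.X.germToFunctionField ⊤).hom.comp (C.const ⊤)).toAlgebra

instance nonempty_top : Nonempty (⊤ : C.X.Opens) := ⟨⟨genericPoint C.X, trivial⟩⟩

theorem germ_const (V : C.X.Opens) [Nonempty V] (a : ℂ) :
    C.X.germToFunctionField V (C.const V a) = algebraMap ℂ C.X.functionField a := by
  have h : C.const V a = C.X.presheaf.map (homOfLE le_top).op (C.const ⊤ a) := by
    have := Scheme.Hom.appLE_map C.toSpec (U := ⊤) (V := ⊤) (V' := V) le_top (homOfLE le_top).op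
    exact congr((ConcreteCategory.hom $this.symm)
      ((Scheme.ΓSpecIso (CommRingCat.of ℂ)).inv a))
  rw [h]
  exact TopCat.Presheaf.germ_res_apply _ _ _ _ _

theorem essFiniteType_trdeg_functionField :
    Algebra.EssFiniteType ℂ C.X.functionField ∧ Algebra.trdeg ℂ C.X.functionField ≤ 1 := by
  obtain ⟨V, hV, hx, g, hg, hg'⟩ := C.exists_etale (genericPoint C.X)
  have : Nonempty V := ⟨⟨_, hx⟩⟩
  algebraize [C.const V]
  have : IsScalarTower ℂ Γ(C.X, V) C.X.functionField :=
    .of_algebraMap_eq fun a => (C.germ_const V a).symm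
  have := functionField_isFractionRing_of_isAffineOpen C.X V hV
  exact trdeg_le_one_of_etale ℂ (B := Γ(C.X, V)) ⟨g, fun a => congr($hg a)⟩ hg'

theorem toSpec_eq : C.toSpec = C.X.toSpecΓ ≫ Spec.map (CommRingCat.ofHom (C.const ⊤)) := by
  have : CommRingCat.ofHom (C.const ⊤) =
      (Scheme.ΓSpecIso (CommRingCat.of ℂ)).inv ≫ C.toSpec.appTop := by
    rw [Scheme.Hom.appTop, ← Scheme.Hom.appLE_eq_app]
    rfl
  rw [this, Spec.map_comp, ← Scheme.toSpecΓ_naturality_assoc, toSpecΓ_SpecMap_ΓSpecIso_inv,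
    Category.comp_id]

/-- The local ring of `X` at a point, as a valuation subring of the function field. -/
def place (x : C.X) : ValuationSubring C.X.functionField where
  toSubring := (algebraMap (C.X.presheaf.stalk x) C.X.functionField).range
  mem_or_inv_mem' f := by
    have : ValuationRing (C.X.presheaf.stalk x) := inferInstance
    exact ValuationRing.isInteger_or_isInteger (C.X.presheaf.stalk x) f

theorem algebraMap_mem_place (x : C.X) (a : C.X.presheaf.stalk x) :
    algebraMap (C.X.presheaf.stalk x) C.X.functionField a ∈ C.place x := ⟨a, rfl⟩

/-- The local ring at `x` is isomorphic to its image in the function field. -/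
def stalkEquivPlace (x : C.X) : C.X.presheaf.stalk x ≃+* C.place x :=
  RingEquiv.ofBijective ((algebraMap (C.X.presheaf.stalk x) C.X.functionField).codRestrict
    (C.place x) (C.algebraMap_mem_place x))
    ⟨fun _ _ h => IsFractionRing.injective (C.X.presheaf.stalk x) C.X.functionField
      (congrArg Subtype.val h), fun ⟨_, a, ha⟩ => ⟨a, Subtype.ext ha⟩⟩

instance place_isPrincipalIdealRing (x : C.X) : IsPrincipalIdealRing (C.place x) :=
  .of_surjective (C.stalkEquivPlace x).toRingHom (C.stalkEquivPlace x).surjective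

/-- The structure map from the complex numbers to a local ring. -/
def constStalk (x : C.X) : ℂ →+* C.X.presheaf.stalk x :=
  (C.X.presheaf.germ ⊤ x trivial).hom.comp (C.const ⊤)

theorem algebraMap_constStalk (x : C.X) (a : ℂ) :
    algebraMap (C.X.presheaf.stalk x) C.X.functionField (C.constStalk x a) =
      algebraMap ℂ C.X.functionField a :=
  Scheme.algebraMap_germ_eq_germToFunctionField (X := C.X) _ _

theorem fromSpecStalk_toSpec (x : C.X) : C.X.fromSpecStalk x ≫ C.toSpec =
    Spec.map (CommRingCat.ofHom (C.constStalk x)) := by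
  rw [toSpec_eq, Scheme.fromSpecStalk_toSpecΓ_assoc, ← Spec.map_comp]
  rfl

/-- The inclusion of the generic point. -/
def fromGenericPoint : Spec (CommRingCat.of C.X.functionField) ⟶ C.X :=
  C.X.fromSpecStalk (genericPoint C.X)

theorem specMap_algebraMap_fromSpecStalk (x : C.X) :
    Spec.map (CommRingCat.ofHom (algebraMap (C.X.presheaf.stalk x) C.X.functionField)) ≫
      C.X.fromSpecStalk x = C.fromGenericPoint :=
  Scheme.SpecMap_stalkSpecializes_fromSpecStalk ((genericPoint_spec C.X).specializes trivial)

theorem fromGenericPoint_toSpec : C.fromGenericPoint ≫ C.toSpec =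
    Spec.map (CommRingCat.ofHom (algebraMap ℂ C.X.functionField)) :=
  C.fromSpecStalk_toSpec (genericPoint C.X)

/-- A curve is separated, so its points are determined by their local rings. -/
theorem place_injective : Function.Injective C.place := by
  intro x y hxy
  -- both points are the image of the closed point under the unique extension of the generic point
  have key (A : ValuationSubring C.X.functionField) (z : C.X) (hz : C.place z = A) :
      ∃ f : Spec (CommRingCat.of A) ⟶ C.X,
        Spec.map (CommRingCat.ofHom (algebraMap A C.X.functionField)) ≫ f = C.fromGenericPoint ∧
        (∃ i : ℂ →+* A, f ≫ C.toSpec = Spec.map (CommRingCat.ofHom i)) ∧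
        f (IsLocalRing.closedPoint A) = z := by
    subst hz
    let g : C.X.presheaf.stalk z ⟶ CommRingCat.of (C.place z) :=
      CommRingCat.ofHom (C.stalkEquivPlace z).toRingHom
    refine ⟨Spec.map g ≫ C.X.fromSpecStalk z, ?_,
      ⟨(C.stalkEquivPlace z).toRingHom.comp (C.constStalk z), ?_⟩, ?_⟩
    · rw [← specMap_algebraMap_fromSpecStalk C z, ← Spec.map_comp_assoc]
      rfl
    · rw [Category.assoc, fromSpecStalk_toSpec, ← Spec.map_comp]
      rfl
    · have : IsLocalHom g.hom := ⟨fun a ha => (isUnit_map_iff (C.stalkEquivPlace z) a).1 ha⟩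
      have h : Spec.map g (IsLocalRing.closedPoint (C.place z)) =
          IsLocalRing.closedPoint (C.X.presheaf.stalk z) := IsLocalRing.comap_closedPoint g.hom
      exact (congrArg _ h).trans Scheme.fromSpecStalk_closedPoint
  obtain ⟨f, hf, ⟨i, hi⟩, hx⟩ := key (C.place x) x rfl
  obtain ⟨g, hg, ⟨j, hj⟩, hy⟩ := key (C.place x) y hxy.symm
  have hij : i = j := by
    have h1 : Spec.map (CommRingCat.ofHom (algebraMap (C.place x) C.X.functionField)) ≫
        Spec.map (CommRingCat.ofHom i) =
        Spec.map (CommRingCat.ofHom (algebraMap (C.place x) C.X.functionField)) ≫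
        Spec.map (CommRingCat.ofHom j) := by
      rw [← hi, ← hj, ← Category.assoc, hf, ← Category.assoc, hg]
    rw [← Spec.map_comp, ← Spec.map_comp] at h1
    have h2 := Spec.map_injective h1
    ext a
    exact congr($h2 a)
  subst hij
  have w : CommSq C.fromGenericPoint
      (Spec.map (CommRingCat.ofHom (algebraMap (C.place x) C.X.functionField)))
      C.toSpec (Spec.map (CommRingCat.ofHom i)) := ⟨by rw [← hf, Category.assoc, hi]⟩
  have hu := IsSeparated.valuativeCriterion C.toSpec
    { R := C.place x, K := C.X.functionField, commSq := w, .. }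
  have hfg : f = g := congrArg CommSq.LiftStruct.l (hu.elim ⟨f, hf, hi⟩ ⟨g, hg, hj⟩)
  rw [← hx, ← hy, hfg]

/-- By the valuative criterion, every valuation ring over `ℂ` in the function field of a proper curve
is the local ring of a point. -/
theorem exists_place_eq (A : ValuationSubring C.X.functionField)
    (hA : ∀ a : ℂ, algebraMap ℂ C.X.functionField a ∈ A) : ∃ x, C.place x = A := by
  let i₂ : ℂ →+* A := (algebraMap ℂ C.X.functionField).codRestrict A hA
  have w : CommSq C.fromGenericPoint
      (Spec.map (CommRingCat.ofHom (algebraMap A C.X.functionField)))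
      C.toSpec (Spec.map (CommRingCat.ofHom i₂)) := ⟨by
    rw [fromGenericPoint_toSpec, ← Spec.map_comp]
    rfl⟩
  have hex : ValuativeCriterion.Existence C.toSpec := by
    have h : UniversallyClosed C.toSpec := inferInstance
    rw [UniversallyClosed.eq_valuativeCriterion] at h
    exact h.1
  obtain ⟨l, hl₁, hl₂⟩ := (hex { R := A, K := C.X.functionField, commSq := w, .. }).exists_lift
  dsimp only at l hl₁ hl₂
  let x := l (IsLocalRing.closedPoint A)
  let φ : C.X.presheaf.stalk x ⟶ CommRingCat.of A := Scheme.stalkClosedPointTo l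
  have hφl : Spec.map φ ≫ C.X.fromSpecStalk x = l := Scheme.Spec_stalkClosedPointTo_fromSpecStalk _
  have hφ : φ ≫ CommRingCat.ofHom (algebraMap A C.X.functionField) =
      CommRingCat.ofHom (algebraMap (C.X.presheaf.stalk x) C.X.functionField) := by
    apply Spec.map_injective
    rw [← cancel_mono (C.X.fromSpecStalk x), Spec.map_comp, Category.assoc, hφl, hl₁,
      ← specMap_algebraMap_fromSpecStalk C x]
  have hφ' (a : C.X.presheaf.stalk x) : ((φ a : A) : C.X.functionField) =
    algebraMap (C.X.presheaf.stalk x) C.X.functionField a := congr($hφ a)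
  have hloc : IsLocalHom φ.hom := inferInstanceAs (IsLocalHom (Scheme.stalkClosedPointTo l).hom)
  have hle : C.place x ≤ A := by
    rintro _ ⟨a, rfl⟩
    rw [← hφ' a]
    exact (φ a : A).2
  refine ⟨x, le_antisymm hle fun f hf => ?_⟩
  -- the local ring at `x` is a valuation ring dominated by `A`
  by_contra hfx
  have h0 : f ≠ 0 := fun h => hfx (h ▸ zero_mem _)
  obtain ⟨a, ha⟩ := ((C.place x).mem_or_inv_mem f).resolve_left hfx
  have hu : IsUnit (φ a) := by
    refine IsUnit.of_mul_eq_one (⟨f, hf⟩ : A) (Subtype.ext ?_)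
    change ((φ a : A) : C.X.functionField) * f = 1
    rw [hφ', ha, inv_mul_cancel₀ h0]
  obtain ⟨b, hb⟩ := (isUnit_of_map_unit φ.hom a hu).exists_right_inv
  refine hfx ⟨b, ?_⟩
  have := congrArg (algebraMap (C.X.presheaf.stalk x) C.X.functionField) hb
  rw [map_mul, ha, map_one] at this
  field_simp at this
  exact this

/-- The generic point corresponds to the trivial valuation ring. -/
theorem isPlaceFamily : IsPlaceFamily ℂ C.place where
  injective := C.place_injective
  algebraMap_mem x a := by
    rw [← C.algebraMap_constStalk x]
    exact C.algebraMap_mem_place x _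
  exists_eq := C.exists_place_eq

theorem ord_algebraMap {x : C.X} (hx : Order.coheight x = 1) {a : C.X.presheaf.stalk x}
    (ha : a ≠ 0) : Scheme.ord (algebraMap (C.X.presheaf.stalk x) C.X.functionField a) x =
      (Ring.ord (C.X.presheaf.stalk x) a).toNat := by
  have hd : Ring.KrullDimLE 1 (C.X.presheaf.stalk x) := krullDimLE_of_coheight_le hx.le
  have ha' : algebraMap (C.X.presheaf.stalk x) C.X.functionField a ≠ 0 := by simpa using ha
  obtain ⟨m, hm⟩ := ENat.ne_top_iff_exists.mp
    (Ring.ord_ne_top (a := a) (mem_nonZeroDivisors_of_ne_zero ha))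
  rw [Scheme.ord_eq_iff hx ha', Scheme.ordHom, Ring.ordFrac_eq_ord _ ha,
    Ring.ordMonoidWithZeroHom_eq_coe _ (mem_nonZeroDivisors_of_ne_zero ha) hm.symm, ← hm]
  rfl

theorem ord_nonneg {x : C.X} {f : C.X.functionField} (hf : f ∈ C.place x) :
    0 ≤ Scheme.ord f x := by
  obtain ⟨a, rfl⟩ := hf
  by_cases hx : Order.coheight x = 1
  · rcases eq_or_ne a 0 with rfl | ha
    · simp
    · rw [C.ord_algebraMap hx ha]
      positivity
  · simp [hx]

theorem ord_eq_zero {x : C.X} {f : C.X.functionField} (hf : f ∈ C.place x)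
    (hf' : f⁻¹ ∈ C.place x) : Scheme.ord f x = 0 := by
  rcases eq_or_ne f 0 with rfl | h0
  · simp
  have h := Scheme.ord_mul (x := x) h0 (inv_ne_zero h0)
  have h1 := Scheme.ord_mul (x := x) (one_ne_zero (α := C.X.functionField)) one_ne_zero
  rw [mul_one] at h1
  rw [mul_inv_cancel₀ h0] at h
  linarith [C.ord_nonneg hf, C.ord_nonneg hf']

theorem ord_eq_zeroOrd {x : C.X} {f : C.X.functionField} (hf : f ∈ C.place x)
    (hf' : f⁻¹ ∉ C.place x) : Scheme.ord f x = IsPlaceFamily.zeroOrd (C.place x) f := by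
  have h0 : f ≠ 0 := by
    rintro rfl
    exact hf' (by simp)
  have hn : ¬ IsField (C.X.presheaf.stalk x) := fun h => by
    obtain ⟨a, rfl⟩ := hf
    obtain ⟨b, hb⟩ := h.mul_inv_cancel (a := a) (by rintro rfl; simp at h0)
    refine hf' ⟨b, eq_inv_of_mul_eq_one_right ?_⟩
    rw [← map_mul, hb, map_one]
  have hx : Order.coheight x = 1 := by
    have := IsPrincipalIdealRing.ringKrullDim_eq_one _ hn
    rw [ringKrullDim_stalk_eq_coheight] at this
    exact_mod_cast this
  have : IsDiscreteValuationRing (C.X.presheaf.stalk x) :=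
    { not_a_field' := fun h => hn (IsLocalRing.isField_iff_maximalIdeal_eq.2 h) }
  have : IsDiscreteValuationRing (C.place x) :=
    IsDiscreteValuationRing.RingEquivClass.isDiscreteValuationRing (C.stalkEquivPlace x)
  obtain ⟨a, ha⟩ := id hf
  have ha0 : a ≠ 0 := by
    rintro rfl
    exact h0 (by rw [← ha, map_zero])
  rw [IsPlaceFamily.zeroOrd, dif_pos hf]
  have he : (⟨f, hf⟩ : C.place x) = C.stalkEquivPlace x a := Subtype.ext ha.symm
  rw [he, Ring.ord_ringEquiv (C.stalkEquivPlace x) ha0, ← ha, C.ord_algebraMap hx ha0]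

theorem finite_setOf_notMem_place (f : C.X.functionField) : {x | f ∉ C.place x}.Finite :=
  have := C.essFiniteType_trdeg_functionField.1
  C.isPlaceFamily.finite_setOf_notMem C.essFiniteType_trdeg_functionField.2 f

/-- The degree of a principal divisor is zero. -/
theorem finsum_ord {f : C.X.functionField} (hf : f ≠ 0) : ∑ᶠ x, Scheme.ord f x = 0 :=
  have := C.essFiniteType_trdeg_functionField.1
  C.isPlaceFamily.finsum_eq_zero C.essFiniteType_trdeg_functionField.2 (fun x f => Scheme.ord f x)
    (fun _ _ _ hf hg => Scheme.ord_mul hf hg) (fun _ _ => C.ord_eq_zeroOrd)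
    (fun _ _ => C.ord_eq_zero) hf

end SmoothCurve
end

/-! ### Families of lattices over the places and their degree -/

section

open Module

section Lattice

variable {R K : Type*} [CommRing R] [IsDomain R] [Field K] [Algebra R K] [IsFractionRing R K]
  {V : Type*} [AddCommGroup V] [Module K V] [Module R V] [IsScalarTower R K V]
  {V₁ : Type*} [AddCommGroup V₁] [Module K V₁] [Module R V₁] [IsScalarTower R K V₁]

namespace Submodule.IsLattice

omit [IsDomain R] [IsFractionRing R K] in
theorem span_basis {ι : Type*} [Finite ι] (γ : Basis ι K V) :
    IsLattice K (span R (Set.range γ)) where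
  fg := fg_span (Set.finite_range γ)
  span_eq_top := by
    rw [span_span_of_tower, γ.span_eq]

/-- Over a principal ideal domain, a lattice is free. -/
theorem exists_basis [IsPrincipalIdealRing R] (M : Submodule R V) [IsLattice K M] :
    ∃ γ : Basis (Fin (finrank K V)) K V, span R (Set.range γ) = M := by
  have : Module.IsTorsionFree R K := inferInstance
  let b := Module.Free.chooseBasis R M
  let c := b.extendOfIsLattice K
  have hc : span R (Set.range c) = M := by
    have : Set.range c = M.subtype '' Set.range b := by
      rw [← Set.range_comp]
      congr 1
      ext i
      simp [c]
    rw [this, ← map_span, b.span_eq, map_top, range_subtype]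
  have hf : finrank K V = Fintype.card (Module.Free.ChooseBasisIndex R M) :=
    finrank_eq_card_basis c
  refine ⟨c.reindex (Fintype.equivFinOfCardEq hf.symm), ?_⟩
  rw [Basis.range_reindex, hc]

omit [IsDomain R] in
theorem exists_smul_mem (M : Submodule R V) [h : IsLattice K M] (v : V) :
    ∃ r ∈ nonZeroDivisors R, r • v ∈ M := by
  have hv : v ∈ span K (M : Set V) := h.span_eq_top ▸ mem_top
  induction hv using span_induction with
  | mem x hx => exact ⟨1, one_mem _, by simpa using hx⟩
  | zero => exact ⟨1, one_mem _, by simp⟩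
  | add x y _ _ hx hy =>
    obtain ⟨r, hr, hx⟩ := hx
    obtain ⟨s, hs, hy⟩ := hy
    refine ⟨r * s, mul_mem hr hs, ?_⟩
    rw [smul_add, mul_smul, mul_smul, smul_comm r s x]
    exact M.add_mem (M.smul_mem _ hx) (M.smul_mem _ hy)
  | smul a x _ hx =>
    obtain ⟨r, hr, hx⟩ := hx
    obtain ⟨⟨b, s⟩, hb⟩ := IsLocalization.surj (nonZeroDivisors R) a
    refine ⟨r * s, mul_mem hr s.2, ?_⟩
    have : ((r * s : R)) • a • x = b • r • x := by
      rw [← algebraMap_smul K (r * (s : R)), ← algebraMap_smul K b, ← algebraMap_smul K r x,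
        smul_smul, smul_smul, ← hb, map_mul]
      ring_nf
    rw [this]
    exact M.smul_mem _ hx

theorem comap [IsPrincipalIdealRing R] (M : Submodule R V) [IsLattice K M] (i : V₁ →ₗ[K] V)
    (hi : Function.Injective i) : IsLattice K (M.comap (i.restrictScalars R)) where
  fg := by
    have h1 : ((M.comap (i.restrictScalars R)).map (i.restrictScalars R)).FG := by
      have : IsNoetherian R ((M.comap (i.restrictScalars R)).map (i.restrictScalars R)) :=
        isNoetherian_of_le (map_comap_le _ _)
      exact Module.Finite.iff_fg.1 inferInstance
    exact fg_of_fg_map_injective (i.restrictScalars R) hi h1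
  span_eq_top := by
    rw [eq_top_iff]
    intro v _
    obtain ⟨r, hr, h⟩ := exists_smul_mem M (i v)
    have h0 : algebraMap R K r ≠ 0 := by
      simpa using nonZeroDivisors.ne_zero hr
    have : v = (algebraMap R K r)⁻¹ • (r • v) := by
      rw [← algebraMap_smul K r, smul_smul, inv_mul_cancel₀ h0, one_smul]
    rw [this]
    refine smul_mem _ _ (subset_span ?_)
    change i (r • v) ∈ M
    rwa [← algebraMap_smul K r, map_smul, algebraMap_smul]

omit [IsDomain R] [IsFractionRing R K] in
theorem map (M : Submodule R V) [h : IsLattice K M] (p : V →ₗ[K] V₁)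
    (hp : Function.Surjective p) : IsLattice K (M.map (p.restrictScalars R)) where
  fg := h.fg.map _
  span_eq_top := by
    have : ((M.map (p.restrictScalars R) : Submodule R V₁) : Set V₁) = p '' M := rfl
    rw [this, ← map_span, h.span_eq_top, map_top, LinearMap.range_eq_top.2 hp]

end Submodule.IsLattice

/-- In a short exact sequence, a basis of the kernel and lifts of a basis of the cokernel form a
basis. -/
theorem Module.Basis.exists_sumElim {V₁ V₂ V₃ : Type*} [AddCommGroup V₁] [AddCommGroup V₂]
    [AddCommGroup V₃] [Module K V₁] [Module K V₂] [Module K V₃] {i : V₁ →ₗ[K] V₂}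
    {p : V₂ →ₗ[K] V₃} (hi : Function.Injective i) (hip : Function.Exact i p)
    {ι₁ ι₃ : Type*} (b₁ : Basis ι₁ K V₁) (b₃ : Basis ι₃ K V₃) (s : ι₃ → V₂)
    (hs : ∀ j, p (s j) = b₃ j) :
    ∃ b : Basis (ι₁ ⊕ ι₃) K V₂, ⇑b = Sum.elim (i ∘ b₁) s := by
  have hps : ⇑p ∘ s = b₃ := funext hs
  refine ⟨Basis.mk (v := Sum.elim (i ∘ b₁) s) ?_ ?_, Basis.coe_mk _ _⟩
  · refine LinearIndependent.sum_type ?_ ?_ ?_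
    · exact b₁.linearIndependent.map' i (LinearMap.ker_eq_bot.2 hi)
    · exact LinearIndependent.of_comp p (hps ▸ b₃.linearIndependent)
    · rw [Submodule.disjoint_def]
      intro v hv hv'
      have h0 : p v = 0 := by
        rw [Set.range_comp, ← Submodule.map_span] at hv
        obtain ⟨w, -, rfl⟩ := hv
        exact hip.apply_apply_eq_zero w
      have hd := (LinearIndependent.of_comp p (hps ▸ b₃.linearIndependent))
      obtain ⟨c, rfl⟩ := (Finsupp.mem_span_range_iff_exists_finsupp).1 hv'
      rw [Finsupp.sum, map_sum] at h0
      simp only [map_smul, hs] at h0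
      have hc : c = 0 := by
        have := linearIndependent_iff.1 b₃.linearIndependent c h0
        exact this
      simp [hc]
  · intro v _
    rw [Set.Sum.elim_range]
    have h1 : p v ∈ Submodule.map p (Submodule.span K (Set.range s)) := by
      rw [Submodule.map_span, ← Set.range_comp, hps, b₃.span_eq]
      trivial
    obtain ⟨w, hw, hwv⟩ := h1
    obtain ⟨u, hu⟩ := (hip (v - w)).1 (by rw [map_sub, hwv, sub_self])
    have : v = i u + w := by rw [hu, sub_add_cancel]
    rw [this, Submodule.span_union]
    refine Submodule.add_mem_sup ?_ hw
    rw [Set.range_comp, ← Submodule.map_span, b₁.span_eq]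
    exact ⟨u, trivial, rfl⟩

end Lattice

/-- The local rings of a complete curve with function field `K`, together with the orders of
vanishing, as far as they are needed to define degrees. -/
structure PlaceSystem (K : Type*) [Field K] (X : Type*) where
  /-- The local ring at a point. -/
  O : X → ValuationSubring K
  /-- The order of vanishing at a point. -/
  ord : X → K → ℤ
  isPrincipalIdealRing : ∀ x, IsPrincipalIdealRing (O x)
  ord_mul : ∀ x f g, f ≠ 0 → g ≠ 0 → ord x (f * g) = ord x f + ord x g
  ord_nonneg : ∀ x f, f ∈ O x → 0 ≤ ord x f
  finite_notMem : ∀ f, {x | f ∉ O x}.Finite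
  finsum_ord : ∀ f, f ≠ 0 → ∑ᶠ x, ord x f = 0

namespace PlaceSystem

attribute [instance] isPrincipalIdealRing

variable {K : Type*} [Field K] {X : Type*} (S : PlaceSystem K X)
  {V : Type*} [AddCommGroup V] [Module K V]
  {V₁ : Type*} [AddCommGroup V₁] [Module K V₁]
  {V₃ : Type*} [AddCommGroup V₃] [Module K V₃]

theorem ord_one (x : X) : S.ord x 1 = 0 := by
  have := S.ord_mul x 1 1 one_ne_zero one_ne_zero
  rw [mul_one] at this
  linarith

theorem ord_eq_zero {x : X} {f g : K} (hf : f ∈ S.O x) (hg : g ∈ S.O x) (h : f * g = 1) :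
    S.ord x f = 0 := by
  have := S.ord_mul x f g (left_ne_zero_of_mul_eq_one h) (right_ne_zero_of_mul_eq_one h)
  rw [h, ord_one] at this
  linarith [S.ord_nonneg x f hf, S.ord_nonneg x g hg]

theorem eventually_mem (f : K) : ∀ᶠ x in Filter.cofinite, f ∈ S.O x :=
  S.finite_notMem f

theorem finite_support_ord {f : K} (hf : f ≠ 0) : (Function.support fun x => S.ord x f).Finite := by
  have : ∀ᶠ x in Filter.cofinite, S.ord x f = 0 := by
    filter_upwards [S.eventually_mem f, S.eventually_mem f⁻¹] with x h1 h2
    exact S.ord_eq_zero h1 h2 (mul_inv_cancel₀ hf)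
  exact this

theorem det_mem {x : X} {ι : Type*} [Fintype ι] [DecidableEq ι] {A : Matrix ι ι K}
    (hA : ∀ i j, A i j ∈ S.O x) : A.det ∈ S.O x := by
  rw [Matrix.det_apply]
  exact sum_mem fun σ _ => by
    rw [Units.smul_def]
    exact zsmul_mem (prod_mem fun i _ => hA _ _) _

section Local

variable {ι : Type*} {x : X}

theorem mem_span_basis {γ : Basis ι K V} {v : V} :
    v ∈ Submodule.span (S.O x) (Set.range γ) ↔ ∀ i, γ.repr v i ∈ S.O x := by
  rw [Basis.mem_span_iff_repr_mem]
  refine forall_congr' fun i => ⟨?_, fun h => ⟨⟨_, h⟩, rfl⟩⟩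
  rintro ⟨a, ha⟩
  rw [← ha]
  exact a.2

theorem toMatrix_mem {γ β : Basis ι K V}
    (h : Submodule.span (S.O x) (Set.range β) ≤ Submodule.span (S.O x) (Set.range γ)) (i j : ι) :
    γ.toMatrix β i j ∈ S.O x :=
  S.mem_span_basis.1 (h (Submodule.subset_span ⟨j, rfl⟩)) i

variable [Fintype ι] [DecidableEq ι]

theorem det_toMatrix_mul (α β γ : Basis ι K V) :
    (α.toMatrix β).det * (β.toMatrix γ).det = (α.toMatrix γ).det := by
  rw [← Matrix.det_mul, Basis.toMatrix_mul_toMatrix]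

theorem det_toMatrix_ne_zero (α β : Basis ι K V) : (α.toMatrix β).det ≠ 0 := by
  have := det_toMatrix_mul α β α
  rw [Basis.toMatrix_self, Matrix.det_one] at this
  exact left_ne_zero_of_mul_eq_one this

/-- The integer `n` is the index of the span of `β` in the lattice `M` over the local ring at `x`,
i.e. the order of the determinant that expresses `β` in a basis of `M`. It is negative if the span
of `β` is larger than `M`. -/
def IsIndex (x : X) (M : Submodule (S.O x) V) (β : Basis ι K V) (n : ℤ) : Prop :=
  ∃ γ : Basis ι K V, Submodule.span (S.O x) (Set.range γ) = M ∧ n = S.ord x (γ.toMatrix β).det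

variable {M M' : Submodule (S.O x) V} {β β' : Basis ι K V} {n n' : ℤ}

variable {S}

theorem IsIndex.mono (h : S.IsIndex x M β n) (h' : S.IsIndex x M' β n') (hM : M ≤ M') :
    n ≤ n' := by
  obtain ⟨γ, rfl, rfl⟩ := h
  obtain ⟨γ', rfl, rfl⟩ := h'
  rw [← det_toMatrix_mul γ' γ β,
    S.ord_mul _ _ _ (det_toMatrix_ne_zero _ _) (det_toMatrix_ne_zero _ _)]
  linarith [S.ord_nonneg x _ (S.det_mem (S.toMatrix_mem hM))]

theorem IsIndex.unique (h : S.IsIndex x M β n) (h' : S.IsIndex x M β n') : n = n' :=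
  le_antisymm (h.mono h' le_rfl) (h'.mono h le_rfl)

theorem IsIndex.change (h : S.IsIndex x M β n) (β' : Basis ι K V) :
    S.IsIndex x M β' (n + S.ord x (β.toMatrix β').det) := by
  obtain ⟨γ, hγ, rfl⟩ := h
  refine ⟨γ, hγ, ?_⟩
  rw [← det_toMatrix_mul γ β β',
    S.ord_mul _ _ _ (det_toMatrix_ne_zero _ _) (det_toMatrix_ne_zero _ _)]

theorem isIndex_zero (β : Basis ι K V) :
    S.IsIndex x (Submodule.span (S.O x) (Set.range β)) β 0 :=
  ⟨β, rfl, by rw [Basis.toMatrix_self, Matrix.det_one, ord_one]⟩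

theorem IsIndex.reindex {ι' : Type*} [Fintype ι'] [DecidableEq ι'] (h : S.IsIndex x M β n)
    (e : ι ≃ ι') : S.IsIndex x M (β.reindex e) n := by
  obtain ⟨γ, hγ, rfl⟩ := h
  refine ⟨γ.reindex e, by rw [Basis.range_reindex, hγ], ?_⟩
  have : (γ.reindex e).toMatrix (β.reindex e) = (γ.toMatrix β).submatrix e.symm e.symm := by
    ext i j
    simp [Basis.toMatrix_apply]
  rw [this, Matrix.det_submatrix_equiv_self]

theorem exists_isIndex (M : Submodule (S.O x) V) [Submodule.IsLattice K M] (β : Basis ι K V) :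
    ∃ n, S.IsIndex x M β n := by
  obtain ⟨γ, hγ⟩ := Submodule.IsLattice.exists_basis M
  have e : Fin (finrank K V) ≃ ι := Fintype.equivOfCardEq (by
    rw [Fintype.card_fin, finrank_eq_card_basis β])
  exact ⟨_, γ.reindex e, by rw [Basis.range_reindex, hγ], rfl⟩

end Local

/-- A family of lattices in `V` is coherent if some, equivalently every, basis of `V` spans almost
all of them. -/
structure IsCoherent (L : ∀ x, Submodule (S.O x) V) : Prop where
  isLattice : ∀ x, Submodule.IsLattice K (L x)
  exists_basis : ∃ (r : ℕ) (β : Basis (Fin r) K V),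
    ∀ᶠ x in Filter.cofinite, Submodule.span (S.O x) (Set.range β) = L x

theorem eventually_span_le {ι ι' : Type*} [Finite ι] [Finite ι'] (β : Basis ι K V)
    (β' : Basis ι' K V) : ∀ᶠ x in Filter.cofinite,
      Submodule.span (S.O x) (Set.range β) ≤ Submodule.span (S.O x) (Set.range β') := by
  have : ∀ᶠ x in Filter.cofinite, ∀ i j, β'.repr (β i) j ∈ S.O x := by
    rw [Filter.eventually_all]
    intro i
    rw [Filter.eventually_all]
    exact fun j => S.eventually_mem _
  filter_upwards [this] with x hx
  rw [Submodule.span_le]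
  rintro _ ⟨i, rfl⟩
  exact S.mem_span_basis.2 (hx i)

variable {S} {L L' : ∀ x, Submodule (S.O x) V}

theorem IsCoherent.eventually_span_eq (hL : S.IsCoherent L) {ι : Type*} [Finite ι]
    (β : Basis ι K V) :
    ∀ᶠ x in Filter.cofinite, Submodule.span (S.O x) (Set.range β) = L x := by
  obtain ⟨r, β', h⟩ := hL.exists_basis
  filter_upwards [h, S.eventually_span_le β β', S.eventually_span_le β' β] with x h1 h2 h3
  exact (le_antisymm h2 h3).trans h1

theorem IsCoherent.of_basis (h : ∀ x, Submodule.IsLattice K (L x)) {ι : Type*} [Finite ι]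
    (β : Basis ι K V)
    (hβ : ∀ᶠ x in Filter.cofinite, Submodule.span (S.O x) (Set.range β) = L x) :
    S.IsCoherent L := by
  obtain ⟨n, ⟨e⟩⟩ := Finite.exists_equiv_fin ι
  exact ⟨h, n, β.reindex e, by simpa only [Basis.range_reindex] using hβ⟩

variable (S) in
open Classical in
/-- The degree of a coherent family of lattices in `V`: the sum of the indices of some basis. The
value zero in the definition is never used for coherent families. -/
noncomputable def deg [Module.Finite K V] (L : ∀ x, Submodule (S.O x) V) : ℤ :=
  ∑ᶠ x, if h : ∃ n, S.IsIndex x (L x) (Module.finBasis K V) n then h.choose else 0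

section Degree

variable {ι : Type*} [Fintype ι] [DecidableEq ι]

theorem IsCoherent.finite_support (hL : S.IsCoherent L) {β : Basis ι K V} {n : X → ℤ}
    (hn : ∀ x, S.IsIndex x (L x) β (n x)) : n.support.Finite := by
  have : ∀ᶠ x in Filter.cofinite, n x = 0 := by
    filter_upwards [hL.eventually_span_eq β] with x hx
    exact (hn x).unique (hx ▸ isIndex_zero β)
  exact this

theorem IsCoherent.exists_isIndex (hL : S.IsCoherent L) (β : Basis ι K V) :
    ∃ n : X → ℤ, ∀ x, S.IsIndex x (L x) β (n x) := by
  have := hL.isLattice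
  exact ⟨_, fun x => (PlaceSystem.exists_isIndex (L x) β).choose_spec⟩

/-- The degree can be computed with respect to any basis, because principal divisors have
degree zero. -/
theorem IsCoherent.deg_eq [Module.Finite K V] (hL : S.IsCoherent L) {β : Basis ι K V} {n : X → ℤ}
    (hn : ∀ x, S.IsIndex x (L x) β (n x)) : S.deg L = ∑ᶠ x, n x := by
  have e : ι ≃ Fin (finrank K V) := Fintype.equivOfCardEq (by
    rw [Fintype.card_fin, finrank_eq_card_basis β])
  let δ := ((β.reindex e).toMatrix (Module.finBasis K V)).det
  have hδ : δ ≠ 0 := det_toMatrix_ne_zero _ _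
  have key : ∀ x, S.IsIndex x (L x) (Module.finBasis K V) (n x + S.ord x δ) := fun x =>
    ((hn x).reindex e).change _
  have h1 : S.deg L = ∑ᶠ x, (n x + S.ord x δ) := by
    refine finsum_congr fun x => ?_
    have h : ∃ n, S.IsIndex x (L x) (Module.finBasis K V) n := ⟨_, key x⟩
    rw [dif_pos h]
    exact h.choose_spec.unique (key x)
  rw [h1, finsum_add_distrib (hL.finite_support hn) (S.finite_support_ord hδ), S.finsum_ord _ hδ,
    add_zero]

theorem IsCoherent.deg_mono [Module.Finite K V] (hL : S.IsCoherent L) (hL' : S.IsCoherent L')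
    (h : ∀ x, L x ≤ L' x) : S.deg L ≤ S.deg L' := by
  obtain ⟨n, hn⟩ := hL.exists_isIndex (Module.finBasis K V)
  obtain ⟨n', hn'⟩ := hL'.exists_isIndex (Module.finBasis K V)
  rw [hL.deg_eq hn, hL'.deg_eq hn']
  exact finsum_le_finsum' (hL.finite_support hn) (hL'.finite_support hn')
    fun x => (hn x).mono (hn' x) (h x)

end Degree

section Exact

variable {i : V₁ →ₗ[K] V} {p : V →ₗ[K] V₃}

/-- The family of lattices induced on a subspace. -/
abbrev comap (L : ∀ x, Submodule (S.O x) V) (i : V₁ →ₗ[K] V) (x : X) : Submodule (S.O x) V₁ :=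
  (L x).comap (i.restrictScalars (S.O x))

/-- The family of lattices induced on a quotient space. -/
abbrev map (L : ∀ x, Submodule (S.O x) V) (p : V →ₗ[K] V₃) (x : X) : Submodule (S.O x) V₃ :=
  (L x).map (p.restrictScalars (S.O x))

theorem repr_map_of_exact {ι₁ ι₃ : Type*} [Fintype ι₁]
    {b₁ : Basis ι₁ K V₁} {b : Basis (ι₁ ⊕ ι₃) K V} {s : ι₃ → V}
    (hb : ⇑b = Sum.elim (i ∘ b₁) s) (v : V₁) (k : ι₁ ⊕ ι₃) :
    b.repr (i v) k = Sum.elim (b₁.repr v) 0 k := by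
  have h : b.repr (i v) = (b₁.repr v).embDomain Function.Embedding.inl := by
    rw [← LinearEquiv.eq_symm_apply, Basis.repr_symm_apply, Finsupp.linearCombination_embDomain]
    conv_lhs => rw [← b₁.linearCombination_repr v, Finsupp.linearCombination_apply, Finsupp.sum,
      map_sum]
    simp only [map_smul]
    rw [Finsupp.linearCombination_apply, Finsupp.sum]
    refine Finset.sum_congr rfl fun j _ => ?_
    simp [hb]
  rw [h]
  cases k with
  | inl k => exact Finsupp.embDomain_apply_self Function.Embedding.inl _ _
  | inr k => exact Finsupp.embDomain_of_notMem_range _ _ _ (by simp)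

theorem repr_inr_of_exact (hip : Function.Exact i p) {ι₁ ι₃ : Type*} [Fintype ι₁] [Fintype ι₃]
    {b₁ : Basis ι₁ K V₁} {b₃ : Basis ι₃ K V₃} {b : Basis (ι₁ ⊕ ι₃) K V} {s : ι₃ → V}
    (hb : ⇑b = Sum.elim (i ∘ b₁) s) (hs : ∀ j, p (s j) = b₃ j) (v : V) (k : ι₃) :
    b.repr v (Sum.inr k) = b₃.repr (p v) k := by
  conv_rhs => rw [← b.sum_repr v, map_sum]
  simp only [map_smul, hb, Fintype.sum_sum_type, Sum.elim_inl, Sum.elim_inr, hs,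
    Function.comp_apply, hip.apply_apply_eq_zero, smul_zero, Finset.sum_const_zero, zero_add,
    map_sum, Finsupp.coe_finsetSum, Finset.sum_apply, Finsupp.smul_apply, Basis.repr_self,
    smul_eq_mul]
  rw [Finset.sum_eq_single k] <;> simp +contextual

/-- If `b` extends a basis `b₁` of a subspace, the lattice spanned by `b` meets the subspace in the
lattice spanned by `b₁`. -/
theorem comap_span_eq {ι₁ ι₃ : Type*} [Fintype ι₁]
    {b₁ : Basis ι₁ K V₁} {b : Basis (ι₁ ⊕ ι₃) K V} {s : ι₃ → V}
    (hb : ⇑b = Sum.elim (i ∘ b₁) s) (x : X) :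
    (Submodule.span (S.O x) (Set.range b)).comap (i.restrictScalars (S.O x)) =
      Submodule.span (S.O x) (Set.range b₁) := by
  ext v
  rw [Submodule.mem_comap, LinearMap.coe_restrictScalars, mem_span_basis, mem_span_basis]
  simp [repr_map_of_exact hb, zero_mem]

theorem map_span_eq (hip : Function.Exact i p) {ι₁ ι₃ : Type*}
    {b₁ : Basis ι₁ K V₁} {b₃ : Basis ι₃ K V₃} {b : Basis (ι₁ ⊕ ι₃) K V} {s : ι₃ → V}
    (hb : ⇑b = Sum.elim (i ∘ b₁) s) (hs : ∀ j, p (s j) = b₃ j) (x : X) :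
    (Submodule.span (S.O x) (Set.range b)).map (p.restrictScalars (S.O x)) =
      Submodule.span (S.O x) (Set.range b₃) := by
  have h1 : p ∘ b = Sum.elim (fun _ => 0) b₃ := by
    rw [hb, Sum.comp_elim]
    congr 1
    · exact funext fun j => hip.apply_apply_eq_zero _
    · exact funext hs
  rw [Submodule.map_span, LinearMap.coe_restrictScalars, ← Set.range_comp, h1, Set.Sum.elim_range,
    Submodule.span_union]
  have : Submodule.span (S.O x) (Set.range fun _ : ι₁ => (0 : V₃)) = ⊥ := by
    rw [Submodule.span_eq_bot]
    rintro _ ⟨j, rfl⟩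
    rfl
  rw [this, bot_sup_eq]

/-- A lattice is spanned by a basis of its part in a subspace together with lifts of a basis of its
image in the quotient. -/
theorem span_eq_of_exact {x : X} {M : Submodule (S.O x) V} (hip : Function.Exact i p)
    {ι₁ ι₃ : Type*}
    {b₁ : Basis ι₁ K V₁} {b₃ : Basis ι₃ K V₃} {b : Basis (ι₁ ⊕ ι₃) K V} {s : ι₃ → V}
    (hb : ⇑b = Sum.elim (i ∘ b₁) s) (hs : ∀ j, p (s j) = b₃ j) (hsM : ∀ j, s j ∈ M)
    (h₁ : Submodule.span (S.O x) (Set.range b₁) = M.comap (i.restrictScalars (S.O x)))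
    (h₃ : Submodule.span (S.O x) (Set.range b₃) = M.map (p.restrictScalars (S.O x))) :
    Submodule.span (S.O x) (Set.range b) = M := by
  apply le_antisymm
  · rw [Submodule.span_le, hb, Set.Sum.elim_range]
    rintro _ (⟨j, rfl⟩ | ⟨j, rfl⟩)
    · have : b₁ j ∈ M.comap (i.restrictScalars (S.O x)) := h₁ ▸ Submodule.subset_span ⟨j, rfl⟩
      exact this
    · exact hsM j
  · intro v hv
    have h1 : p v ∈ (Submodule.span (S.O x) (Set.range s)).map (p.restrictScalars (S.O x)) := by
      rw [Submodule.map_span, LinearMap.coe_restrictScalars, ← Set.range_comp,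
        funext (f := p ∘ s) hs, h₃]
      exact ⟨v, hv, rfl⟩
    obtain ⟨w, hw, hwv⟩ := h1
    obtain ⟨u, hu⟩ := (hip (v - w)).1 (by
      rw [map_sub, sub_eq_zero]
      exact hwv.symm)
    have hwM : w ∈ M := by
      refine (Submodule.span_le (p := M)).2 ?_ hw
      rintro _ ⟨j, rfl⟩
      exact hsM j
    have hu1 : u ∈ Submodule.span (S.O x) (Set.range b₁) := by
      rw [h₁]
      change i u ∈ M
      rw [hu]
      exact M.sub_mem hv hwM
    have : v = i u + w := by rw [hu, sub_add_cancel]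
    rw [this, hb, Set.Sum.elim_range, Submodule.span_union]
    refine Submodule.add_mem_sup ?_ hw
    rw [Set.range_comp, ← LinearMap.coe_restrictScalars (S.O x), ← Submodule.map_span]
    exact ⟨u, hu1, rfl⟩

/-- The index is additive in short exact sequences, because the determinant of a block triangular
matrix is the product of the determinants of the diagonal blocks. -/
theorem IsIndex.add (hi : Function.Injective i) (hip : Function.Exact i p)
    {x : X} {M : Submodule (S.O x) V} {ι₁ ι₃ : Type*} [Fintype ι₁] [DecidableEq ι₁]
    [Fintype ι₃] [DecidableEq ι₃]
    {b₁ : Basis ι₁ K V₁} {b₃ : Basis ι₃ K V₃} {b : Basis (ι₁ ⊕ ι₃) K V} {s : ι₃ → V}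
    (hb : ⇑b = Sum.elim (i ∘ b₁) s) (hs : ∀ j, p (s j) = b₃ j) {n₁ n₃ : ℤ}
    (h₁ : S.IsIndex x (M.comap (i.restrictScalars (S.O x))) b₁ n₁)
    (h₃ : S.IsIndex x (M.map (p.restrictScalars (S.O x))) b₃ n₃) :
    S.IsIndex x M b (n₁ + n₃) := by
  obtain ⟨γ₁, hγ₁, rfl⟩ := h₁
  obtain ⟨γ₃, hγ₃, rfl⟩ := h₃
  have hl : ∀ j, ∃ v ∈ M, p v = γ₃ j := by
    intro j
    have : γ₃ j ∈ M.map (p.restrictScalars (S.O x)) := hγ₃ ▸ Submodule.subset_span ⟨j, rfl⟩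
    exact this
  choose t ht hpt using hl
  obtain ⟨γ, hγ⟩ := Module.Basis.exists_sumElim hi hip γ₁ γ₃ t hpt
  refine ⟨γ, span_eq_of_exact hip hγ hpt ht hγ₁ hγ₃, ?_⟩
  have : γ.toMatrix b =
      Matrix.fromBlocks (γ₁.toMatrix b₁) (γ.toMatrix b).toBlocks₁₂ 0 (γ₃.toMatrix b₃) := by
    ext k l
    rcases k with k | k <;> rcases l with l | l <;>
      simp [Basis.toMatrix_apply, hb, repr_map_of_exact hγ, repr_inr_of_exact hip hγ hpt,
        Matrix.toBlocks₁₂, hs]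
  rw [this, Matrix.det_fromBlocks_zero₂₁,
    S.ord_mul _ _ _ (det_toMatrix_ne_zero _ _) (det_toMatrix_ne_zero _ _)]

variable [Module.Finite K V]

theorem IsCoherent.exact (hL : S.IsCoherent L) (hi : Function.Injective i)
    (hip : Function.Exact i p) (hp : Function.Surjective p) :
    S.IsCoherent (comap L i) ∧ S.IsCoherent (map L p) := by
  have := hL.isLattice
  have : Module.Finite K V₁ := .of_injective i hi
  have : Module.Finite K V₃ := .of_surjective p hp
  choose s hs using fun j => hp (Module.finBasis K V₃ j)
  obtain ⟨b, hb⟩ := Module.Basis.exists_sumElim hi hip (Module.finBasis K V₁)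
    (Module.finBasis K V₃) s hs
  refine ⟨.of_basis (fun x => .comap _ i hi) (Module.finBasis K V₁) ?_,
    .of_basis (fun x => .map _ p hp) (Module.finBasis K V₃) ?_⟩
  · filter_upwards [hL.eventually_span_eq b] with x hx
    rw [comap, ← hx, comap_span_eq hb]
  · filter_upwards [hL.eventually_span_eq b] with x hx
    rw [map, ← hx, map_span_eq hip hb hs]

/-- The degree is additive in short exact sequences. -/
theorem IsCoherent.deg_exact [Module.Finite K V₁] [Module.Finite K V₃]
    (hL : S.IsCoherent L) (hi : Function.Injective i) (hip : Function.Exact i p)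
    (hp : Function.Surjective p) : S.deg L = S.deg (comap L i) + S.deg (map L p) := by
  obtain ⟨h1, h3⟩ := hL.exact hi hip hp
  choose s hs using fun j => hp (Module.finBasis K V₃ j)
  obtain ⟨b, hb⟩ := Module.Basis.exists_sumElim hi hip (Module.finBasis K V₁)
    (Module.finBasis K V₃) s hs
  obtain ⟨n₁, hn₁⟩ := h1.exists_isIndex (Module.finBasis K V₁)
  obtain ⟨n₃, hn₃⟩ := h3.exists_isIndex (Module.finBasis K V₃)
  rw [h1.deg_eq hn₁, h3.deg_eq hn₃, hL.deg_eq fun x => (hn₁ x).add hi hip hb hs (hn₃ x),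
    finsum_add_distrib (h1.finite_support hn₁) (h3.finite_support hn₃)]

end Exact

end PlaceSystem

end

/-! ### Degrees of subspaces -/

section

open Module

namespace PlaceSystem

variable {K : Type*} [Field K] {X : Type*} {S : PlaceSystem K X}
  {V : Type*} [AddCommGroup V] [Module K V] [Module.Finite K V]
  {L : ∀ x, Submodule (S.O x) V}

theorem IsCoherent.deg_eq_zero (hL : S.IsCoherent L) [Subsingleton V] : S.deg L = 0 := by
  have h0 (x : X) : S.IsIndex x (L x) (Module.finBasis K V) 0 := by
    have : L x = Submodule.span (S.O x) (Set.range (Module.finBasis K V)) :=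
      Subsingleton.elim _ _
    rw [this]
    exact isIndex_zero _
  rw [hL.deg_eq h0, finsum_zero]

theorem IsCoherent.deg_comap_equiv {V₁ : Type*} [AddCommGroup V₁] [Module K V₁]
    [Module.Finite K V₁] (hL : S.IsCoherent L) (e : V₁ ≃ₗ[K] V) :
    S.deg (comap L e.toLinearMap) = S.deg L := by
  have hip : Function.Exact e.toLinearMap (0 : V →ₗ[K] PUnit.{1}) := by
    intro v
    simp
  have hp : Function.Surjective (0 : V →ₗ[K] PUnit.{1}) := fun _ => ⟨0, rfl⟩
  rw [hL.deg_exact e.injective hip hp, (hL.exact e.injective hip hp).2.deg_eq_zero, add_zero]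

theorem IsCoherent.comap_subtype (hL : S.IsCoherent L) (W : Submodule K V) :
    S.IsCoherent (comap L W.subtype) :=
  (hL.exact W.injective_subtype (LinearMap.exact_subtype_mkQ W) W.mkQ_surjective).1

variable (L) in
/-- The degree of the family of lattices induced on a subspace. -/
noncomputable def subDeg (W : Submodule K V) : ℤ := S.deg (comap L W.subtype)

theorem IsCoherent.subDeg_bot (hL : S.IsCoherent L) : subDeg L ⊥ = 0 :=
  (hL.comap_subtype ⊥).deg_eq_zero

theorem IsCoherent.subDeg_top (hL : S.IsCoherent L) : subDeg L ⊤ = S.deg L :=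
  hL.deg_comap_equiv Submodule.topEquiv

/-- The degree of a subquotient is the difference of the degrees of the two subspaces. -/
theorem IsCoherent.subDeg_add (hL : S.IsCoherent L) {A B : Submodule K V} (hAB : A ≤ B)
    {Q : Type*} [AddCommGroup Q] [Module K Q] [Module.Finite K Q] (q : B →ₗ[K] Q)
    (hq : Function.Surjective q) (hker : ∀ b : B, q b = 0 ↔ (b : V) ∈ A) :
    S.IsCoherent (map (comap L B.subtype) q) ∧
      subDeg L B = subDeg L A + S.deg (map (comap L B.subtype) q) ∧
      finrank K B = finrank K A + finrank K Q := by
  have hi : Function.Injective (Submodule.inclusion hAB) := Submodule.inclusion_injective hAB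
  have hip : Function.Exact (Submodule.inclusion hAB) q := by
    intro b
    rw [hker]
    exact ⟨fun h => ⟨⟨b, h⟩, rfl⟩, by rintro ⟨a, rfl⟩; exact a.2⟩
  refine ⟨((hL.comap_subtype B).exact hi hip hq).2, (hL.comap_subtype B).deg_exact hi hip hq, ?_⟩
  have h1 := q.finrank_range_add_finrank_ker
  rw [LinearMap.range_eq_top.2 hq, finrank_top] at h1
  have h2 : LinearMap.ker q = LinearMap.range (Submodule.inclusion hAB) :=
    hip.linearMap_ker_eq
  rw [h2, LinearMap.finrank_range_of_inj hi] at h1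
  omega

/-- The degree, twisted by a multiple of the dimension. -/
noncomputable def twistedDeg (L : ∀ x, Submodule (S.O x) V) (c : ℚ) (W : Submodule K V) : ℚ :=
  subDeg L W - c * finrank K W

theorem IsCoherent.twistedDeg_bot (hL : S.IsCoherent L) (c : ℚ) : twistedDeg L c ⊥ = 0 := by
  simp [twistedDeg, hL.subDeg_bot]

/-- If `T` preserves the lattices, it induces a homomorphism from `W / (W ⊓ T⁻¹ A)` onto
`(A ⊔ T W) / A`, which is generically an isomorphism and hence does not lower the degree. -/
theorem IsCoherent.twistedDeg_add_le (hL : S.IsCoherent L) (c : ℚ) (T : V →ₗ[K] V)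
    (hT : ∀ x, ∀ v ∈ L x, T v ∈ L x) (A W : Submodule K V) :
    twistedDeg L c A + twistedDeg L c W ≤
      twistedDeg L c (A ⊔ W.map T) + twistedDeg L c (W ⊓ A.comap T) := by
  let Q := W.map (A.mkQ ∘ₗ T)
  let q₁ : ↥(A ⊔ W.map T) →ₗ[K] Q := (A.mkQ ∘ₗ (A ⊔ W.map T).subtype).codRestrict Q (by
    rintro ⟨v, hv⟩
    obtain ⟨a, ha, _, ⟨w, hw, rfl⟩, rfl⟩ := Submodule.mem_sup.1 hv
    refine ⟨w, hw, ?_⟩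
    simp [ha])
  let q₂ : W →ₗ[K] Q := ((A.mkQ ∘ₗ T) ∘ₗ W.subtype).codRestrict Q
    fun w => ⟨w, w.2, rfl⟩
  have hq₂ : Function.Surjective q₂ := by
    rintro ⟨_, w, hw, rfl⟩
    exact ⟨⟨w, hw⟩, rfl⟩
  have hmem (w : W) : T w ∈ A ⊔ W.map T := Submodule.mem_sup_right ⟨w, w.2, rfl⟩
  have hq₁₂ (w : W) : q₁ ⟨T w, hmem w⟩ = q₂ w := rfl
  have hq₁ : Function.Surjective q₁ := fun z => by
    obtain ⟨w, rfl⟩ := hq₂ z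
    exact ⟨_, hq₁₂ w⟩
  obtain ⟨c₁, d₁, r₁⟩ := hL.subDeg_add (A := A) le_sup_left q₁ hq₁ (by
    intro b
    rw [← Subtype.coe_inj]
    exact Submodule.Quotient.mk_eq_zero A)
  obtain ⟨c₂, d₂, r₂⟩ := hL.subDeg_add (A := W ⊓ A.comap T) inf_le_left q₂ hq₂ (by
    intro b
    rw [← Subtype.coe_inj]
    refine (Submodule.Quotient.mk_eq_zero A).trans ?_
    simp)
  have hle := c₂.deg_mono c₁ fun x => by
    rintro _ ⟨w, hw, rfl⟩
    exact ⟨⟨T w, hmem w⟩, hT x _ hw, rfl⟩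
  simp only [twistedDeg, d₁, d₂, r₁, r₂]
  push_cast
  have : (S.deg (map (comap L W.subtype) q₂) : ℚ) ≤
    S.deg (map (comap L (A ⊔ W.map T).subtype) q₁) := by exact_mod_cast hle
  linarith

/-- If some nonzero subspace of a `T`-stable subspace `N` has nonnegative twisted degree, so has a
`T`-stable one, namely `W + T W + T² W + ⋯` for a minimal such subspace `W`. -/
theorem IsCoherent.exists_invariant (hL : S.IsCoherent L) (c : ℚ) (T : V →ₗ[K] V)
    (hT : ∀ x, ∀ v ∈ L x, T v ∈ L x) (N : Submodule K V) (hN : N ≤ N.comap T)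
    (W : Submodule K V) (hW : W ≠ ⊥) (hWN : W ≤ N) (hWc : 0 ≤ twistedDeg L c W) :
    ∃ W' : Submodule K V, W' ≠ ⊥ ∧ W' ≤ N ∧ W' ≤ W'.comap T ∧ 0 ≤ twistedDeg L c W' := by
  induction h : finrank K W using Nat.strong_induction_on generalizing W with
  | _ n ih =>
  by_cases hU : ∃ U : Submodule K V, U < W ∧ U ≠ ⊥ ∧ 0 ≤ twistedDeg L c U
  · obtain ⟨U, hUW, hU0, hUc⟩ := hU
    exact ih _ (h ▸ Submodule.finrank_lt_finrank_of_lt hUW) U hU0 (hUW.le.trans hWN) hUc rfl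
  have hmin : ∀ U < W, twistedDeg L c U ≤ 0 := by
    intro U hUW
    rcases eq_or_ne U ⊥ with rfl | hU0
    · exact (hL.twistedDeg_bot c).le
    · by_contra! hlt
      exact hU ⟨U, hUW, hU0, hlt.le⟩
  -- `W` has minimal dimension, so adding `T ^ k W` does not lower the twisted degree below zero
  let A : ℕ → Submodule K V := fun n => Nat.rec W (fun k B => B ⊔ W.map (T ^ (k + 1))) n
  have hA (k : ℕ) : A (k + 1) = A k ⊔ W.map (T ^ (k + 1)) := rfl
  have hTk (k : ℕ) : ∀ x, ∀ v ∈ L x, (T ^ k) v ∈ L x := by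
    induction k with
    | zero => exact fun x v hv => hv
    | succ k ihk =>
      intro x v hv
      rw [pow_succ']
      exact hT x _ (ihk x v hv)
  have hTN (k : ℕ) : W.map (T ^ k) ≤ N := by
    induction k with
    | zero => rwa [pow_zero, Module.End.one_eq_id, Submodule.map_id]
    | succ k ihk =>
      rw [pow_succ', Module.End.mul_eq_comp, Submodule.map_comp, Submodule.map_le_iff_le_comap]
      exact ihk.trans hN
  have hmono : Monotone A := monotone_nat_of_le_succ fun k => by
    rw [hA]
    exact le_sup_left
  have hAc (k : ℕ) : 0 ≤ twistedDeg L c (A k) := by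
    induction k with
    | zero => exact hWc
    | succ k ihk =>
      rw [hA]
      have h1 := hL.twistedDeg_add_le c (T ^ (k + 1)) (hTk _) (A k) W
      rcases (inf_le_left : W ⊓ (A k).comap (T ^ (k + 1)) ≤ W).lt_or_eq with h2 | h2
      · linarith [hmin _ h2]
      · rw [h2] at h1
        linarith
  have hAN (k : ℕ) : A k ≤ N := by
    induction k with
    | zero => exact hWN
    | succ k ihk => exact sup_le ihk (hTN _)
  obtain ⟨n, hn⟩ := monotone_stabilizes_iff_noetherian.2 (inferInstance : IsNoetherian K V)
    ⟨A, hmono⟩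
  have hWA : W ≤ A n := hmono (Nat.zero_le n)
  refine ⟨A n, fun h0 => hW (le_bot_iff.1 (h0 ▸ hWA)), hAN n, ?_, hAc n⟩
  have hk (k : ℕ) : W.map (T ^ k) ≤ A n := by
    have hWA0 : W ≤ A 0 := le_rfl
    have h1 : W.map (T ^ k) ≤ A k := by
      cases k with
      | zero =>
        rw [pow_zero, Module.End.one_eq_id, Submodule.map_id]
        exact hWA0
      | succ k => exact le_sup_right
    refine h1.trans ?_
    rcases le_total k n with h2 | h2
    · exact hmono h2
    · exact (hn k h2).ge
  have key (k : ℕ) : A k ≤ (A n).comap T := by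
    induction k with
    | zero =>
      have := hk 1
      rw [pow_one] at this
      exact Submodule.map_le_iff_le_comap.1 this
    | succ k ihk =>
      refine sup_le ihk ?_
      rw [← Submodule.map_le_iff_le_comap, ← Submodule.map_comp, ← Module.End.mul_eq_comp,
        ← pow_succ']
      exact hk _
  exact key n

end PlaceSystem

end

/-! ### Sections, subsheaves and quotient sheaves -/

noncomputable section

open Opposite

namespace SmoothCurve
variable {C : SmoothCurve} {E E' : C.X.Modules} {U V W : C.X.Opens}

section Sections

@[simp]
theorem res_add (h : V ≤ U) (s t : Γ(E, U)) : res E h (s + t) = res E h s + res E h t :=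
  map_add (E.presheaf.map (homOfLE h).op).hom s t

@[simp]
theorem res_zero (h : V ≤ U) : res E h 0 = 0 :=
  map_zero (E.presheaf.map (homOfLE h).op).hom

@[simp]
theorem res_sum (h : V ≤ U) {ι : Type*} (I : Finset ι) (s : ι → Γ(E, U)) :
    res E h (∑ i ∈ I, s i) = ∑ i ∈ I, res E h (s i) :=
  map_sum (E.presheaf.map (homOfLE h).op).hom s I

theorem res_smul (h : V ≤ U) (a : Γ(C.X, U)) (s : Γ(E, U)) :
    res E h (a • s) = C.X.presheaf.map (homOfLE h).op a • res E h s :=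
  Scheme.Modules.map_smul E (homOfLE h) a s

@[simp]
theorem res_res (h : V ≤ U) (h' : W ≤ V) (s : Γ(E, U)) :
    res E h' (res E h s) = res E (h'.trans h) s := by
  rw [res, res, ← ConcreteCategory.comp_apply, ← Functor.map_comp]
  rfl

@[simp]
theorem res_self (s : Γ(E, U)) : res E le_rfl s = s :=
  congr($(E.presheaf.map_id (op U)) s)

theorem app_res (f : E ⟶ E') (h : V ≤ U) (s : Γ(E, U)) :
    f.app V (res E h s) = res E' h (f.app U s) :=
  congr($(f.mapPresheaf.naturality (homOfLE h).op) s)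

@[simp]
theorem app_smul (f : E ⟶ E') (a : Γ(C.X, U)) (s : Γ(E, U)) :
    f.app U (a • s) = a • f.app U s := Scheme.Modules.Hom.app_smul f a s

@[simp]
theorem comp_app_apply {E'' : C.X.Modules} (f : E ⟶ E') (g : E' ⟶ E'') (s : Γ(E, U)) :
    (f ≫ g).app U s = g.app U (f.app U s) := rfl

/-- Sections which agree locally are equal. -/
theorem section_ext (s t : Γ(E, U))
    (h : ∀ x ∈ U, ∃ (V : C.X.Opens) (_ : x ∈ V) (hV : V ≤ U), res E hV s = res E hV t) : s = t := by
  choose! V hxV hV hst using h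
  exact TopCat.Sheaf.eq_of_locally_eq' ⟨E.presheaf, E.isSheaf⟩ (fun x : U => V x) U
    (fun x => homOfLE (hV x x.2))
    (fun x hx => TopologicalSpace.Opens.mem_iSup.2 ⟨⟨x, hx⟩, hxV x hx⟩)
    s t fun x => hst x x.2

theorem exists_glue {ι : Type} (V : ι → C.X.Opens) (hV : ∀ i, V i ≤ U) (hU : U ≤ iSup V)
    (s : ∀ i, Γ(E, V i))
    (h : ∀ i j, res E (inf_le_left : V i ⊓ V j ≤ V i) (s i) =
      res E (inf_le_right : V i ⊓ V j ≤ V j) (s j)) :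
    ∃ t : Γ(E, U), ∀ i, res E (hV i) t = s i :=
  (TopCat.Sheaf.existsUnique_gluing' ⟨E.presheaf, E.isSheaf⟩ V U
    (fun i => homOfLE (hV i)) hU s h).exists

theorem subsingleton_sections (h : U = ⊥) : Subsingleton Γ(E, U) := ⟨fun s t =>
  section_ext s t fun x hx => by rw [h] at hx; exact hx.elim⟩

theorem hom_ext_sections {f g : E ⟶ E'}
    (h : ∀ (U : C.X.Opens) (s : Γ(E, U)), f.app U s = g.app U s) : f = g := by
  ext U s
  exact h U s

end Sections

/-- A family of submodules of sections which is stable under restriction and defined by a local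
condition. -/
structure Subsheaf (E : C.X.Modules) where
  sections (U : C.X.Opens) : Submodule Γ(C.X, U) Γ(E, U)
  res_mem {U V : C.X.Opens} (h : V ≤ U) {s : Γ(E, U)} (hs : s ∈ sections U) :
    res E h s ∈ sections V
  mem_of_local {U : C.X.Opens} {s : Γ(E, U)}
    (hs : ∀ x ∈ U, ∃ (V : C.X.Opens) (_ : x ∈ V) (h : V ≤ U), res E h s ∈ sections V) :
    s ∈ sections U

namespace Subsheaf

variable (N : Subsheaf E)

/-- A subsheaf as a submodule of the underlying presheaf of modules. -/
def toSubmodule : E.val.Submodule where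
  obj U := N.sections U.unop
  map f _ hs := N.res_mem f.unop.le hs

/-- The sheaf of modules associated to a subsheaf. -/
def toModules : C.X.Modules where
  val := N.toSubmodule.toPresheafOfModules
  isSheaf := by
    change TopCat.Presheaf.IsSheaf (X := C.X) _
    rw [TopCat.Presheaf.isSheaf_iff_isSheafUniqueGluing]
    intro ι V sf h
    have key : ∃ t : Γ(E, iSup V), ∀ i, res E (le_iSup V i) t = (sf i).1 :=
      exists_glue V (le_iSup V) le_rfl (fun i => (sf i).1) fun i j => congrArg Subtype.val (h i j)
    obtain ⟨t, ht⟩ := key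
    have htN : t ∈ N.sections (iSup V) := N.mem_of_local fun x hx => by
      obtain ⟨i, hi⟩ := TopologicalSpace.Opens.mem_iSup.1 hx
      exact ⟨V i, hi, le_iSup V i, ht i ▸ (sf i).2⟩
    refine ⟨⟨t, htN⟩, fun i => Subtype.ext (ht i), ?_⟩
    rintro ⟨t', ht'N⟩ ht'
    refine Subtype.ext (section_ext _ _ fun x hx => ?_)
    obtain ⟨i, hi⟩ := TopologicalSpace.Opens.mem_iSup.1 hx
    exact ⟨V i, hi, le_iSup V i, (congrArg Subtype.val (ht' i)).trans (ht i).symm⟩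

/-- The inclusion of a subsheaf. -/
def ι : N.toModules ⟶ E := ⟨N.toSubmodule.ι⟩

theorem ι_injective (U : C.X.Opens) : Function.Injective (N.ι.app U) := fun _ _ h => Subtype.ext h

theorem ι_mem (s : Γ(N.toModules, U)) : N.ι.app U s ∈ N.sections U := s.2

theorem exists_ι_eq {s : Γ(E, U)} (hs : s ∈ N.sections U) : ∃ t, N.ι.app U t = s := ⟨⟨s, hs⟩, rfl⟩

/-- A homomorphism with values in a subsheaf factors through it. -/
def lift (f : E' ⟶ E) (hf : ∀ (U : C.X.Opens) (s : Γ(E', U)), f.app U s ∈ N.sections U) :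
    E' ⟶ N.toModules :=
  let φ : E'.val ⟶ N.toSubmodule.toPresheafOfModules := PresheafOfModules.homMk
    { app U := AddCommGrpCat.ofHom
        (((f.app U.unop).hom).codRestrict (N.sections U.unop).toAddSubgroup (hf _))
      naturality U V i := by
        ext s
        exact Subtype.ext (app_res f i.unop.le s) }
    fun U r m => Subtype.ext (app_smul f r m)
  ⟨φ⟩

theorem lift_ι (f : E' ⟶ E) (hf : ∀ (U : C.X.Opens) (s : Γ(E', U)), f.app U s ∈ N.sections U) :
    N.lift f hf ≫ N.ι = f := rfl

instance : Mono N.ι where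
  right_cancellation _ _ h := hom_ext_sections fun U s =>
    N.ι_injective U congr(Scheme.Modules.Hom.app $h U s)

end Subsheaf

/-- The subsheaf of sections killed by a homomorphism. -/
def kernelSubsheaf (f : E ⟶ E') : Subsheaf E where
  sections U :=
    { carrier := {s | f.app U s = 0}
      add_mem' := fun {a b} ha hb => by
        rw [Set.mem_ofPred_eq, map_add, ha, hb, add_zero]
      zero_mem' := map_zero (f.app U).hom
      smul_mem' := fun a s hs => by
        rw [Set.mem_ofPred_eq, app_smul, hs, smul_zero] }
  res_mem {U V} h s hs := by
    change f.app V (res E h s) = 0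
    rw [app_res, (show f.app U s = 0 from hs), res_zero]
  mem_of_local {U s} hs := section_ext _ _ fun x hx => by
    obtain ⟨V, hxV, h, hV⟩ := hs x hx
    exact ⟨V, hxV, h, by rw [← app_res, res_zero]; exact hV⟩

/-- The subsheaf of sections which locally lift along a homomorphism. -/
def imageSubsheaf (f : E ⟶ E') : Subsheaf E' where
  sections U :=
    { carrier := {s | ∀ x ∈ U, ∃ (V : C.X.Opens) (_ : x ∈ V) (h : V ≤ U) (t : Γ(E, V)),
        f.app V t = res E' h s}
      add_mem' := fun {a b} ha hb x hx => by
        obtain ⟨V, hxV, h, t, ht⟩ := ha x hx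
        obtain ⟨V', hxV', h', t', ht'⟩ := hb x hx
        refine ⟨V ⊓ V', ⟨hxV, hxV'⟩, inf_le_left.trans h, res E inf_le_left t +
          res E inf_le_right t', ?_⟩
        rw [map_add, app_res, app_res, ht, ht', res_res, res_res, res_add]
      zero_mem' := fun x hx => ⟨U, hx, le_rfl, 0, by rw [map_zero, res_zero]⟩
      smul_mem' := fun a s hs x hx => by
        obtain ⟨V, hxV, h, t, ht⟩ := hs x hx
        exact ⟨V, hxV, h, C.X.presheaf.map (homOfLE h).op a • t, by rw [app_smul, ht, res_smul]⟩ }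
  res_mem {U V} h s hs x hx := by
    obtain ⟨W, hxW, h', t, ht⟩ := hs x (h hx)
    exact ⟨V ⊓ W, ⟨hx, hxW⟩, inf_le_left, res E inf_le_right t, by
      rw [app_res, ht, res_res, res_res]⟩
  mem_of_local {U s} hs x hx := by
    obtain ⟨V, hxV, h, hV⟩ := hs x hx
    obtain ⟨W, hxW, h', t, ht⟩ := hV x hxV
    exact ⟨W, hxW, h'.trans h, t, by rw [ht, res_res]⟩

/-- A monomorphism is injective on sections, as it has no kernel subsheaf. -/
theorem app_injective_of_mono (f : E ⟶ E') [Mono f] (U : C.X.Opens) :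
    Function.Injective (f.app U) := by
  have h0 : (kernelSubsheaf f).ι ≫ f = 0 := hom_ext_sections fun U s =>
    (kernelSubsheaf f).ι_mem s
  rw [← zero_comp, cancel_mono] at h0
  refine (injective_iff_map_eq_zero (f.app U).hom).2 fun s hs => ?_
  obtain ⟨t, rfl⟩ := (kernelSubsheaf f).exists_ι_eq (U := U) (s := s) hs
  rw [h0]
  rfl

/-- Left exactness of sections: in an abelian category, a monomorphism is the kernel of its
cokernel. -/
theorem exists_app_eq_of_cokernel (f : E ⟶ E') [Mono f] {s : Γ(E', U)}
    (hs : (cokernel.π f).app U s = 0) : ∃ t, f.app U t = s := by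
  let N := kernelSubsheaf (cokernel.π f)
  have h0 : N.ι ≫ cokernel.π f = 0 := hom_ext_sections fun U s => N.ι_mem s
  obtain ⟨t, rfl⟩ := N.exists_ι_eq (U := U) (s := s) hs
  refine ⟨((Abelian.monoIsKernelOfCokernel _ (cokernelIsCokernel f)).lift
    (KernelFork.ofι N.ι h0)).app U t, ?_⟩
  have := (Abelian.monoIsKernelOfCokernel _ (cokernelIsCokernel f)).fac
    (KernelFork.ofι N.ι h0) WalkingParallelPair.zero
  exact congr(Scheme.Modules.Hom.app $this U t)

/-- Sections lift locally along an epimorphism, as the image subsheaf is everything. -/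
theorem exists_local_lift_of_epi (f : E ⟶ E') [Epi f] (s : Γ(E', U)) {x : C.X} (hx : x ∈ U) :
    ∃ (V : C.X.Opens) (_ : x ∈ V) (h : V ≤ U) (t : Γ(E, V)), f.app V t = res E' h s := by
  let N := imageSubsheaf f
  have hf : N.lift f (fun U s x hx => ⟨U, hx, le_rfl, s, by rw [res_self]⟩) ≫ N.ι = f :=
    N.lift_ι _ _
  have : Epi N.ι := epi_of_epi_fac hf
  have : IsIso N.ι := isIso_of_mono_of_epi _
  have hs : N.ι.app U ((inv N.ι).app U s) = s := by
    rw [← comp_app_apply, IsIso.inv_hom_id]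
    rfl
  have := N.ι_mem ((inv N.ι).app U s)
  rw [hs] at this
  exact this x hx

theorem isIso_of_app_bijective (f : E ⟶ E') (h : ∀ U, Function.Bijective (f.app U)) : IsIso f :=
  Scheme.Modules.Hom.isIso_iff_isIso_app.2 fun U => (ConcreteCategory.isIso_iff_bijective _).2 (h U)

end SmoothCurve
end

/-! ### Rational functions on a curve -/

noncomputable section

open Opposite Module

namespace SmoothCurve

section RationalFunctions

variable (C : SmoothCurve)

/-- The local rings of a curve and the orders of vanishing. -/
def places : PlaceSystem C.X.functionField C.X where
  O := C.place
  ord x f := Scheme.ord f x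
  isPrincipalIdealRing := C.place_isPrincipalIdealRing
  ord_mul _ _ _ hf hg := Scheme.ord_mul hf hg
  ord_nonneg _ _ := C.ord_nonneg
  finite_notMem := C.finite_setOf_notMem_place
  finsum_ord _ := C.finsum_ord

variable {C} {U V W : C.X.Opens} {x : C.X}

theorem genericPoint_mem (U : C.X.Opens) [h : Nonempty U] : genericPoint C.X ∈ U :=
  ((genericPoint_spec C.X).mem_open_set_iff U.isOpen).2 (by simpa using h)

instance nonempty_inf [Nonempty U] [Nonempty V] : Nonempty (U ⊓ V : C.X.Opens) :=
  ⟨⟨genericPoint C.X, genericPoint_mem U, genericPoint_mem V⟩⟩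

theorem germToFunctionField_map (h : V ≤ U) [Nonempty U] [Nonempty V] (a : Γ(C.X, U)) :
    C.X.germToFunctionField V (C.X.presheaf.map (homOfLE h).op a) =
      C.X.germToFunctionField U a :=
  TopCat.Presheaf.germ_res_apply _ _ _ _ _

theorem germToFunctionField_mem_place [Nonempty U] (hx : x ∈ U) (a : Γ(C.X, U)) :
    C.X.germToFunctionField U a ∈ C.place x :=
  ⟨C.X.presheaf.germ U x hx a, Scheme.algebraMap_germ_eq_germToFunctionField _ hx a⟩

theorem exists_of_mem_place {f : C.X.functionField} (hf : f ∈ C.place x) :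
    ∃ (U : C.X.Opens) (_ : x ∈ U) (_ : Nonempty U) (a : Γ(C.X, U)),
      C.X.germToFunctionField U a = f := by
  obtain ⟨b, rfl⟩ := hf
  obtain ⟨U, hU, a, rfl⟩ := C.X.presheaf.exists_germ_eq b
  have : Nonempty U := ⟨⟨x, hU⟩⟩
  exact ⟨U, hU, this, a, (Scheme.algebraMap_germ_eq_germToFunctionField _ hU a).symm⟩

theorem place_genericPoint : C.place (genericPoint C.X) = ⊤ := by
  rw [eq_top_iff]
  intro f _
  obtain ⟨U, hU, a, rfl⟩ := C.X.presheaf.exists_germ_eq f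
  have : Nonempty U := ⟨⟨_, hU⟩⟩
  exact germToFunctionField_mem_place hU a

theorem exists_common_sections {ι : Type*} [Finite ι] {c : ι → C.X.functionField}
    (hc : ∀ i, c i ∈ C.place x) (hx : x ∈ U) :
    ∃ (W : C.X.Opens) (_ : x ∈ W) (_ : W ≤ U) (_ : Nonempty W) (a : ι → Γ(C.X, W)),
      ∀ i, C.X.germToFunctionField W (a i) = c i := by
  have := Fintype.ofFinite ι
  choose V hV hV' a ha using fun i => exists_of_mem_place (hc i)
  let W := U ⊓ Finset.univ.inf V
  have hWV (i : ι) : W ≤ V i := inf_le_right.trans (Finset.inf_le (Finset.mem_univ i))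
  have hxW : x ∈ W := by
    refine ⟨hx, ?_⟩
    change x ∈ ((Finset.univ.inf V : C.X.Opens) : Set C.X)
    rw [TopologicalSpace.Opens.coe_finset_inf]
    simpa [Finset.inf_set_eq_iInter] using hV
  have : Nonempty W := ⟨⟨x, hxW⟩⟩
  exact ⟨W, hxW, inf_le_left, this, fun i => C.X.presheaf.map (homOfLE (hWV i)).op (a i),
    fun i => by rw [germToFunctionField_map, ha]⟩

/-- A rational function which is regular at all points of `U` is regular on `U`. -/
theorem exists_of_forall_mem_place [Nonempty U] {f : C.X.functionField}
    (hf : ∀ x ∈ U, f ∈ C.place x) : ∃ a : Γ(C.X, U), C.X.germToFunctionField U a = f := by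
  have h (x : U) : ∃ (W : C.X.Opens) (_ : x.1 ∈ W) (_ : W ≤ U) (_ : Nonempty W) (a : Γ(C.X, W)),
      C.X.germToFunctionField W a = f := by
    obtain ⟨W, h1, h2, h3, a, ha⟩ := exists_common_sections (c := fun _ : Unit => f)
      (fun _ => hf x x.2) x.2
    exact ⟨W, h1, h2, h3, a (), ha ()⟩
  choose W hxW hWU hW a ha using h
  obtain ⟨t, ht⟩ := (TopCat.Sheaf.existsUnique_gluing' C.X.sheaf W U (fun i => homOfLE (hWU i))
    (fun x hx => TopologicalSpace.Opens.mem_iSup.2 ⟨⟨x, hx⟩, hxW ⟨x, hx⟩⟩) a fun i j => by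
      apply Scheme.germToFunctionField_injective (X := C.X) (W i ⊓ W j)
      exact (germToFunctionField_map inf_le_left _).trans ((ha i).trans ((ha j).symm.trans
        (germToFunctionField_map inf_le_right _).symm))).exists
  have hx : genericPoint C.X ∈ U := genericPoint_mem U
  refine ⟨t, ?_⟩
  exact (germToFunctionField_map (hWU ⟨_, hx⟩) t).symm.trans
    ((congrArg _ (ht ⟨_, hx⟩)).trans (ha ⟨_, hx⟩))

/-- Points other than the generic point are closed, because the local rings are principal ideal
rings. -/
theorem isClosed_singleton (hx : x ≠ genericPoint C.X) : IsClosed {x} := by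
  rw [← closure_subset_iff_isClosed]
  intro z hz
  by_contra hzx
  have h1 : x ⤳ z := specializes_iff_mem_closure.2 hz
  have h2 : z < x := lt_of_le_not_ge (Scheme.le_iff_specializes.2 h1) fun h =>
    hzx (Specializes.antisymm (Scheme.le_iff_specializes.1 h) h1).eq
  have h3 : x < genericPoint C.X := lt_of_le_not_ge
    (Scheme.le_iff_specializes.2 (genericPoint_specializes x)) fun h =>
    hx (Specializes.antisymm (Scheme.le_iff_specializes.1 h) (genericPoint_specializes x)).eq
  have h4 := Order.coheight_add_one_le h2
  have h5 := Order.coheight_add_one_le h3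
  have h6 : ringKrullDim (C.X.presheaf.stalk z) ≤ (1 : ℕ) :=
    Ring.krullDimLE_iff.1 inferInstance
  rw [ringKrullDim_stalk_eq_coheight] at h6
  have h7 : Order.coheight z ≤ 1 := by exact_mod_cast h6
  have h8 : (1 : ℕ∞) + 1 ≤ Order.coheight z :=
    le_trans (by gcongr; exact le_trans (by simp) h5) h4
  exact absurd (h8.trans h7) (by norm_num)

instance compactSpace : CompactSpace C.X := by
  have : QuasiCompact C.toSpec := inferInstance
  exact ⟨by simpa using this.isCompact_preimage Set.univ isOpen_univ isCompact_univ⟩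

theorem finite_of_locally_finite {S : Set C.X}
    (h : ∀ x : C.X, ∃ U : C.X.Opens, x ∈ U ∧ (S ∩ U).Finite) : S.Finite := by
  have := isCompact_univ.induction_on (p := fun s : Set C.X => (S ∩ s).Finite) (by simp)
    (fun s t hst ht => ht.subset (Set.inter_subset_inter_right _ hst))
    (fun s t hs ht => by rw [Set.inter_union_distrib_left]; exact hs.union ht)
    (fun x _ => by
      obtain ⟨U, hxU, hU⟩ := h x
      exact ⟨U, mem_nhdsWithin_of_mem_nhds (U.isOpen.mem_nhds hxU), hU⟩)
  simpa using this

end RationalFunctions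
end SmoothCurve
end

/-! ### The generic fibre of a sheaf -/

noncomputable section

open Opposite Module

namespace SmoothCurve

variable {C : SmoothCurve} {E E' : C.X.Modules} {U W : C.X.Opens} {x : C.X}

/-- An identification of the generic stalk of `E` with a vector space `V` over the function field,
for a sheaf of modules `E` all of whose sections are determined by their germ at the generic
point. -/
structure GenericFiber (E : C.X.Modules) (V : Type*) [AddCommGroup V]
    [Module C.X.functionField V] where
  /-- The germ at the generic point. -/
  germ (U : C.X.Opens) : Γ(E, U) →+ V
  germ_smul (U : C.X.Opens) [Nonempty U] (a : Γ(C.X, U)) (s : Γ(E, U)) :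
    germ U (a • s) = C.X.germToFunctionField U a • germ U s
  germ_res {U W : C.X.Opens} (h : W ≤ U) [Nonempty W] (s : Γ(E, U)) : germ W (res E h s) = germ U s
  injective (U : C.X.Opens) [Nonempty U] : Function.Injective (germ U)
  exists_eq (v : V) : ∃ (U : C.X.Opens) (_ : Nonempty U) (s : Γ(E, U)), germ U s = v

namespace GenericFiber

variable {V : Type*} [AddCommGroup V] [Module C.X.functionField V] (g : GenericFiber E V)
  {V' : Type*} [AddCommGroup V'] [Module C.X.functionField V'] (g' : GenericFiber E' V')

/-- The stalk of `E` at `x`, as a module over the local ring, inside the generic stalk. -/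
def lattice (x : C.X) : Submodule (C.places.O x) V where
  carrier := {v | ∃ (U : C.X.Opens) (_ : x ∈ U) (s : Γ(E, U)), g.germ U s = v}
  add_mem' := by
    rintro _ _ ⟨U, hU, s, rfl⟩ ⟨W, hW, t, rfl⟩
    have : Nonempty (U ⊓ W : C.X.Opens) := ⟨⟨x, hU, hW⟩⟩
    exact ⟨U ⊓ W, ⟨hU, hW⟩, res E inf_le_left s + res E inf_le_right t, by
      rw [map_add, germ_res, germ_res]⟩
  zero_mem' := ⟨⊤, trivial, 0, map_zero _⟩
  smul_mem' := by
    rintro ⟨f, hf⟩ _ ⟨U, hU, s, rfl⟩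
    obtain ⟨W, hxW, hWU, _, a, ha⟩ := exists_common_sections (c := fun _ : Unit => f)
      (fun _ => hf) hU
    refine ⟨W, hxW, a () • res E hWU s, ?_⟩
    rw [germ_smul, ha, germ_res]
    rfl

theorem germ_mem_lattice (hx : x ∈ U) (s : Γ(E, U)) : g.germ U s ∈ g.lattice x := ⟨U, hx, s, rfl⟩

/-- An element of the generic stalk which belongs to all stalks over `U` is a section over `U`. -/
theorem exists_germ_eq [Nonempty U] {v : V} (hv : ∀ x ∈ U, v ∈ g.lattice x) :
    ∃ s, g.germ U s = v := by
  have h (x : U) : ∃ (W : C.X.Opens) (_ : x.1 ∈ W) (_ : W ≤ U) (s : Γ(E, W)), g.germ W s = v := by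
    obtain ⟨W, hW, s, hs⟩ := hv x x.2
    have : Nonempty (W ⊓ U : C.X.Opens) := ⟨⟨x, hW, x.2⟩⟩
    exact ⟨W ⊓ U, ⟨hW, x.2⟩, inf_le_right, res E inf_le_left s, by rw [germ_res, hs]⟩
  choose W hxW hWU s hs using h
  have (x : U) : Nonempty (W x) := ⟨⟨x, hxW x⟩⟩
  obtain ⟨t, ht⟩ := exists_glue W hWU
    (fun x hx => TopologicalSpace.Opens.mem_iSup.2 ⟨⟨x, hx⟩, hxW ⟨x, hx⟩⟩) s fun i j => by
      apply g.injective
      rw [germ_res, germ_res, hs, hs]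
  refine ⟨t, ?_⟩
  have i : U := Classical.arbitrary U
  rw [← g.germ_res (hWU i), ht, hs]

theorem germ_sum_smul [Nonempty U] {ι : Type*} [Fintype ι] (c : ι → Γ(C.X, U))
    (s : ι → Γ(E, U)) : g.germ U (∑ i, c i • s i) =
      ∑ i, C.X.germToFunctionField U (c i) • g.germ U (s i) := by
  rw [map_sum]
  simp only [germ_smul]

section Frames

variable {ι : Type} [Fintype ι]

theorem exists_basis_of_isFrame [Nonempty U] {s : ι → Γ(E, U)} (hs : IsFrame E U s) :
    ∃ b : Basis ι C.X.functionField V, ∀ i, b i = g.germ U (s i) := by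
  have hli : LinearIndependent C.X.functionField fun i => g.germ U (s i) := by
    rw [Fintype.linearIndependent_iff]
    intro c hc
    obtain ⟨W, -, hWU, _, a, ha⟩ := exists_common_sections (c := c)
      (fun i => place_genericPoint (C := C) ▸ trivial) (genericPoint_mem U)
    have h0 : (∑ i, a i • res E hWU (s i)) = 0 := by
      apply g.injective
      rw [germ_sum_smul, map_zero, ← hc]
      simp only [ha, germ_res]
    have h1 := (hs W hWU 0).unique (y₁ := a) (y₂ := 0) h0.symm (by simp)
    intro i
    rw [← ha, h1, Pi.zero_apply, map_zero]
  refine ⟨Basis.mk hli ?_, fun i => by rw [Basis.mk_apply]⟩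
  intro v _
  obtain ⟨W, _, t, rfl⟩ := g.exists_eq v
  obtain ⟨c, hc, -⟩ := hs (U ⊓ W) inf_le_left (res E inf_le_right t)
  rw [← g.germ_res (inf_le_right : U ⊓ W ≤ W) t, hc, germ_sum_smul]
  simp only [germ_res]
  exact Submodule.sum_mem _ fun i _ =>
    Submodule.smul_mem _ _ (Submodule.subset_span ⟨i, rfl⟩)

theorem span_of_isFrame [Nonempty U] {s : ι → Γ(E, U)} (hs : IsFrame E U s)
    {b : Basis ι C.X.functionField V} (hb : ∀ i, b i = g.germ U (s i)) (hx : x ∈ U) :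
    Submodule.span (C.places.O x) (Set.range b) = g.lattice x := by
  apply le_antisymm
  · rw [Submodule.span_le]
    rintro _ ⟨i, rfl⟩
    rw [hb]
    exact g.germ_mem_lattice hx _
  · rintro _ ⟨W, hW, t, rfl⟩
    have : Nonempty (U ⊓ W : C.X.Opens) := ⟨⟨x, hx, hW⟩⟩
    obtain ⟨c, hc, -⟩ := hs (U ⊓ W) inf_le_left (res E inf_le_right t)
    rw [← g.germ_res (inf_le_right : U ⊓ W ≤ W) t, hc, germ_sum_smul]
    refine Submodule.sum_mem _ fun i _ => ?_
    rw [germ_res, ← hb]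
    have hxUW : x ∈ U ⊓ W := ⟨hx, hW⟩
    exact Submodule.smul_mem _ (⟨_, germToFunctionField_mem_place hxUW (c i)⟩ : C.places.O x)
      (Submodule.subset_span ⟨i, rfl⟩)

/-- A basis of the generic stalk which spans all stalks over `U` is a frame over `U`. -/
theorem exists_isFrame_of_basis [Nonempty U] (b : Basis ι C.X.functionField V)
    (hb : ∀ x ∈ U, Submodule.span (C.places.O x) (Set.range b) = g.lattice x) :
    ∃ s : ι → Γ(E, U), (∀ i, b i = g.germ U (s i)) ∧ IsFrame E U s := by
  have h (i : ι) : ∃ s, g.germ U s = b i := g.exists_germ_eq fun x hx => by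
    rw [← hb x hx]
    exact Submodule.subset_span ⟨i, rfl⟩
  choose s hs using h
  refine ⟨s, fun i => (hs i).symm, fun W hW t => ?_⟩
  rcases eq_or_ne W ⊥ with rfl | hW0
  · have := subsingleton_sections (E := E) (U := (⊥ : C.X.Opens)) rfl
    have : Subsingleton Γ(C.X, (⊥ : C.X.Opens)) :=
      CommRingCat.subsingleton_of_isTerminal (Scheme.sheaf C.X).isTerminalOfEmpty
    exact ⟨0, Subsingleton.elim _ _, fun _ _ => Subsingleton.elim _ _⟩
  have : Nonempty W := by
    obtain ⟨x, hx⟩ := (TopologicalSpace.Opens.ne_bot_iff_nonempty W).1 hW0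
    exact ⟨⟨x, hx⟩⟩
  have h (i : ι) : ∃ a : Γ(C.X, W), C.X.germToFunctionField W a = b.repr (g.germ W t) i :=
    exists_of_forall_mem_place fun x hx => C.places.mem_span_basis.1
      (hb x (hW hx) ▸ g.germ_mem_lattice hx t) i
  choose c hc using h
  refine ⟨c, ?_, fun d hd => ?_⟩
  · apply g.injective
    rw [germ_sum_smul]
    simp only [hc, germ_res, hs]
    exact (b.sum_repr _).symm
  · funext i
    apply Scheme.germToFunctionField_injective (X := C.X) W
    rw [hc, hd, germ_sum_smul]
    simp only [germ_res, hs]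
    rw [b.repr_sum_self]

end Frames

theorem isCoherent (hE : IsVectorBundle E) : C.places.IsCoherent g.lattice := by
  have hloc (x : C.X) : ∃ (U : C.X.Opens) (_ : x ∈ U) (n : ℕ)
      (b : Basis (Fin n) C.X.functionField V), ∀ y ∈ U,
        Submodule.span (C.places.O y) (Set.range b) = g.lattice y := by
    obtain ⟨U, hx, n, s, hs⟩ := hE x
    have : Nonempty U := ⟨⟨x, hx⟩⟩
    obtain ⟨b, hb⟩ := g.exists_basis_of_isFrame hs
    exact ⟨U, hx, n, b, fun y hy => g.span_of_isFrame hs hb hy⟩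
  refine ⟨fun x => ?_, ?_⟩
  · obtain ⟨U, hx, n, b, hb⟩ := hloc x
    rw [← hb x hx]
    exact .span_basis b
  · obtain ⟨U, hx, n, b, hb⟩ := hloc (genericPoint C.X)
    refine ⟨n, b, finite_of_locally_finite fun x => ?_⟩
    obtain ⟨W, hxW, m, c, hc⟩ := hloc x
    refine ⟨W, hxW, ?_⟩
    have : ∀ᶠ y in Filter.cofinite, Submodule.span (C.places.O y) (Set.range b) =
        Submodule.span (C.places.O y) (Set.range c) := by
      filter_upwards [C.places.eventually_span_le b c, C.places.eventually_span_le c b] with y h1 h2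
      exact le_antisymm h1 h2
    refine Set.Finite.subset this ?_
    rintro y ⟨hy, hyW⟩ h
    exact hy (h.trans (hc y hyW))

theorem eq_top_of_genericPoint (M : Submodule (C.places.O (genericPoint C.X)) V)
    [Submodule.IsLattice C.X.functionField M] : M = ⊤ := by
  rw [eq_top_iff]
  intro v _
  obtain ⟨r, hr, h⟩ := Submodule.IsLattice.exists_smul_mem M v
  have h0 : (r : C.X.functionField) ≠ 0 := fun h0 =>
    nonZeroDivisors.ne_zero hr (Subtype.ext h0)
  have hi : (r : C.X.functionField)⁻¹ ∈ C.places.O (genericPoint C.X) := by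
    change _ ∈ C.place (genericPoint C.X)
    rw [place_genericPoint]
    trivial
  have : v = (⟨_, hi⟩ : C.places.O (genericPoint C.X)) • r • v := by
    change v = (r : C.X.functionField)⁻¹ • (r : C.X.functionField) • v
    rw [smul_smul, inv_mul_cancel₀ h0, one_smul]
  rw [this]
  exact M.smul_mem _ h

/-- For a coherent family of lattices, a basis of one of the lattices is a basis of the lattices
nearby. -/
theorem exists_nhd_span_eq {L : ∀ x, Submodule (C.places.O x) V} (hL : C.places.IsCoherent L)
    {ι : Type*} [Finite ι] {b : Basis ι C.X.functionField V}
    (hb : Submodule.span (C.places.O x) (Set.range b) = L x) :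
    ∃ (U : C.X.Opens) (_ : x ∈ U), ∀ y ∈ U, Submodule.span (C.places.O y) (Set.range b) = L y := by
  let F : Set C.X := {y | Submodule.span (C.places.O y) (Set.range b) ≠ L y}
  have hF : F.Finite := hL.eventually_span_eq b
  have hξ : genericPoint C.X ∉ F := by
    have := hL.isLattice (genericPoint C.X)
    have := Submodule.IsLattice.span_basis (R := C.places.O (genericPoint C.X)) b
    simp only [F, Set.mem_ofPred_eq, not_not]
    rw [eq_top_of_genericPoint (L _), eq_top_of_genericPoint (Submodule.span _ _)]
  have hc : IsClosed F := by
    rw [← Set.biUnion_of_singleton F]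
    exact hF.isClosed_biUnion fun y hy => isClosed_singleton fun h => hξ (h ▸ hy)
  exact ⟨⟨Fᶜ, hc.isOpen_compl⟩, fun h => h hb, fun y hy => not_not.1 hy⟩

/-- A sheaf of modules whose stalks form a coherent family of lattices is a vector bundle. -/
theorem isVectorBundle (h : C.places.IsCoherent g.lattice) : IsVectorBundle E := by
  intro x
  have := h.isLattice x
  obtain ⟨b, hb⟩ := Submodule.IsLattice.exists_basis (g.lattice x)
  obtain ⟨U, hx, hU⟩ := exists_nhd_span_eq h hb
  have : Nonempty U := ⟨⟨x, hx⟩⟩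
  obtain ⟨s, -, hs⟩ := g.exists_isFrame_of_basis b hU
  exact ⟨U, hx, _, s, hs⟩

theorem rank_eq (h : C.places.IsCoherent g.lattice) : rank E = finrank C.X.functionField V := by
  have key : {r | ∃ U : C.X.Opens, Nonempty U ∧ ∃ s : Fin r → Γ(E, U), IsFrame E U s} =
      {finrank C.X.functionField V} := by
    apply Set.eq_singleton_iff_nonempty_unique_mem.2
    constructor
    · obtain ⟨U, hx, n, s, hs⟩ := g.isVectorBundle h (genericPoint C.X)
      exact ⟨n, U, ⟨⟨_, hx⟩⟩, s, hs⟩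
    · rintro r ⟨U, _, s, hs⟩
      obtain ⟨b, -⟩ := g.exists_basis_of_isFrame hs
      rw [finrank_eq_card_basis b, Fintype.card_fin]
  rw [rank, key, csInf_singleton]

section Degree

variable {r : ℕ} {b : Fin r → Γ(E, U)} {β : Basis (Fin r) C.X.functionField V} {n : ℤ}

theorem isIndex_of_isOrderAt [Nonempty U] (hβ : ∀ i, β i = g.germ U (b i))
    (hn : IsOrderAt E b x n) : C.places.IsIndex x (g.lattice x) β n := by
  obtain ⟨V, hx, s, A, _, hs, hA, rfl⟩ := hn
  have : Nonempty V := ⟨⟨x, hx⟩⟩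
  obtain ⟨γ, hγ⟩ := g.exists_basis_of_isFrame hs
  refine ⟨γ, g.span_of_isFrame hs hγ hx, ?_⟩
  have hm : γ.toMatrix β = (C.X.germToFunctionField (U ⊓ V)).hom.mapMatrix A := by
    ext i j
    have h := congrArg (g.germ (U ⊓ V)) (hA j)
    rw [germ_res, germ_sum_smul, ← hβ] at h
    simp only [germ_res, ← hγ] at h
    rw [Basis.toMatrix_apply, h, γ.repr_sum_self]
    rfl
  rw [hm, ← RingHom.map_det]
  rfl

theorem isOrderAt_of_isIndex [Nonempty U] (h : C.places.IsCoherent g.lattice)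
    (hβ : ∀ i, β i = g.germ U (b i)) (hn : C.places.IsIndex x (g.lattice x) β n) :
    IsOrderAt E b x n := by
  obtain ⟨γ, hγ, rfl⟩ := hn
  obtain ⟨V, hx, hV⟩ := exists_nhd_span_eq h hγ
  have : Nonempty V := ⟨⟨x, hx⟩⟩
  obtain ⟨s, hs, hsF⟩ := g.exists_isFrame_of_basis γ hV
  choose A hA hA' using fun j => hsF (U ⊓ V) inf_le_right (res E inf_le_left (b j))
  have h1 : ∀ j, res E inf_le_left (b j) = ∑ i, Matrix.of (fun i j => A j i) i j •
      res E (inf_le_right : U ⊓ V ≤ V) (s i) := hA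
  refine ⟨V, hx, s, Matrix.of fun i j => A j i, inferInstance, hsF, h1, ?_⟩
  have hm : γ.toMatrix β =
      (C.X.germToFunctionField (U ⊓ V)).hom.mapMatrix (Matrix.of fun i j => A j i) := by
    ext i j
    have h := congrArg (g.germ (U ⊓ V)) (h1 j)
    rw [germ_res, germ_sum_smul, ← hβ] at h
    simp only [germ_res, ← hs] at h
    rw [Basis.toMatrix_apply, h, γ.repr_sum_self]
    rfl
  rw [hm, ← RingHom.map_det]
  rfl

theorem degree_eq [Module.Finite C.X.functionField V] (h : C.places.IsCoherent g.lattice) :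
    degree E = C.places.deg g.lattice := by
  have key (d : ℤ) (hd : HasDegree E d) : d = C.places.deg g.lattice := by
    obtain ⟨r, U, b, n, _, hb, hn, -, rfl⟩ := hd
    obtain ⟨β, hβ⟩ := g.exists_basis_of_isFrame hb
    exact (h.deg_eq fun x => g.isIndex_of_isOrderAt hβ (hn x)).symm
  have hex : ∃ d, HasDegree E d := by
    obtain ⟨U, hx, r, b, hb⟩ := g.isVectorBundle h (genericPoint C.X)
    have : Nonempty U := ⟨⟨_, hx⟩⟩
    obtain ⟨β, hβ⟩ := g.exists_basis_of_isFrame hb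
    obtain ⟨n, hn⟩ := h.exists_isIndex β
    exact ⟨_, r, U, b, n, this, hb, fun x => g.isOrderAt_of_isIndex h hβ (hn x),
      h.finite_support hn, rfl⟩
  rw [degree, dif_pos hex]
  exact key _ hex.choose_spec

end Degree
end GenericFiber
end SmoothCurve
end

/-! ### Generic fibres of vector bundles and of subsheaves -/

noncomputable section

open Opposite Module

namespace SmoothCurve

variable {C : SmoothCurve} {E E' E'' : C.X.Modules} {U W : C.X.Opens} {x : C.X}

theorem eq_bot_of_not_nonempty (hU : ¬ Nonempty U) : U = ⊥ := by
  rw [← TopologicalSpace.Opens.coe_eq_empty]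
  exact Set.not_nonempty_iff_eq_empty.1 fun ⟨x, hx⟩ => hU ⟨⟨x, hx⟩⟩

namespace GenericFiber

variable {V : Type*} [AddCommGroup V] [Module C.X.functionField V] (g : GenericFiber E V)
  {V' : Type*} [AddCommGroup V'] [Module C.X.functionField V'] (g' : GenericFiber E' V')

open Classical in
/-- Construction of the germ at the generic point from a functional relation: `R U s v` says that
`v` is the germ of the section `s` over `U`. Over the empty set the germ is zero. -/
def ofRel (R : ∀ U : C.X.Opens, Γ(E, U) → V → Prop)
    (hex : ∀ (U : C.X.Opens) [Nonempty U] (s : Γ(E, U)), ∃ v, R U s v)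
    (huniq : ∀ (U : C.X.Opens) [Nonempty U] (s : Γ(E, U)) (v w : V), R U s v → R U s w → v = w)
    (hadd : ∀ (U : C.X.Opens) [Nonempty U] (s t : Γ(E, U)) (v w : V),
      R U s v → R U t w → R U (s + t) (v + w))
    (hsmul : ∀ (U : C.X.Opens) [Nonempty U] (a : Γ(C.X, U)) (s : Γ(E, U)) (v : V),
      R U s v → R U (a • s) (C.X.germToFunctionField U a • v))
    (hres : ∀ (U W : C.X.Opens) [Nonempty U] [Nonempty W] (h : W ≤ U) (s : Γ(E, U)) (v : V),
      R U s v → R W (res E h s) v)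
    (hinj : ∀ (U : C.X.Opens) [Nonempty U] (s : Γ(E, U)), R U s 0 → s = 0)
    (hsurj : ∀ v : V, ∃ (U : C.X.Opens) (_ : Nonempty U) (s : Γ(E, U)), R U s v) :
    GenericFiber E V :=
  let γ (U : C.X.Opens) : Γ(E, U) →+ V := if h : Nonempty U then
    AddMonoidHom.mk' (fun s => (hex U s).choose) (fun s t =>
      huniq U _ _ _ (hex U (s + t)).choose_spec
        (hadd U _ _ _ _ (hex U s).choose_spec (hex U t).choose_spec)) else 0
  have hγ (U : C.X.Opens) [h : Nonempty U] (s : Γ(E, U)) (v : V) (hv : R U s v) : γ U s = v := by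
    simp only [γ, dif_pos h]
    exact huniq U _ _ _ (hex U s).choose_spec hv
  { germ := γ
    germ_smul U _ a s := by
      obtain ⟨v, hv⟩ := hex U s
      rw [hγ U s v hv, hγ U _ _ (hsmul U a s v hv)]
    germ_res {U W} h _ s := by
      have : Nonempty U := ⟨⟨genericPoint C.X, h (genericPoint_mem W)⟩⟩
      obtain ⟨v, hv⟩ := hex U s
      rw [hγ U s v hv, hγ W _ _ (hres U W h s v hv)]
    injective U _ := by
      refine (injective_iff_map_eq_zero _).2 fun s hs => ?_
      obtain ⟨v, hv⟩ := hex U s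
      rw [hγ U s v hv] at hs
      exact hinj U s (hs ▸ hv)
    exists_eq v := by
      obtain ⟨U, h, s, hs⟩ := hsurj v
      exact ⟨U, h, s, hγ U s v hs⟩ }

theorem ofRel_germ {R : ∀ U : C.X.Opens, Γ(E, U) → V → Prop} {hex huniq hadd hsmul hres hinj hsurj}
    [h : Nonempty U] {s : Γ(E, U)} {v : V} (hv : R U s v) :
    (ofRel R hex huniq hadd hsmul hres hinj hsurj).germ U s = v := by
  simp only [ofRel, dif_pos h]
  exact huniq U _ _ _ (hex U s).choose_spec hv

theorem eq_zero_of_isFrame {ι : Type} [Fintype ι] {s : ι → Γ(E, U)} (hs : IsFrame E U s)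
    {t : Γ(E, U)} (hW : W ≤ U) [Nonempty W] (ht : res E hW t = 0) : t = 0 := by
  have : Nonempty U := ⟨⟨genericPoint C.X, hW (genericPoint_mem W)⟩⟩
  obtain ⟨c, hc, -⟩ := hs U le_rfl t
  have h1 : c = 0 := by
    have h2 := congrArg (res E hW) hc
    simp only [ht, res_sum, res_smul, res_res] at h2
    have h3 := (hs W hW 0).unique h2 (y₂ := 0) (by simp)
    funext i
    apply Scheme.germToFunctionField_injective (X := C.X) U
    rw [← germToFunctionField_map hW]
    have h4 := congrFun h3 i
    rw [h4]
    simp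
  rw [hc, h1]
  simp

theorem isFrame_res {ι : Type} [Fintype ι] {s : ι → Γ(E, U)} (hs : IsFrame E U s) (h : W ≤ U) :
    IsFrame E W fun i => res E h (s i) := by
  intro W' h' t
  simpa only [res_res] using hs W' (h'.trans h) t

/-- A section of a vector bundle that vanishes on a nonempty open set is zero. -/
theorem eq_zero_of_isVectorBundle (hE : IsVectorBundle E) {t : Γ(E, U)} (hW : W ≤ U) [Nonempty W]
    (ht : res E hW t = 0) : t = 0 := by
  refine section_ext _ _ fun x hx => ?_
  obtain ⟨U', hx', n, s, hs⟩ := hE x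
  have : Nonempty U' := ⟨⟨x, hx'⟩⟩
  refine ⟨U ⊓ U', ⟨hx, hx'⟩, inf_le_left, ?_⟩
  rw [res_zero]
  refine eq_zero_of_isFrame (isFrame_res hs inf_le_right) (W := W ⊓ U') (inf_le_inf_right _ hW) ?_
  rw [res_res, ← res_res hW inf_le_left, ht, res_zero]

/-- A frame of a vector bundle over a nonempty open set trivializes the generic stalk. -/
theorem exists_genericFiber (hE : IsVectorBundle E) :
    ∃ r : ℕ, Nonempty (GenericFiber E (Fin r → C.X.functionField)) := by
  obtain ⟨U₀, hx₀, r, s, hs⟩ := hE (genericPoint C.X)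
  have : Nonempty U₀ := ⟨⟨_, hx₀⟩⟩
  refine ⟨r, ⟨ofRel (fun U t v => ∃ (W : C.X.Opens) (_ : Nonempty W) (h : W ≤ U) (h₀ : W ≤ U₀)
    (c : Fin r → Γ(C.X, W)), res E h t = ∑ i, c i • res E h₀ (s i) ∧
      ∀ i, v i = C.X.germToFunctionField W (c i)) ?_ ?_ ?_ ?_ ?_ ?_ ?_⟩⟩
  · intro U _ t
    obtain ⟨c, hc, -⟩ := hs (U ⊓ U₀) inf_le_right (res E inf_le_left t)
    exact ⟨_, U ⊓ U₀, inferInstance, inf_le_left, inf_le_right, c, hc, fun i => rfl⟩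
  · rintro U _ t v w ⟨W, _, h, h₀, c, hc, hv⟩ ⟨W', _, h', h₀', c', hc', hw⟩
    have h1 := congrArg (res E (inf_le_left : W ⊓ W' ≤ W)) hc
    have h2 := congrArg (res E (inf_le_right : W ⊓ W' ≤ W')) hc'
    simp only [res_sum, res_smul, res_res] at h1 h2
    have h3 := (hs (W ⊓ W') (inf_le_left.trans h₀) _).unique h1 h2
    funext i
    rw [hv, hw, ← germToFunctionField_map (inf_le_left : W ⊓ W' ≤ W),
      ← germToFunctionField_map (inf_le_right : W ⊓ W' ≤ W')]
    exact congrArg _ (congrFun h3 i)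
  · rintro U _ t t' v w ⟨W, _, h, h₀, c, hc, hv⟩ ⟨W', _, h', h₀', c', hc', hw⟩
    have h1 := congrArg (res E (inf_le_left : W ⊓ W' ≤ W)) hc
    have h2 := congrArg (res E (inf_le_right : W ⊓ W' ≤ W')) hc'
    simp only [res_sum, res_smul, res_res] at h1 h2
    refine ⟨W ⊓ W', inferInstance, inf_le_left.trans h, inf_le_left.trans h₀,
      fun i => C.X.presheaf.map (homOfLE inf_le_left).op (c i) +
        C.X.presheaf.map (homOfLE inf_le_right).op (c' i), ?_, fun i => ?_⟩
    rotate_left 1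
    · rw [Pi.add_apply, hv, hw, ← germToFunctionField_map (inf_le_left : W ⊓ W' ≤ W),
        ← germToFunctionField_map (inf_le_right : W ⊓ W' ≤ W'), ← map_add]
    · rw [res_add, h1, h2, ← Finset.sum_add_distrib]
      simp only [add_smul]
  · rintro U _ a t v ⟨W, _, h, h₀, c, hc, hv⟩
    refine ⟨W, inferInstance, h, h₀, fun i => C.X.presheaf.map (homOfLE h).op a * c i, ?_,
      fun i => ?_⟩
    rotate_left 1
    · rw [Pi.smul_apply, hv, ← germToFunctionField_map h, smul_eq_mul, ← map_mul]
    · rw [res_smul, hc, Finset.smul_sum]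
      simp only [mul_smul]
  · rintro U U' _ _ hU t v ⟨W, _, h, h₀, c, hc, hv⟩
    refine ⟨W ⊓ U', inferInstance, inf_le_right, inf_le_left.trans h₀,
      fun i => C.X.presheaf.map (homOfLE inf_le_left).op (c i), ?_, fun i => ?_⟩
    · have h1 := congrArg (res E (inf_le_left : W ⊓ U' ≤ W)) hc
      simp only [res_sum, res_smul, res_res] at h1
      rw [res_res, h1]
    · rw [hv, germToFunctionField_map]
  · rintro U _ t ⟨W, _, h, h₀, c, hc, hv⟩
    refine eq_zero_of_isVectorBundle hE h ?_
    rw [hc]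
    refine Finset.sum_eq_zero fun i _ => ?_
    have : c i = 0 := by
      apply Scheme.germToFunctionField_injective (X := C.X) W
      rw [← hv, map_zero, Pi.zero_apply]
    rw [this, zero_smul]
  · intro v
    obtain ⟨W, hxW, hWU, h, a, ha⟩ := exists_common_sections (c := v)
      (fun i => place_genericPoint (C := C) ▸ trivial) hx₀
    exact ⟨W, h, ∑ i, a i • res E hWU (s i), W, h, le_rfl, hWU, a, res_self _,
      fun i => (ha i).symm⟩

section Map

variable {g g'} in
theorem germ_app_eq (f : E ⟶ E') [Nonempty U] [Nonempty W] {s : Γ(E, U)} {t : Γ(E, W)}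
    (h : g.germ U s = g.germ W t) : g'.germ U (f.app U s) = g'.germ W (f.app W t) := by
  have h1 : res E (inf_le_left : U ⊓ W ≤ U) s = res E (inf_le_right : U ⊓ W ≤ W) t := by
    apply g.injective
    rw [germ_res, germ_res, h]
  rw [← g'.germ_res (inf_le_left : U ⊓ W ≤ U), ← g'.germ_res (inf_le_right : U ⊓ W ≤ W),
    ← app_res, ← app_res, h1]

/-- The linear map between the generic stalks induced by a homomorphism. -/
def map (f : E ⟶ E') : V →ₗ[C.X.functionField] V' :=
  have key (U : C.X.Opens) [Nonempty U] (s : Γ(E, U)) (v : V) (h : g.germ U s = v) :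
      g'.germ (g.exists_eq v).choose (f.app _ (g.exists_eq v).choose_spec.choose_spec.choose) =
        g'.germ U (f.app U s) :=
    have := (g.exists_eq v).choose_spec.choose
    germ_app_eq f ((g.exists_eq v).choose_spec.choose_spec.choose_spec.trans h.symm)
  { toFun v := g'.germ (g.exists_eq v).choose
      (f.app _ (g.exists_eq v).choose_spec.choose_spec.choose)
    map_add' v w := by
      obtain ⟨U, _, s, hs⟩ := g.exists_eq v
      obtain ⟨W, _, t, ht⟩ := g.exists_eq w
      rw [key U s v hs, key W t w ht, key (U ⊓ W) (res E inf_le_left s + res E inf_le_right t)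
        (v + w) (by rw [map_add, germ_res, germ_res, hs, ht]), map_add, map_add, app_res, app_res,
        germ_res, germ_res]
    map_smul' c v := by
      obtain ⟨U, _, s, hs⟩ := g.exists_eq v
      obtain ⟨W, -, hWU, _, a, ha⟩ := exists_common_sections (c := fun _ : Unit => c)
        (fun i => place_genericPoint (C := C) ▸ trivial) (genericPoint_mem U)
      rw [key U s v hs, key W (a () • res E hWU s) (c • v) (by rw [germ_smul, germ_res, hs, ha]),
        app_smul, germ_smul, ha, app_res, germ_res, RingHom.id_apply] }

@[simp]
theorem map_germ (f : E ⟶ E') [Nonempty U] (s : Γ(E, U)) :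
    g.map g' f (g.germ U s) = g'.germ U (f.app U s) :=
  have := (g.exists_eq (g.germ U s)).choose_spec.choose
  germ_app_eq f (g.exists_eq (g.germ U s)).choose_spec.choose_spec.choose_spec

theorem map_mem_lattice (f : E ⟶ E') {v : V} (hv : v ∈ g.lattice x) :
    g.map g' f v ∈ g'.lattice x := by
  obtain ⟨U, hx, s, rfl⟩ := hv
  have : Nonempty U := ⟨⟨x, hx⟩⟩
  rw [map_germ]
  exact g'.germ_mem_lattice hx _

theorem germ_eq_zero (hU : ¬ Nonempty U) (s : Γ(E, U)) : g.germ U s = 0 := by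
  have := subsingleton_sections (E := E) (eq_bot_of_not_nonempty hU)
  rw [Subsingleton.elim s 0, map_zero]

theorem eq_zero_of_germ {f : E ⟶ E'} (h : ∀ (U : C.X.Opens) (s : Γ(E, U)),
    g'.germ U (f.app U s) = 0) : f = 0 := by
  refine hom_ext_sections fun U s => ?_
  by_cases hU : Nonempty U
  · apply g'.injective
    rw [h, Scheme.Modules.Hom.zero_app]
    exact (map_zero _).symm
  · have := subsingleton_sections (E := E') (eq_bot_of_not_nonempty hU)
    exact Subsingleton.elim _ _

end Map

section Sub

/-- The subspace of the generic stalk generated by the sections of a subsheaf. -/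
def range (j : E' ⟶ E) : Submodule C.X.functionField V where
  carrier := {v | ∃ (U : C.X.Opens) (_ : Nonempty U) (s : Γ(E', U)), g.germ U (j.app U s) = v}
  add_mem' := by
    rintro _ _ ⟨U, _, s, rfl⟩ ⟨W, _, t, rfl⟩
    exact ⟨U ⊓ W, inferInstance, res E' inf_le_left s + res E' inf_le_right t, by
      rw [map_add, map_add, app_res, app_res, germ_res, germ_res]⟩
  zero_mem' := ⟨⊤, inferInstance, 0, by rw [map_zero, map_zero]⟩
  smul_mem' := by
    rintro c _ ⟨U, _, s, rfl⟩
    obtain ⟨W, -, hWU, _, a, ha⟩ := exists_common_sections (c := fun _ : Unit => c)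
      (fun i => place_genericPoint (C := C) ▸ trivial) (genericPoint_mem U)
    exact ⟨W, inferInstance, a () • res E' hWU s, by
      rw [app_smul, germ_smul, ha, app_res, germ_res]⟩

variable {j : E' ⟶ E}

theorem germ_mem_range (j : E' ⟶ E) (s : Γ(E', U)) : g.germ U (j.app U s) ∈ g.range j := by
  by_cases hU : Nonempty U
  · exact ⟨U, hU, s, rfl⟩
  · rw [g.germ_eq_zero hU]
    exact zero_mem _

variable (j) in
/-- The generic stalk of a subsheaf, as a subspace. -/
def sub [Mono j] : GenericFiber E' (g.range j) where
  germ U := ((g.germ U).comp (j.app U).hom).codRestrict _ (g.germ_mem_range j)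
  germ_smul U _ a s := Subtype.ext <| by
    change g.germ U (j.app U (a • s)) = _
    rw [app_smul, germ_smul]
    rfl
  germ_res {U W} h _ s := Subtype.ext <| by
    change g.germ W (j.app W (res E' h s)) = _
    rw [app_res, germ_res]
    rfl
  injective U _ := fun s t h => app_injective_of_mono j U (g.injective U (congrArg Subtype.val h))
  exists_eq := by
    rintro ⟨_, U, h, s, rfl⟩
    exact ⟨U, h, s, rfl⟩

theorem coe_sub_germ [Mono j] (s : Γ(E', U)) : ((g.sub j).germ U s : V) = g.germ U (j.app U s) :=
  rfl

variable (j) in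
/-- A subsheaf is saturated if its stalks are the intersections of the stalks of `E` with its
generic stalk. -/
def IsSaturated [Mono j] : Prop :=
  ∀ (x : C.X) (v : g.range j), (v : V) ∈ g.lattice x → v ∈ (g.sub j).lattice x

theorem IsSaturated.lattice_eq {g : GenericFiber E V} [Mono j] (h : g.IsSaturated j) :
    (g.sub j).lattice = PlaceSystem.comap (S := C.places) g.lattice (g.range j).subtype := by
  funext x
  apply le_antisymm
  · rintro _ ⟨U, hx, s, rfl⟩
    exact g.germ_mem_lattice hx _
  · exact fun v hv => h x v hv

/-- The sections of a saturated subsheaf are the sections of `E` whose germ at the generic point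
lies in its generic stalk. -/
theorem IsSaturated.exists_app_eq {g : GenericFiber E V} [Mono j] (h : g.IsSaturated j)
    {s : Γ(E, U)} (hs : g.germ U s ∈ g.range j) : ∃ t, j.app U t = s := by
  by_cases hU : Nonempty U
  · obtain ⟨t, ht⟩ := (g.sub j).exists_germ_eq (U := U) (v := ⟨_, hs⟩) fun x hx =>
      h x _ (g.germ_mem_lattice hx s)
    exact ⟨t, g.injective U (congrArg Subtype.val ht)⟩
  · have := subsingleton_sections (E := E) (eq_bot_of_not_nonempty hU)
    exact ⟨0, Subsingleton.elim _ _⟩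

section Coherent

variable [Module.Finite C.X.functionField V] {g : GenericFiber E V} [Mono j]

theorem IsSaturated.isCoherent (h : g.IsSaturated j) (hg : C.places.IsCoherent g.lattice) :
    C.places.IsCoherent (g.sub j).lattice := by
  rw [h.lattice_eq]
  exact hg.comap_subtype _

theorem IsSaturated.degree_eq (h : g.IsSaturated j) (hg : C.places.IsCoherent g.lattice) :
    degree E' = PlaceSystem.subDeg (S := C.places) g.lattice (g.range j) := by
  rw [(g.sub j).degree_eq (h.isCoherent hg), h.lattice_eq]
  rfl

theorem IsSaturated.rank_eq (h : g.IsSaturated j) (hg : C.places.IsCoherent g.lattice) :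
    rank E' = finrank C.X.functionField (g.range j) :=
  (g.sub j).rank_eq (h.isCoherent hg)

end Coherent

theorem range_eq_bot_iff [Mono j] : g.range j = ⊥ ↔ j = 0 := by
  constructor
  · intro h
    refine g.eq_zero_of_germ fun U s => ?_
    have := g.germ_mem_range j s
    rwa [h, Submodule.mem_bot] at this
  · rintro rfl
    rw [eq_bot_iff]
    rintro _ ⟨U, _, s, rfl⟩
    exact map_zero (g.germ U)

theorem range_eq_top_of_isIso [IsIso j] : g.range j = ⊤ := by
  rw [eq_top_iff]
  intro v _
  obtain ⟨U, h, s, rfl⟩ := g.exists_eq v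
  refine ⟨U, h, (inv j).app U s, ?_⟩
  rw [← comp_app_apply, IsIso.inv_hom_id]
  rfl

/-- A saturated subsheaf of full rank is everything. -/
theorem IsSaturated.isIso {g : GenericFiber E V} [Mono j] (h : g.IsSaturated j)
    (hj : g.range j = ⊤) : IsIso j :=
  isIso_of_app_bijective j fun U => ⟨app_injective_of_mono j U, fun _ =>
    h.exists_app_eq (hj ▸ Submodule.mem_top)⟩

theorem range_le_ker_iff (f : E ⟶ E'') (g'' : GenericFiber E'' V') :
    g.range j ≤ LinearMap.ker (g.map g'' f) ↔ j ≫ f = 0 := by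
  constructor
  · intro h
    refine g''.eq_zero_of_germ fun U s => ?_
    by_cases hU : Nonempty U
    · have := h (g.germ_mem_range j s)
      rwa [LinearMap.mem_ker, map_germ] at this
    · exact g''.germ_eq_zero hU _
  · rintro h _ ⟨U, _, s, rfl⟩
    rw [LinearMap.mem_ker, map_germ, ← comp_app_apply, h]
    exact map_zero (g''.germ U)

end Sub

end GenericFiber
end SmoothCurve
end

/-! ### Subbundles and subspaces of the generic fibre -/

noncomputable section

open Opposite Module

namespace SmoothCurve

variable {C : SmoothCurve} {E E' E'' : C.X.Modules} {U W : C.X.Opens} {x : C.X}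

namespace GenericFiber

variable {V : Type*} [AddCommGroup V] [Module C.X.functionField V] (g : GenericFiber E V)

section Subbundle

/-- A frame of a subbundle is part of a frame of `E`. -/
theorem isSaturated_of_isSubbundle {F : Subobject E} (hF : IsSubbundle F) :
    g.IsSaturated F.arrow := by
  intro x v hv
  obtain ⟨U, hx, m, n, s, t, hs, hst⟩ := hF x
  have : Nonempty U := ⟨⟨x, hx⟩⟩
  obtain ⟨b, hb⟩ := (g.sub F.arrow).exists_basis_of_isFrame hs
  obtain ⟨β, hβ⟩ := g.exists_basis_of_isFrame hst
  rw [← (g.sub F.arrow).span_of_isFrame hs hb hx, PlaceSystem.mem_span_basis]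
  rw [← g.span_of_isFrame hst hβ hx, PlaceSystem.mem_span_basis] at hv
  intro i
  have h1 : β.repr (v : V) (Sum.inl i) = b.repr v i := by
    have h2 : (v : V) = ∑ k, Sum.elim (b.repr v) (0 : Fin n → C.X.functionField) k • β k := by
      conv_lhs => rw [← b.sum_repr v]
      simp [hβ, hb, coe_sub_germ]
    rw [h2, β.repr_sum_self]
    rfl
  rw [← h1]
  exact hv _

/-- At each point, a basis of the stalk of a saturated subsheaf extends to a basis of the stalk of
`E`, as the quotient is a lattice, hence free. These bases are frames over a neighbourhood. -/
theorem isSubbundle_of_isSaturated [Module.Finite C.X.functionField V]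
    (hg : C.places.IsCoherent g.lattice) {F : Subobject E}
    (hF : g.IsSaturated F.arrow) : IsSubbundle F := by
  intro x
  let R := g.range F.arrow
  have hgF := hF.isCoherent hg
  have hQ := (hg.exact R.injective_subtype (LinearMap.exact_subtype_mkQ R) R.mkQ_surjective).2
  have := hgF.isLattice x
  have := hQ.isLattice x
  obtain ⟨γ₁, hγ₁⟩ := Submodule.IsLattice.exists_basis ((g.sub F.arrow).lattice x)
  obtain ⟨γ₃, hγ₃⟩ :=
    Submodule.IsLattice.exists_basis (PlaceSystem.map (S := C.places) g.lattice R.mkQ x)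
  have hl : ∀ j, ∃ v ∈ g.lattice x, R.mkQ v = γ₃ j := fun j => by
    have : γ₃ j ∈ PlaceSystem.map (S := C.places) g.lattice R.mkQ x :=
      hγ₃ ▸ Submodule.subset_span ⟨j, rfl⟩
    exact this
  choose t ht hpt using hl
  obtain ⟨γ, hγ⟩ := Module.Basis.exists_sumElim R.injective_subtype
    (LinearMap.exact_subtype_mkQ R) γ₁ γ₃ t hpt
  have hspan := PlaceSystem.span_eq_of_exact (S := C.places) (LinearMap.exact_subtype_mkQ R) hγ hpt
    ht (hγ₁.trans (congrFun hF.lattice_eq x)) hγ₃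
  obtain ⟨U₁, hx₁, hU₁⟩ := exists_nhd_span_eq hgF hγ₁
  obtain ⟨U₂, hx₂, hU₂⟩ := exists_nhd_span_eq hg hspan
  have : Nonempty (U₁ ⊓ U₂ : C.X.Opens) := ⟨⟨x, hx₁, hx₂⟩⟩
  obtain ⟨s, hs, hsF⟩ := (g.sub F.arrow).exists_isFrame_of_basis (U := U₁ ⊓ U₂) γ₁
    fun y hy => hU₁ y hy.1
  obtain ⟨u, hu, huF⟩ := g.exists_isFrame_of_basis (U := U₁ ⊓ U₂) γ fun y hy => hU₂ y hy.2
  refine ⟨U₁ ⊓ U₂, ⟨hx₁, hx₂⟩, _, _, s, fun i => u (Sum.inr i), hsF, ?_⟩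
  convert huF using 1
  funext k
  rcases k with k | k
  · apply g.injective
    rw [← hu, hγ]
    change g.germ _ _ = (γ₁ k : V)
    rw [hs, coe_sub_germ]
    rfl
  · rfl

/-- The subsheaf of sections of `E` whose germ at the generic point lies in a subspace. -/
def subsheaf (A : Submodule C.X.functionField V) : Subsheaf E where
  sections U :=
    { carrier := {s | g.germ U s ∈ A}
      add_mem' := fun {a b} ha hb => by
        rw [Set.mem_ofPred_eq, map_add]
        exact A.add_mem ha hb
      zero_mem' := by
        rw [Set.mem_ofPred_eq, map_zero]
        exact A.zero_mem
      smul_mem' := fun a s hs => by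
        by_cases hU : Nonempty U
        · rw [Set.mem_ofPred_eq, germ_smul]
          exact A.smul_mem _ hs
        · rw [Set.mem_ofPred_eq, g.germ_eq_zero hU]
          exact A.zero_mem }
  res_mem {U W} h s hs := by
    change g.germ W _ ∈ A
    by_cases hW : Nonempty W
    · rw [germ_res]
      exact hs
    · rw [g.germ_eq_zero hW]
      exact A.zero_mem
  mem_of_local {U s} hs := by
    change g.germ U _ ∈ A
    by_cases hU : Nonempty U
    · obtain ⟨x, hx⟩ := hU
      obtain ⟨W, hxW, h, hW⟩ := hs x hx
      have : Nonempty W := ⟨⟨x, hxW⟩⟩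
      rw [← g.germ_res h]
      exact hW
    · rw [g.germ_eq_zero hU]
      exact A.zero_mem

/-- The subsheaf of `E` with a given generic stalk, which is saturated. -/
def subobject (A : Submodule C.X.functionField V) : Subobject E := Subobject.mk (g.subsheaf A).ι

variable (A : Submodule C.X.functionField V)

theorem subobject_factors {f : E' ⟶ E}
    (hf : ∀ (U : C.X.Opens) (s : Γ(E', U)), g.germ U (f.app U s) ∈ A) : (g.subobject A).Factors f :=
  (Subobject.mk_factors_iff _ _).2 ⟨(g.subsheaf A).lift f hf, (g.subsheaf A).lift_ι f hf⟩

theorem germ_subobject_mem (s : Γ((g.subobject A : C.X.Modules), U)) :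
    g.germ U ((g.subobject A).arrow.app U s) ∈ A := by
  have h : (Subobject.underlyingIso (g.subsheaf A).ι).hom ≫ (g.subsheaf A).ι =
      (g.subobject A).arrow := Subobject.underlyingIso_hom_comp_eq_mk _
  have h' : (g.subobject A).arrow.app U s = (g.subsheaf A).ι.app U
      ((Subobject.underlyingIso (g.subsheaf A).ι).hom.app U s) :=
    congr(Scheme.Modules.Hom.app $h.symm U s)
  rw [h']
  exact (g.subsheaf A).ι_mem _

theorem exists_subobject_eq {s : Γ(E, U)} (hs : g.germ U s ∈ A) :
    ∃ t, (g.subobject A).arrow.app U t = s := by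
  obtain ⟨t, rfl⟩ := (g.subsheaf A).exists_ι_eq (U := U) (s := s) hs
  refine ⟨(Subobject.underlyingIso (g.subsheaf A).ι).inv.app U t, ?_⟩
  exact congr(Scheme.Modules.Hom.app $(Subobject.underlyingIso_arrow (g.subsheaf A).ι) U t)

theorem range_subobject : g.range (g.subobject A).arrow = A := by
  apply le_antisymm
  · rintro _ ⟨U, _, s, rfl⟩
    exact g.germ_subobject_mem A s
  · intro v hv
    obtain ⟨U, h, s, rfl⟩ := g.exists_eq v
    obtain ⟨t, rfl⟩ := g.exists_subobject_eq A hv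
    exact ⟨U, h, t, rfl⟩

theorem isSaturated_subobject : g.IsSaturated (g.subobject A).arrow := by
  rintro x ⟨v, hv⟩ hvx
  obtain ⟨U, hx, s, rfl⟩ := hvx
  rw [range_subobject] at hv
  obtain ⟨t, rfl⟩ := g.exists_subobject_eq A hv
  exact ⟨U, hx, t, rfl⟩

end Subbundle

section Quotient

variable (A : Submodule C.X.functionField V) (π : E ⟶ E') [Epi π]
  (hπ : ∀ (U : C.X.Opens) (s : Γ(E, U)), π.app U s = 0 ↔ g.germ U s ∈ A)

/-- The generic stalk of a quotient sheaf by a saturated subsheaf, as a quotient space. The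
hypothesis `hπ` says that the kernel of `π` consists of the sections with germ in `A`. -/
def quot : GenericFiber E' (V ⧸ A) := by
  refine ofRel (fun U q v => ∃ (W : C.X.Opens) (_ : Nonempty W) (h : W ≤ U) (s : Γ(E, W)),
    π.app W s = res E' h q ∧ v = A.mkQ (g.germ W s)) ?_ ?_ ?_ ?_ ?_ ?_ ?_
  · intro U _ q
    obtain ⟨W, hW, h, s, hs⟩ := exists_local_lift_of_epi π q (genericPoint_mem U)
    exact ⟨_, W, ⟨⟨_, hW⟩⟩, h, s, hs, rfl⟩
  · rintro U _ q _ _ ⟨W, _, h, s, hs, rfl⟩ ⟨W', _, h', s', hs', rfl⟩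
    rw [← sub_eq_zero, ← map_sub, ← g.germ_res (inf_le_left : W ⊓ W' ≤ W),
      ← g.germ_res (inf_le_right : W ⊓ W' ≤ W'), ← map_sub]
    refine (Submodule.Quotient.mk_eq_zero A).2 ((hπ _ _).1 ?_)
    rw [map_sub, app_res, app_res, hs, hs', res_res, res_res, sub_self]
  · rintro U _ q q' _ _ ⟨W, _, h, s, hs, rfl⟩ ⟨W', _, h', s', hs', rfl⟩
    refine ⟨W ⊓ W', inferInstance, inf_le_left.trans h, res E inf_le_left s + res E inf_le_right s',
      ?_, ?_⟩
    · rw [map_add, app_res, app_res, hs, hs', res_res, res_res, res_add]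
    · rw [map_add, map_add, germ_res, germ_res]
  · rintro U _ a q _ ⟨W, _, h, s, hs, rfl⟩
    refine ⟨W, inferInstance, h, C.X.presheaf.map (homOfLE h).op a • s, ?_, ?_⟩
    · rw [app_smul, hs, res_smul]
    · rw [germ_smul, germToFunctionField_map, map_smul]
  · rintro U U' _ _ hU q _ ⟨W, _, h, s, hs, rfl⟩
    refine ⟨W ⊓ U', inferInstance, inf_le_right, res E inf_le_left s, ?_, ?_⟩
    · rw [app_res, hs, res_res, res_res]
    · rw [germ_res]
  · rintro U _ q ⟨W, _, h, s, hs, hv⟩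
    have h0 : res E' h q = 0 := by
      rw [← hs, hπ]
      exact (Submodule.Quotient.mk_eq_zero A).1 hv.symm
    refine section_ext _ _ fun x hx => ?_
    obtain ⟨W', hx', h', s', hs'⟩ := exists_local_lift_of_epi π q hx
    have : Nonempty W' := ⟨⟨x, hx'⟩⟩
    refine ⟨W', hx', h', ?_⟩
    rw [res_zero, ← hs', hπ, ← g.germ_res (inf_le_right : W ⊓ W' ≤ W'), ← hπ, app_res, hs', res_res,
      ← res_res h inf_le_left, h0, res_zero]
  · intro v
    obtain ⟨v, rfl⟩ := A.mkQ_surjective v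
    obtain ⟨U, h, s, rfl⟩ := g.exists_eq v
    exact ⟨U, h, π.app U s, U, h, le_rfl, s, (res_self _).symm, rfl⟩

theorem quot_germ [Nonempty U] (s : Γ(E, U)) :
    (g.quot A π hπ).germ U (π.app U s) = A.mkQ (g.germ U s) :=
  ofRel_germ ⟨U, inferInstance, le_rfl, s, (res_self _).symm, rfl⟩

theorem quot_lattice :
    (g.quot A π hπ).lattice = PlaceSystem.map (S := C.places) g.lattice A.mkQ := by
  funext x
  apply le_antisymm
  · rintro _ ⟨U, hx, q, rfl⟩
    obtain ⟨W, hW, h, s, hs⟩ := exists_local_lift_of_epi π q hx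
    have : Nonempty W := ⟨⟨x, hW⟩⟩
    refine ⟨g.germ W s, g.germ_mem_lattice hW s, ?_⟩
    rw [← germ_res _ h, ← hs, quot_germ]
    rfl
  · rintro _ ⟨_, ⟨U, hx, s, rfl⟩, rfl⟩
    have : Nonempty U := ⟨⟨x, hx⟩⟩
    exact ⟨U, hx, π.app U s, g.quot_germ A π hπ s⟩

end Quotient

end GenericFiber
end SmoothCurve
end

/-! ### Harder–Narasimhan filtrations and stability -/

noncomputable section

open Opposite Module

namespace SmoothCurve

variable {C : SmoothCurve} {E E' H : C.X.Modules} {U : C.X.Opens}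

namespace GenericFiber

variable {V : Type*} [AddCommGroup V] [Module C.X.functionField V] (g : GenericFiber E V)

theorem range_arrow_mono {F G : Subobject E} (h : F ≤ G) : g.range F.arrow ≤ g.range G.arrow := by
  rintro _ ⟨U, _, s, rfl⟩
  have h' : F.arrow.app U s = G.arrow.app U ((Subobject.ofLE F G h).app U s) :=
    congr(Scheme.Modules.Hom.app $((Subobject.ofLE_arrow h).symm) U s)
  rw [h']
  exact g.germ_mem_range _ _

theorem range_arrow_eq_bot_iff {F : Subobject E} : g.range F.arrow = ⊥ ↔ F = ⊥ := by
  rw [range_eq_bot_iff]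
  constructor
  · intro h
    rw [← Subobject.mk_arrow F, Subobject.mk_eq_bot_iff_zero]
    exact h
  · rintro rfl
    exact Subobject.bot_arrow

theorem range_arrow_eq_top_iff {F : Subobject E} (hF : g.IsSaturated F.arrow) :
    g.range F.arrow = ⊤ ↔ F = ⊤ := by
  rw [← Subobject.isIso_arrow_iff_eq_top]
  exact ⟨hF.isIso, fun _ => g.range_eq_top_of_isIso⟩

section Filtration

variable [Module.Finite C.X.functionField V]

/-- The degree and the rank are additive on quotients of saturated subsheaves. -/
theorem degree_cokernel_ofLE (hg : C.places.IsCoherent g.lattice) {F G : Subobject E} (h : F ≤ G)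
    (hF : g.IsSaturated F.arrow) (hG : g.IsSaturated G.arrow) :
    PlaceSystem.subDeg (S := C.places) g.lattice (g.range G.arrow) =
        PlaceSystem.subDeg (S := C.places) g.lattice (g.range F.arrow) +
          degree (cokernel (Subobject.ofLE F G h)) ∧
      finrank C.X.functionField (g.range G.arrow) =
        finrank C.X.functionField (g.range F.arrow) + rank (cokernel (Subobject.ofLE F G h)) := by
  let B := g.range G.arrow
  let A : Submodule C.X.functionField B := (g.range F.arrow).comap B.subtype
  have harr (U : C.X.Opens) (t : Γ((F : C.X.Modules), U)) :
      G.arrow.app U ((Subobject.ofLE F G h).app U t) = F.arrow.app U t :=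
    congr(Scheme.Modules.Hom.app $(Subobject.ofLE_arrow h) U t)
  have hπ (U : C.X.Opens) (s : Γ((G : C.X.Modules), U)) :
      (cokernel.π (Subobject.ofLE F G h)).app U s = 0 ↔ (g.sub G.arrow).germ U s ∈ A := by
    change _ ↔ g.germ U (G.arrow.app U s) ∈ g.range F.arrow
    constructor
    · intro hs
      obtain ⟨t, rfl⟩ := exists_app_eq_of_cokernel _ hs
      rw [harr]
      exact g.germ_mem_range _ _
    · intro hs
      obtain ⟨t, ht⟩ := hF.exists_app_eq hs
      rw [← harr] at ht
      rw [← app_injective_of_mono G.arrow U ht]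
      exact congr(Scheme.Modules.Hom.app $(cokernel.condition (Subobject.ofLE F G h)) U t)
  obtain ⟨h1, h2, h3⟩ := hg.subDeg_add (g.range_arrow_mono h) A.mkQ A.mkQ_surjective
    fun b => Submodule.Quotient.mk_eq_zero A
  let q := (g.sub G.arrow).quot A (cokernel.π (Subobject.ofLE F G h)) hπ
  have hq : q.lattice = PlaceSystem.map (S := C.places)
      (PlaceSystem.comap (S := C.places) g.lattice B.subtype) A.mkQ :=
    ((g.sub G.arrow).quot_lattice A _ hπ).trans
      congr(PlaceSystem.map (S := C.places) $(hG.lattice_eq) A.mkQ)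
  rw [← hq] at h1 h2
  rw [h2, h3, q.degree_eq h1, q.rank_eq h1]
  exact ⟨rfl, rfl⟩

/-- The first piece of a Harder–Narasimhan filtration has at least the slope of the bundle,
because all graded pieces have at most the slope `μ` of the first one. -/
theorem exists_slope_piece_one (hg : C.places.IsCoherent g.lattice) (F : HNFiltration E)
    (hE : (⊥ : Subobject E) ≠ ⊤) :
    F.piece 1 ≠ ⊥ ∧ ∃ μ : ℚ,
      PlaceSystem.subDeg (S := C.places) g.lattice (g.range (F.piece 1).arrow) =
        μ * finrank C.X.functionField (g.range (F.piece 1).arrow) ∧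
      C.places.deg g.lattice ≤ μ * finrank C.X.functionField V := by
  obtain ⟨n, p, hp, h0, hn, hsub, -, hslope⟩ := F
  dsimp only
  obtain _ | n := n
  · exact absurd (h0.symm.trans hn) hE
  have hsat i := g.isSaturated_of_isSubbundle (hsub i)
  let Q := gradedPiece p hp.monotone
  have hstep (i : Fin (n + 1)) := g.degree_cokernel_ofLE hg
    (hp.monotone i.castSucc_lt_succ.le) (hsat i.castSucc) (hsat i.succ)
  -- a graded piece of rank zero has degree zero, so that its slope determines its degree
  have hdeg (i : Fin (n + 1)) : (degree (Q i) : ℚ) = slope (Q i) * rank (Q i) := by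
    rcases eq_or_ne (rank (Q i)) 0 with h | h
    · have h1 := Submodule.eq_of_le_of_finrank_eq
        (g.range_arrow_mono (hp.monotone i.castSucc_lt_succ.le))
        ((hstep i).2.trans (congrArg _ h)).symm
      have h2 : degree (Q i) = 0 := by
        have := (hstep i).1
        rw [h1] at this
        exact left_eq_add.1 this
      rw [h, h2]
      simp
    · rw [slope, div_mul_cancel₀]
      exact_mod_cast h
  have hbot : g.range (p 0).arrow = ⊥ := g.range_arrow_eq_bot_iff.2 h0
  have hle (i : Fin (n + 1)) : slope (Q i) ≤ slope (Q 0) := by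
    rcases eq_or_ne i 0 with rfl | hi
    · exact le_rfl
    · exact (hslope 0 i (Fin.pos_iff_ne_zero.2 hi)).le
  have hsum (i : Fin (n + 2)) :
      (PlaceSystem.subDeg (S := C.places) g.lattice (g.range (p i).arrow) : ℚ) ≤
        slope (Q 0) * finrank C.X.functionField (g.range (p i).arrow) := by
    induction i using Fin.induction with
    | zero =>
      rw [hbot, hg.subDeg_bot]
      simp
    | succ i ih =>
      rw [(hstep i).1, (hstep i).2]
      have h1 : (degree (Q i) : ℚ) ≤ slope (Q 0) * rank (Q i) :=
        (hdeg i).trans_le (mul_le_mul_of_nonneg_right (hle i) (Nat.cast_nonneg _))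
      change ((_ + degree (Q i) : ℤ) : ℚ) ≤ _ * ((_ + rank (Q i) : ℕ) : ℚ)
      push_cast
      linarith
  refine ⟨?_, slope (Q 0), ?_, ?_⟩
  · exact fun h => (hp (Fin.zero_lt_one (n := n))).ne (h0.trans h.symm)
  · have h1 := (hstep 0).1
    have h2 := (hstep 0).2
    change _ = PlaceSystem.subDeg _ (g.range (p 0).arrow) + degree (Q 0) at h1
    change _ = finrank _ (g.range (p 0).arrow) + rank (Q 0) at h2
    have hfin : finrank C.X.functionField (g.range (p 0).arrow) = 0 :=
      Submodule.finrank_eq_zero.2 hbot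
    rw [hbot, hg.subDeg_bot, zero_add] at h1
    replace h2 := h2.trans (congrArg (· + rank (Q 0)) hfin)
    rw [zero_add] at h2
    exact (congrArg Int.cast h1).trans
      ((hdeg 0).trans (congrArg (fun k : ℕ => slope (Q 0) * (k : ℚ)) h2.symm))
  · have h1 := hsum (Fin.last _)
    have htop : g.range (p (Fin.last _)).arrow = ⊤ :=
      (g.range_arrow_eq_top_iff (hsat _)).2 hn
    rwa [htop, hg.subDeg_top, finrank_top] at h1

end Filtration

end GenericFiber

namespace FramedHitchinPair

open GenericFiber

variable {V V' : Type*} [AddCommGroup V] [Module C.X.functionField V]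
  [Module.Finite C.X.functionField V] [AddCommGroup V'] [Module C.X.functionField V']

/-- In a stable constrained framed Hitchin pair, no subspace of the kernel of the framing violates
the inequality of stability, invariant or not: the kernel is invariant under the Higgs field, so
that a violating subspace would give an invariant one. -/
theorem IsStable.twistedDeg_neg {P : FramedHitchinPair H} {σ : ℚ} (h : P.IsStable σ)
    (hP : P.IsConstrained) (hψ : P.ψ ≠ 0) (g : GenericFiber P.E V)
    (hg : C.places.IsCoherent g.lattice) (g' : GenericFiber H V')
    {W : Submodule C.X.functionField V} (hW : W ≠ ⊥)
    (hWψ : W ≤ LinearMap.ker (g.map g' P.ψ)) :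
    PlaceSystem.twistedDeg (S := C.places) g.lattice (framedSlope σ P.ψ) W < 0 := by
  by_contra! hWc
  have hN : LinearMap.ker (g.map g' P.ψ) ≤
      (LinearMap.ker (g.map g' P.ψ)).comap (g.map g P.φ) := by
    obtain ⟨w, hw⟩ := hP
    intro v hv
    obtain ⟨U, _, s, rfl⟩ := g.exists_eq v
    rw [LinearMap.mem_ker, map_germ] at hv
    rw [Submodule.mem_comap, LinearMap.mem_ker, map_germ, map_germ, ← comp_app_apply, hw,
      germ_smul, hv, smul_zero]
  obtain ⟨A, hA, hAψ, hAφ, hAc⟩ := hg.exists_invariant _ (g.map g P.φ)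
    (fun x v hv => g.map_mem_lattice g P.φ hv) _ hN W hW hWψ hWc
  have hr := g.range_subobject A
  have hs := g.isSaturated_subobject A
  have hcomp : (g.subobject A).arrow ≫ P.ψ = 0 :=
    (g.range_le_ker_iff P.ψ g').1 (hr.symm ▸ hAψ)
  have hlt := h (g.subobject A) (g.isSubbundle_of_isSaturated hg hs)
    (fun h0 => hA (hr.symm.trans (g.range_arrow_eq_bot_iff.2 h0)))
    (fun h1 => by
      have : IsIso (g.subobject A).arrow := (Subobject.isIso_arrow_iff_eq_top _).2 h1
      exact hψ ((cancel_epi (g.subobject A).arrow).1 (hcomp.trans comp_zero.symm)))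
    (by
      have hf : (g.subobject A).Factors ((g.subobject A).arrow ≫ P.φ) := by
        refine g.subobject_factors A fun U s => ?_
        by_cases hU : Nonempty U
        · rw [comp_app_apply, ← g.map_germ g]
          exact hAφ (g.germ_subobject_mem A s)
        · rw [g.germ_eq_zero hU]
          exact A.zero_mem
      exact ⟨_, (g.subobject A).factorThru_arrow _ hf⟩)
  have hpos : (0 : ℚ) < finrank C.X.functionField A :=
    Nat.cast_pos.2 (Submodule.one_le_finrank_iff.2 hA)
  rw [PlaceSystem.twistedDeg] at hAc
  rw [framedSlope, if_pos hcomp, hs.degree_eq hg, hs.rank_eq hg, hr, div_lt_iff₀ hpos] at hlt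
  linarith

end FramedHitchinPair

end SmoothCurve

end

theorem theorem4p3 (C : SmoothCurve) (H : C.X.Modules) (hH : SmoothCurve.IsVectorBundle H)
    (σ : ℚ) (hσ : 0 < σ) (P : SmoothCurve.FramedHitchinPair H) (hP : P.IsConstrained)
    (hψ : P.ψ ≠ 0)
    (hE : SmoothCurve.IsSemistable P.E ∨
      (¬ SmoothCurve.IsSemistable P.E ∧
        ∃ F : SmoothCurve.HNFiltration P.E, F.piece 1 ≤ kernelSubobject P.ψ)) :
    P.IsStable σ ↔ P.toFramedModule.IsStable σ := by
  refine ⟨fun h => ?_, fun h F hF h0 h1 _ => h F hF h0 h1⟩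
  obtain ⟨r, ⟨g⟩⟩ := SmoothCurve.GenericFiber.exists_genericFiber P.isVectorBundle
  obtain ⟨r', ⟨g'⟩⟩ := SmoothCurve.GenericFiber.exists_genericFiber hH
  have hg := g.isCoherent P.isVectorBundle
  have hneg (F : Subobject P.E) (h0 : F ≠ ⊥) (hF : F.arrow ≫ P.ψ = 0) :=
    h.twistedDeg_neg hP hψ g hg g' (mt g.range_arrow_eq_bot_iff.1 h0)
      ((g.range_le_ker_iff P.ψ g').2 hF)
  have hψc : SmoothCurve.framedSlope σ P.ψ =
      (SmoothCurve.degree P.E - σ) / SmoothCurve.rank P.E := by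
    rw [SmoothCurve.framedSlope, if_neg hψ, one_mul]
  obtain hE | ⟨-, HN, hHN⟩ := hE
  · intro F hF h0 h1
    have hs := g.isSaturated_of_isSubbundle hF
    have hr := mt g.range_arrow_eq_bot_iff.1 h0
    have hpos : (0 : ℚ) < SmoothCurve.rank (F : C.X.Modules) := by
      rw [hs.rank_eq hg]
      exact Nat.cast_pos.2 (Submodule.one_le_finrank_iff.2 hr)
    by_cases hF0 : F.arrow ≫ P.ψ = 0
    · have hlt := hneg F h0 hF0
      rw [PlaceSystem.twistedDeg, ← hs.degree_eq hg, ← hs.rank_eq hg] at hlt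
      rw [SmoothCurve.framedSlope, if_pos hF0, div_lt_iff₀ hpos]
      linarith
    · -- both framings are nonzero, and dividing `σ` by a smaller rank subtracts more
      have hlt : (SmoothCurve.rank (F : C.X.Modules) : ℚ) < SmoothCurve.rank P.E := by
        rw [hs.rank_eq hg, g.rank_eq hg]
        exact Nat.cast_lt.2 (Submodule.finrank_lt
          (lt_top_iff_ne_top.2 (mt (g.range_arrow_eq_top_iff hs).1 h1)).ne)
      have hle := hE F hF h0 h1
      have h2 := div_lt_div_of_pos_left hσ hpos hlt
      rw [SmoothCurve.slope, SmoothCurve.slope] at hle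
      rw [hψc, SmoothCurve.framedSlope, if_neg hF0, one_mul, sub_div, sub_div]
      linarith
  · have hbt : (⊥ : Subobject P.E) ≠ ⊤ := by
      intro hbt
      have := (Subobject.isIso_arrow_iff_eq_top _).2 hbt
      refine hψ ((cancel_epi (⊥ : Subobject P.E).arrow).1 ?_)
      rw [Subobject.bot_arrow, zero_comp, zero_comp]
    -- the first piece of the filtration violates stability, so that the pair is not stable
    obtain ⟨h0, μ, hμ, hdeg⟩ := g.exists_slope_piece_one hg HN hbt
    have hker : (HN.piece 1).arrow ≫ P.ψ = 0 := by
      rw [← Subobject.ofLE_arrow hHN, Category.assoc, kernelSubobject_arrow_comp, comp_zero]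
    have hlt := hneg _ h0 hker
    have hV : (0 : ℚ) < Module.finrank C.X.functionField (Fin r → C.X.functionField) := by
      refine Nat.cast_pos.2 ((Submodule.one_le_finrank_iff.2
        (mt g.range_arrow_eq_bot_iff.1 h0)).trans (Submodule.finrank_le _))
    have hc : SmoothCurve.framedSlope σ P.ψ ≤ μ := by
      rw [hψc, g.degree_eq hg, g.rank_eq hg, div_le_iff₀ hV]
      linarith
    rw [PlaceSystem.twistedDeg, hμ, ← sub_mul] at hlt
    exact absurd hlt (not_lt.2 (mul_nonneg (sub_nonneg.2 hc) (Nat.cast_nonneg _)))
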